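/- Let $n\ge 2$, $s_0>0$, and let $\lambda,\Lambda$ be positive constants. There is a constant $C>0$, depending only on $n$, $\lambda$, $\Lambda$ and $s_0$, with the following property. Let $s\in(s_0,1)$, let $W\in C^3(\mathbb R)$ be arbitrary, and let $K:\mathbb R^n\setminus\{0\}\to\mathbb R$ be of class $C^2$ with $$K(z)=K(-z),\qquad \frac{(2-s)\lambda}{|z|^{n+s}}\le K(z)\le\frac{(2-s)\Lambda}{|z|^{n+s}},\qquad \max\bigl\{|z|\,|\partial_eK(z)|,\ |z|^2|\partial_{ee}K(z)|\bigr\}\le\frac{(2-s)\Lambda}{|z|^{n+s}}$$ for all $z\in\mathbb R^n\setminus\{0\}$ and all unit vectors $e$. Put $L_Ku(x)=\int_{\mathbb R^n}(u(x)-u(\bar x))K(x-\bar x)\,d\bar x$. Let $R>0$, write $B_r$ for the open ball of radius $r$ centred at $0$, and let $u:\mathbb R^n\to(-1,1)$ be a stable solution of $L_Ku+W'(u)=0$ in $B_{2R}$; that is, $u$ is measurable on $\mathbb R^n$, is of class $C^2$ in $B_{2R}$, satisfies the equation at every point of $B_{2R}$, and $$\frac12\iint_{\mathbb R^n\times\mathbb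 R^n}|\xi(x)-\xi(\bar x)|^2K(x-\bar x)\,dx\,d\bar x+\int_{\mathbb R^n}W''(u)\,\xi^2\,dx\ge 0$$ for every compactly supported Lipschitz function $\xi:\mathbb R^n\to\mathbb R$ vanishing outside $B_{2R}$. Then $$\mathcal E^{\rm Sob}_{B_R}(u):=\frac14\iint_{(\mathbb R^n\times\mathbb R^n)\setminus(B_R^c\times B_R^c)}|u(x)-u(\bar x)|^2K(x-\bar x)\,dx\,d\bar x\ \le\ \frac{C}{(1-s)^2}\,R^{n-s}.$$ -/

import Mathlib

open MeasureTheory Set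
open scoped ENNReal

/-- The ellipticity class `𝓛₂(s, lam, Lam)` of kernels on `ℝⁿ`. The value `K 0` plays no role.
Here `∂ₑK(z)` is `fderiv ℝ K z e` and `∂ₑₑK(z)` is the derivative in direction `e` of `∂ₑK`. -/
structure IsKernelL2 {n : ℕ} (s lam Lam : ℝ) (K : EuclideanSpace ℝ (Fin n) → ℝ) : Prop where
  symm : ∀ z, K z = K (-z)
  lower : ∀ z, z ≠ 0 → (2 - s) * lam / ‖z‖ ^ ((n : ℝ) + s) ≤ K z
  upper : ∀ z, z ≠ 0 → K z ≤ (2 - s) * Lam / ‖z‖ ^ ((n : ℝ) + s)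
  contDiffOn : ContDiffOn ℝ 2 K {0}ᶜ
  deriv_bound : ∀ z, z ≠ 0 → ∀ e : EuclideanSpace ℝ (Fin n), ‖e‖ = 1 →
    max (‖z‖ * |fderiv ℝ K z e|) (‖z‖ ^ 2 * |fderiv ℝ (fun y => fderiv ℝ K y e) z e|)
      ≤ (2 - s) * Lam / ‖z‖ ^ ((n : ℝ) + s)

/-- The operator `L_K u(x) = ∫ (u(x) - u(y)) K(x - y) dy`. For `K` in the class above with
`0 < s < 1` and `u` bounded, measurable and `C²` near `x`, the integral converges absolutely. -/
noncomputable def nonlocalOp {n : ℕ} (K u : EuclideanSpace ℝ (Fin n) → ℝ)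
    (x : EuclideanSpace ℝ (Fin n)) : ℝ :=
  ∫ y, (u x - u y) * K (x - y)

/-- `u` is a solution of `L_K u + W'(u) = 0` in `Ω`: a bounded (Lebesgue measurable) function on
all of `ℝⁿ` which is `C²` in `Ω` and satisfies the equation at every point of `Ω`. -/
structure IsNonlocalSolution {n : ℕ} (K : EuclideanSpace ℝ (Fin n) → ℝ) (W : ℝ → ℝ)
    (Ω : Set (EuclideanSpace ℝ (Fin n))) (u : EuclideanSpace ℝ (Fin n) → ℝ) : Prop where
  aemeasurable : AEMeasurable u volume
  bounded : ∃ M : ℝ, ∀ x, |u x| ≤ M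
  contDiffOn : ContDiffOn ℝ 2 u Ω
  equation : ∀ x ∈ Ω, nonlocalOp K u x + deriv W (u x) = 0

/-- `u` is a stable solution of `L_K u + W'(u) = 0` in `Ω`: a solution at which the second
variation of the energy is nonnegative. Both integrals converge absolutely for such `ξ` when
`W` is `C²` and `K` is in the class above with `0 < s < 2`. -/
structure IsStableNonlocalSolution {n : ℕ} (K : EuclideanSpace ℝ (Fin n) → ℝ) (W : ℝ → ℝ)
    (Ω : Set (EuclideanSpace ℝ (Fin n))) (u : EuclideanSpace ℝ (Fin n) → ℝ) : Prop
    extends IsNonlocalSolution K W Ω u where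
  stable : ∀ ξ : EuclideanSpace ℝ (Fin n) → ℝ,
    (∃ L, LipschitzWith L ξ) → HasCompactSupport ξ → (∀ x, x ∉ Ω → ξ x = 0) →
    0 ≤ 1 / 2 * (∫ p : EuclideanSpace ℝ (Fin n) × EuclideanSpace ℝ (Fin n),
          |ξ p.1 - ξ p.2| ^ 2 * K (p.1 - p.2))
        + ∫ x, deriv (deriv W) (u x) * ξ x ^ 2

/-- The Sobolev part of the localized energy,
`1/4 ∬_{(ℝⁿ × ℝⁿ) ∖ (Ωᶜ × Ωᶜ)} |v(x) - v(y)|² K(x - y) dx dy`, with values in `[0, ∞]`. -/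
noncomputable def sobolevEnergy {n : ℕ} (K : EuclideanSpace ℝ (Fin n) → ℝ)
    (Ω : Set (EuclideanSpace ℝ (Fin n))) (v : EuclideanSpace ℝ (Fin n) → ℝ) : ℝ≥0∞ :=
  1 / 4 * ∫⁻ p in (univ ×ˢ univ) \ (Ωᶜ ×ˢ Ωᶜ),
    ENNReal.ofReal (|v p.1 - v p.2| ^ 2 * K (p.1 - p.2))

/-! The heart of the matter is an interior bound for the total variation, `V(7R/4) ≤ C/(1-s) *
R^(n-1)`, where `V(r)` is the integral of `‖∇u‖` over the closed ball of radius `r`. Given that,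
interpolation between `L^∞` and `W^(1,1)` bounds the Gagliardo energy by `R^(1-s)/(1-s)` times the
variation plus terms of order `R^(n-s)`, and pairs at distance at least `R/2` contribute a tail of
the same order. The square of `1/(1-s)` comes from one factor in the variation bound and one in the
interpolation.

For the variation bound, fix a direction `v`, write `ω = ∂ᵥu`, and let `η` be a cutoff. Test the
linearized equation with `η²ω` and stability with `|ηω|`. The terms in `W''` cancel, so nothing
about `W` enters the constant, and a pointwise identity leaves `∬ η(x)η(y)(|ω(x)ω(y)| - ω(x)ω(y))K ≤
½ ∬ (η(x)-η(y))² ω(x)ω(y) K + far term` (`IsStableNonlocalSolution.integral_cross_le`).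

On the left, `K` is at least a multiple of `R^(-n-s)` on the support of `η`, so the left side
controls `(∫ η|ω|)² - (∫ ηω)²`, and `∫ ηω` is harmless after one integration by parts. On the right,
`-2ω(x)ω(y)` is the mixed derivative of `(u(x)-u(y))²`. Two integrations by parts move both
derivatives onto `(η(x)-η(y))²K`, and the kernel bounds give `‖∇η‖²` times the Gagliardo energy
(`exists_cross_bound`). Interpolating that energy, for radii `r < ρ` with gap `d`, `V(r)² ≤ C/(1-s)
* (R/d)³ * R^(n-1) * (R^(n-1) + V(ρ))`. The right side is linear in `V(ρ)`, so the
arithmetic-geometric inequality and an iteration over increasing radii absorb it.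

Since `u` is `C²` only inside the ball, it is replaced by a compactly supported `C²` function `U`
equal to `u` near the support of `η`. The error `u - U` is merely measurable but lives at a positive
distance from that support, which produces the far term; there the derivative falls on `K`. -/

/-- The surface area of the unit sphere of `ℝⁿ`. -/
noncomputable def sphereArea (n : ℕ) : ℝ :=
  n * (volume : Measure (EuclideanSpace ℝ (Fin n))).real (Metric.ball 0 1)

/-- The Riesz kernel `|z|^(-n-s)`. -/
noncomputable def rieszKernel {n : ℕ} (s : ℝ) (z : EuclideanSpace ℝ (Fin n)) : ℝ :=
  ‖z‖ ^ (-((n : ℝ) + s))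

/-! ### Radial integrals of the Riesz kernel -/

section Radial

variable {n : ℕ}

local notation "𝔼" => EuclideanSpace ℝ (Fin n)

lemma sphereArea_pos (hn : 0 < n) : 0 < sphereArea n := by
  unfold sphereArea
  have : 0 < (volume : Measure 𝔼).real (Metric.ball 0 1) :=
    ENNReal.toReal_pos (Metric.measure_ball_pos _ _ one_pos).ne' measure_ball_lt_top.ne
  positivity

lemma rieszKernel_nonneg (s : ℝ) (z : 𝔼) : 0 ≤ rieszKernel s z :=
  Real.rpow_nonneg (norm_nonneg z) _

lemma rieszKernel_neg (s : ℝ) (z : 𝔼) : rieszKernel s (-z) = rieszKernel s z := by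
  simp [rieszKernel]

@[fun_prop]
lemma measurable_rieszKernel (s : ℝ) : Measurable (rieszKernel (n := n) s) :=
  (measurable_norm).pow_const _

lemma integral_fun_norm (hn : 0 < n) (f : ℝ → ℝ) :
    ∫ z : 𝔼, f ‖z‖ = sphereArea n * ∫ t in Ioi (0 : ℝ), t ^ (n - 1) * f t := by
  have : Nonempty (Fin n) := ⟨⟨0, hn⟩⟩
  rw [integral_fun_norm_addHaar volume f]
  simp [sphereArea, mul_assoc]

lemma integrable_fun_norm (hn : 0 < n) {f : ℝ → ℝ} :
    Integrable (fun z : 𝔼 => f ‖z‖) ↔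
      IntegrableOn (fun t : ℝ => t ^ (n - 1) * f t) (Ioi 0) := by
  have : Nonempty (Fin n) := ⟨⟨0, hn⟩⟩
  rw [integrable_fun_norm_addHaar volume (f := f)]
  simp

lemma pow_mul_rpow_dim (hn : 0 < n) {t : ℝ} (ht : 0 < t) (a : ℝ) :
    t ^ (n - 1) * t ^ (a - n) = t ^ (a - 1) := by
  rw [← Real.rpow_natCast, ← Real.rpow_add ht, Nat.cast_sub hn]
  congr 1
  push_cast
  ring

lemma integral_norm_rpow_ball (hn : 0 < n) {a r : ℝ} (ha : 0 < a) (hr : 0 < r) :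
    IntegrableOn (fun z : 𝔼 => ‖z‖ ^ (a - n)) (Metric.ball 0 r) ∧
      ∫ z in Metric.ball (0 : 𝔼) r, ‖z‖ ^ (a - n) = sphereArea n * (r ^ a / a) := by
  have e : (Metric.ball (0 : 𝔼) r).indicator (fun z : 𝔼 => ‖z‖ ^ (a - n)) =
      fun z => (Iio r).indicator (fun t : ℝ => t ^ (a - n)) ‖z‖ := by
    ext z
    simp [indicator]
  have e2 : EqOn (fun t : ℝ => t ^ (n - 1) * (Iio r).indicator (fun t : ℝ => t ^ (a - n)) t)
      ((Iio r).indicator (fun t : ℝ => t ^ (a - 1))) (Ioi 0) := by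
    intro t ht
    by_cases h : t < r
    · simp [h, pow_mul_rpow_dim hn ht]
    · simp [h]
  have e3 : IntegrableOn (fun t : ℝ => t ^ (a - 1)) (Iio r ∩ Ioi 0) := by
    rw [Iio_inter_Ioi, ← integrableOn_Ioc_iff_integrableOn_Ioo]
    exact (intervalIntegrable_iff_integrableOn_Ioc_of_le hr.le).1
      (intervalIntegral.intervalIntegrable_rpow' (by linarith))
  constructor
  · rw [← integrable_indicator_iff measurableSet_ball, e, integrable_fun_norm hn,
      integrableOn_congr_fun e2 measurableSet_Ioi, IntegrableOn,
      integrable_indicator_iff measurableSet_Iio, IntegrableOn,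
      Measure.restrict_restrict measurableSet_Iio]
    exact e3
  · rw [← integral_indicator measurableSet_ball, e, integral_fun_norm hn,
      setIntegral_congr_fun measurableSet_Ioi e2, integral_indicator measurableSet_Iio,
      Measure.restrict_restrict measurableSet_Iio, Iio_inter_Ioi, ← integral_Ioc_eq_integral_Ioo,
      ← intervalIntegral.integral_of_le hr.le, integral_rpow (Or.inl (by linarith))]
    simp [ha.ne']

lemma integral_norm_rpow_compl_ball (hn : 0 < n) {a r : ℝ} (ha : 0 < a) (hr : 0 < r) :
    IntegrableOn (fun z : 𝔼 => ‖z‖ ^ (-a - n)) (Metric.ball 0 r)ᶜ ∧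
      ∫ z in (Metric.ball (0 : 𝔼) r)ᶜ, ‖z‖ ^ (-a - n) = sphereArea n * (r ^ (-a) / a) := by
  have e : (Metric.ball (0 : 𝔼) r)ᶜ.indicator (fun z : 𝔼 => ‖z‖ ^ (-a - n)) =
      fun z => (Ici r).indicator (fun t : ℝ => t ^ (-a - n)) ‖z‖ := by
    ext z
    simp [indicator]
  have e2 : EqOn (fun t : ℝ => t ^ (n - 1) * (Ici r).indicator (fun t : ℝ => t ^ (-a - n)) t)
      ((Ici r).indicator (fun t : ℝ => t ^ (-a - 1))) (Ioi 0) := by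
    intro t ht
    by_cases h : r ≤ t
    · simp [h, pow_mul_rpow_dim hn ht]
    · simp [h]
  have e4 : Ici r ∩ Ioi 0 = Ici r := inter_eq_left.2 fun t ht => hr.trans_le ht
  have e3 : IntegrableOn (fun t : ℝ => t ^ (-a - 1)) (Ici r) := by
    rw [integrableOn_Ici_iff_integrableOn_Ioi]
    exact integrableOn_Ioi_rpow_of_lt (by linarith) hr
  constructor
  · rw [← integrable_indicator_iff measurableSet_ball.compl, e, integrable_fun_norm hn,
      integrableOn_congr_fun e2 measurableSet_Ioi, IntegrableOn,
      integrable_indicator_iff measurableSet_Ici, IntegrableOn,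
      Measure.restrict_restrict measurableSet_Ici, e4]
    exact e3
  · rw [← integral_indicator measurableSet_ball.compl, e, integral_fun_norm hn,
      setIntegral_congr_fun measurableSet_Ioi e2, integral_indicator measurableSet_Ici,
      Measure.restrict_restrict measurableSet_Ici, e4, integral_Ici_eq_integral_Ioi,
      integral_Ioi_rpow_of_lt (by linarith) hr]
    simp only [sub_add_cancel]
    field_simp

lemma norm_mul_rieszKernel (s : ℝ) (z : 𝔼) (hz : z ≠ 0) :
    ‖z‖ * rieszKernel s z = ‖z‖ ^ ((1 - s) - n) := by
  have : 0 < ‖z‖ := norm_pos_iff.2 hz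
  unfold rieszKernel
  nth_rw 1 [← Real.rpow_one ‖z‖]
  rw [← Real.rpow_add this]
  congr 1
  ring

lemma lintegral_norm_mul_rieszKernel_ball (hn : 0 < n) {s r : ℝ} (hs1 : s < 1)
    (hr : 0 < r) :
    ∫⁻ z in Metric.ball (0 : 𝔼) r, ENNReal.ofReal (‖z‖ * rieszKernel s z) =
      ENNReal.ofReal (sphereArea n * (r ^ (1 - s) / (1 - s))) := by
  have : Nonempty (Fin n) := ⟨⟨0, hn⟩⟩
  have h := integral_norm_rpow_ball hn (sub_pos.2 hs1) hr
  rw [← h.2, ofReal_integral_eq_lintegral_ofReal h.1 (.of_forall fun z => by positivity)]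
  refine lintegral_congr_ae ?_
  filter_upwards [ae_restrict_of_ae (Measure.ae_ne volume (0 : 𝔼))] with z hz
  rw [norm_mul_rieszKernel s z hz]

lemma lintegral_rieszKernel_compl_ball (hn : 0 < n) {s r : ℝ} (hs : 0 < s) (hr : 0 < r) :
    ∫⁻ z in (Metric.ball (0 : 𝔼) r)ᶜ, ENNReal.ofReal (rieszKernel s z) =
      ENNReal.ofReal (sphereArea n * (r ^ (-s) / s)) := by
  have h := integral_norm_rpow_compl_ball (n := n) hn hs hr
  rw [← h.2, ofReal_integral_eq_lintegral_ofReal h.1 (.of_forall fun z => by positivity)]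
  refine lintegral_congr fun z => ?_
  rw [rieszKernel, show -((n : ℝ) + s) = -s - n by ring]

/-- The range `0 < s < 1` is what makes one power of `‖z‖` sufficient: it tames the origin because
`s < 1`, and the kernel is integrable at infinity because `s > 0`. Hence no principal values are
needed anywhere. -/
lemma integrable_min_mul_rieszKernel (hn : 0 < n) {s : ℝ} (hs : 0 < s) (hs1 : s < 1) :
    Integrable (fun z : 𝔼 => min 1 ‖z‖ * rieszKernel s z) := by
  have hm : Measurable (fun z : 𝔼 => min 1 ‖z‖ * rieszKernel s z) := by fun_prop
  have h0 : ∀ z : 𝔼, 0 ≤ min 1 ‖z‖ * rieszKernel s z := fun z =>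
    mul_nonneg (le_min zero_le_one (norm_nonneg z)) (rieszKernel_nonneg s z)
  refine ⟨hm.aestronglyMeasurable, ?_⟩
  rw [hasFiniteIntegral_iff_ofReal (.of_forall h0),
    ← lintegral_add_compl _ (measurableSet_ball (x := (0 : 𝔼)) (ε := 1))]
  refine ENNReal.add_lt_top.2 ⟨?_, ?_⟩
  · refine lt_of_le_of_lt (lintegral_mono fun z => ?_)
      ((lintegral_norm_mul_rieszKernel_ball hn hs1 one_pos).trans_lt ENNReal.ofReal_lt_top)
    exact ENNReal.ofReal_le_ofReal
      (mul_le_mul_of_nonneg_right (min_le_right _ _) (rieszKernel_nonneg s z))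
  · refine lt_of_le_of_lt (lintegral_mono fun z => ?_)
      ((lintegral_rieszKernel_compl_ball hn hs one_pos).trans_lt ENNReal.ofReal_lt_top)
    refine ENNReal.ofReal_le_ofReal ?_
    nlinarith [min_le_left 1 ‖z‖, rieszKernel_nonneg s z]

end Radial

/-! ### Double integrals in difference variables -/

section ProductIntegrals

variable {n : ℕ}

local notation "𝔼" => EuclideanSpace ℝ (Fin n)

/-- The weight `(1_{B_M}(x) + 1_{B_M}(y)) min(1, |x - y|) |x - y|^(-n-s)` on `ℝⁿ × ℝⁿ`. -/
noncomputable def pairWeight (s M : ℝ) (p : 𝔼 × 𝔼) : ℝ :=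
  ((Metric.ball (0 : 𝔼) M).indicator (fun _ => (1 : ℝ)) p.1 +
    (Metric.ball (0 : 𝔼) M).indicator (fun _ => (1 : ℝ)) p.2) *
    (min 1 ‖p.1 - p.2‖ * rieszKernel s (p.1 - p.2))

lemma integrable_indicator_mul_sub {M : ℝ} {k : 𝔼 → ℝ} (hk : Integrable k) :
    Integrable (fun p : 𝔼 × 𝔼 =>
      (Metric.ball (0 : 𝔼) M).indicator (fun _ => (1 : ℝ)) p.2 * k (p.1 - p.2)) := by
  have h : Integrable ((Metric.ball (0 : 𝔼) M).indicator (fun _ => (1 : ℝ))) :=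
    (integrableOn_const (measure_ball_lt_top.ne)).integrable_indicator measurableSet_ball
  have := (measurePreserving_sub_prod (volume : Measure 𝔼) (volume : Measure 𝔼)).integrable_comp_of_integrable
    (hk.mul_prod h)
  refine this.congr (.of_forall fun p => ?_)
  simp [mul_comm]

lemma integrable_pairWeight (hn : 0 < n) {s : ℝ} (hs : 0 < s) (hs1 : s < 1) (M : ℝ) :
    Integrable (pairWeight (n := n) s M) := by
  have hk := integrable_min_mul_rieszKernel hn hs hs1
  have h2 := integrable_indicator_mul_sub (M := M) hk
  have h1 := h2.swap
  refine (h1.add h2).congr (.of_forall fun p => ?_)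
  simp only [pairWeight, Pi.add_apply, Function.comp, Prod.fst_swap, Prod.snd_swap]
  rw [norm_sub_rev p.2 p.1, ← rieszKernel_neg s (p.2 - p.1), neg_sub]
  ring

/-- The diagonal is the preimage of the null set `{0}` under subtraction. It lets the kernel bounds,
which say nothing at `0`, be used almost everywhere. -/
lemma ae_fst_ne_snd (hn : 0 < n) : ∀ᵐ p : 𝔼 × 𝔼, p.1 ≠ p.2 := by
  have : Nonempty (Fin n) := ⟨⟨0, hn⟩⟩
  have h := (Measure.quasiMeasurePreserving_fst.comp
    (measurePreserving_sub_prod (volume : Measure 𝔼)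
      (volume : Measure 𝔼)).quasiMeasurePreserving).ae
    (Measure.ae_ne (volume : Measure 𝔼) 0)
  filter_upwards [h] with p hp
  exact sub_ne_zero.1 hp

lemma integrable_of_abs_le_pairWeight (hn : 0 < n) {s : ℝ} (hs : 0 < s) (hs1 : s < 1) {M C : ℝ}
    {F : 𝔼 × 𝔼 → ℝ} (hF : AEStronglyMeasurable F)
    (h : ∀ p, p.1 ≠ p.2 → |F p| ≤ C * pairWeight s M p) : Integrable F := by
  refine ((integrable_pairWeight hn hs hs1 M).const_mul C).mono' hF ?_
  filter_upwards [ae_fst_ne_snd hn] with p hp using h p hp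

/-- Passing to the increment `z = x - y` freezes the kernel, so that the inner integral in `x` sees
it as a constant. -/
lemma measurePreserving_shear :
    MeasurePreserving (fun p : 𝔼 × 𝔼 => (p.2, p.2 - p.1)) := by
  have h1 : MeasurePreserving (Prod.map id Neg.neg : 𝔼 × 𝔼 → 𝔼 × 𝔼) :=
    (MeasurePreserving.id _).prod (Measure.measurePreserving_neg _)
  have h2 := (measurePreserving_prod_add (volume : Measure 𝔼) (volume : Measure 𝔼)).comp
    (h1.comp Measure.measurePreserving_swap)
  have e : (fun p : 𝔼 × 𝔼 => (p.2, p.2 - p.1)) =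
      (fun z : 𝔼 × 𝔼 => (z.1, z.1 + z.2)) ∘ Prod.map id Neg.neg ∘ Prod.swap := by
    ext p <;> simp [sub_eq_add_neg]
  rw [e]
  exact h2

lemma integral_prod_eq_shear {F : 𝔼 × 𝔼 → ℝ} (hF : Integrable F) :
    ∫ p, F p = ∫ z : 𝔼, ∫ x : 𝔼, F (x, x - z) := by
  have h := measurePreserving_shear (n := n)
  have h2 := h.integrable_comp_of_integrable hF
  rw [← integral_prod (fun p : 𝔼 × 𝔼 => F (p.2, p.2 - p.1)) h2]
  have h3 := integral_map (μ := (volume : Measure (𝔼 × 𝔼))) h.measurable.aemeasurable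
    (f := F) (by rw [h.map_eq]; exact hF.aestronglyMeasurable)
  rw [h.map_eq] at h3
  exact h3

lemma lintegral_prod_eq_shear {F : 𝔼 × 𝔼 → ℝ≥0∞} (hF : AEMeasurable F) :
    ∫⁻ p, F p = ∫⁻ z : 𝔼, ∫⁻ x : 𝔼, F (x, x - z) := by
  have h := measurePreserving_shear (n := n)
  have hF' : AEMeasurable F (Measure.map (fun p : 𝔼 × 𝔼 => (p.2, p.2 - p.1)) volume) := by
    rw [h.map_eq]; exact hF
  rw [← lintegral_prod (fun p : 𝔼 × 𝔼 => F (p.2, p.2 - p.1))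
    (hF'.comp_measurable h.measurable)]
  have h3 := lintegral_map' hF' h.measurable.aemeasurable
  rw [h.map_eq] at h3
  exact h3

end ProductIntegrals

/-! ### Interpolation between bounded functions and functions of bounded variation -/

section Interpolation

variable {n : ℕ}

local notation "𝔼" => EuclideanSpace ℝ (Fin n)

lemma abs_sub_le_lintegral_fderiv {U : 𝔼 → ℝ} (hU : ContDiff ℝ 1 U) (x z : 𝔼) :
    ENNReal.ofReal |U x - U (x - z)| ≤
      ∫⁻ t in Ioc (0 : ℝ) 1, ENNReal.ofReal (‖z‖ * ‖fderiv ℝ U (x - t • z)‖) := by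
  have hc : Continuous fun t : ℝ => fderiv ℝ U (x - t • z) :=
    (hU.continuous_fderiv one_ne_zero).comp (by fun_prop)
  have hd : ∀ t : ℝ, HasDerivAt (fun t : ℝ => U (x - t • z)) (fderiv ℝ U (x - t • z) (-z)) t := by
    intro t
    have h1 : HasDerivAt (fun t : ℝ => x - t • z) (-z) t := by
      simpa using ((hasDerivAt_id t).smul_const z).const_sub x
    exact ((hU.differentiable one_ne_zero _).hasFDerivAt).comp_hasDerivAt t h1
  have hi := intervalIntegral.integral_eq_sub_of_hasDerivAt (a := 0) (b := 1)
    (fun t _ => hd t) ((hc.clm_apply continuous_const).intervalIntegrable _ _)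
  simp only [one_smul, zero_smul, sub_zero] at hi
  rw [← ofReal_integral_eq_lintegral_ofReal ((hc.norm.const_mul _).integrableOn_Ioc)
    (.of_forall fun t => by positivity)]
  refine ENNReal.ofReal_le_ofReal ?_
  rw [abs_sub_comm, ← hi, ← intervalIntegral.integral_of_le zero_le_one, ← Real.norm_eq_abs]
  refine intervalIntegral.norm_integral_le_of_norm_le zero_le_one (.of_forall fun t _ => ?_)
    ((hc.norm.const_mul _).intervalIntegrable _ _)
  have := (fderiv ℝ U (x - t • z)).le_opNorm (-z)
  rw [norm_neg] at this
  linarith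

/-- Write the increment as an integral of the gradient along the segment, exchange the integrals,
and use translation invariance. -/
lemma lintegral_abs_sub_translate_le {U : 𝔼 → ℝ} (hU : ContDiff ℝ 1 U) (hc : HasCompactSupport U)
    (z : 𝔼) : ∫⁻ x, ENNReal.ofReal |U x - U (x - z)| ≤
      ENNReal.ofReal (‖z‖ * ∫ x, ‖fderiv ℝ U x‖) := by
  have hcont := hU.continuous_fderiv one_ne_zero
  calc ∫⁻ x, ENNReal.ofReal |U x - U (x - z)|
      ≤ ∫⁻ x, ∫⁻ t in Ioc (0 : ℝ) 1, ENNReal.ofReal (‖z‖ * ‖fderiv ℝ U (x - t • z)‖) :=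
        lintegral_mono fun x => abs_sub_le_lintegral_fderiv hU x z
    _ = ∫⁻ t in Ioc (0 : ℝ) 1, ∫⁻ x, ENNReal.ofReal (‖z‖ * ‖fderiv ℝ U (x - t • z)‖) := by
        refine lintegral_lintegral_swap (Continuous.aemeasurable ?_)
        refine ENNReal.continuous_ofReal.comp (continuous_const.mul (Continuous.norm ?_))
        exact hcont.comp (by fun_prop)
    _ = ∫⁻ t in Ioc (0 : ℝ) 1, ENNReal.ofReal (‖z‖ * ∫ x, ‖fderiv ℝ U x‖) := by
        refine lintegral_congr fun t => ?_
        rw [lintegral_sub_right_eq_self (fun x => ENNReal.ofReal (‖z‖ * ‖fderiv ℝ U x‖)) (t • z),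
          ← integral_const_mul, ofReal_integral_eq_lintegral_ofReal]
        · exact ((hcont.norm.integrable_of_hasCompactSupport (hc.fderiv ℝ).norm)).const_mul _
        · exact .of_forall fun t => by positivity
    _ = _ := by simp

lemma lintegral_abs_sub_translate_le_two {U : 𝔼 → ℝ} (hU : Integrable U) (z : 𝔼) :
    ∫⁻ x, ENNReal.ofReal |U x - U (x - z)| ≤ ENNReal.ofReal (2 * ∫ x, |U x|) := by
  have h2 : Integrable fun x => U (x - z) := hU.comp_sub_right z
  have h3 : Integrable fun x => |U x - U (x - z)| := (hU.sub h2).abs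
  rw [← ofReal_integral_eq_lintegral_ofReal h3 (.of_forall fun x => abs_nonneg _)]
  refine ENNReal.ofReal_le_ofReal ?_
  calc ∫ x, |U x - U (x - z)| ≤ ∫ x, (|U x| + |U (x - z)|) :=
        integral_mono h3 (hU.abs.add h2.abs) fun x => abs_sub _ _
    _ = 2 * ∫ x, |U x| := by
        rw [integral_add hU.abs h2.abs, integral_sub_right_eq_self (fun x => |U x|) z]
        ring

/-- Since `|U| ≤ 1`, the squared increment is at most twice the increment. For `‖z‖ < R` use the
gradient bound on translates, for `‖z‖ ≥ R` the trivial `L¹` bound. The factor `1/(1-s)` is the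
integral of `‖z‖^(1-n-s)` near the origin. -/
lemma lintegral_sq_sub_mul_rieszKernel_le (hn : 0 < n) {s R : ℝ} (hs : 0 < s) (hs1 : s < 1)
    (hR : 0 < R) {U : 𝔼 → ℝ} (hU : ContDiff ℝ 1 U) (hc : HasCompactSupport U)
    (hb : ∀ x, |U x| ≤ 1) :
    ∫⁻ p : 𝔼 × 𝔼, ENNReal.ofReal ((U p.1 - U p.2) ^ 2 * rieszKernel s (p.1 - p.2)) ≤
      ENNReal.ofReal (2 * sphereArea n * (R ^ (1 - s) / (1 - s) * (∫ x, ‖fderiv ℝ U x‖) +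
        R ^ (-s) / s * (2 * ∫ x, |U x|))) := by
  have hUc := hU.continuous
  have hUm := hUc.measurable
  have hA := (sphereArea_pos hn).le
  have hI1 : 0 ≤ ∫ x, ‖fderiv ℝ U x‖ := integral_nonneg fun x => norm_nonneg _
  have hI2 : 0 ≤ ∫ x, |U x| := integral_nonneg fun x => abs_nonneg _
  have h1s : 0 < 1 - s := sub_pos.2 hs1
  have hm : Measurable fun p : 𝔼 × 𝔼 =>
      ENNReal.ofReal ((U p.1 - U p.2) ^ 2 * rieszKernel s (p.1 - p.2)) := by fun_prop
  have key : ∀ z : 𝔼, ∀ B : ℝ, ∫⁻ x, ENNReal.ofReal |U x - U (x - z)| ≤ ENNReal.ofReal B →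
      ∫⁻ x, ENNReal.ofReal ((U x - U (x - z)) ^ 2 * rieszKernel s z) ≤
        ENNReal.ofReal (2 * B) * ENNReal.ofReal (rieszKernel s z) := by
    intro z B hB
    calc ∫⁻ x, ENNReal.ofReal ((U x - U (x - z)) ^ 2 * rieszKernel s z)
        ≤ ∫⁻ x, ENNReal.ofReal |U x - U (x - z)| * ENNReal.ofReal (2 * rieszKernel s z) := by
          refine lintegral_mono fun x => ?_
          rw [← ENNReal.ofReal_mul (abs_nonneg _)]
          refine ENNReal.ofReal_le_ofReal ?_
          have h2 : |U x - U (x - z)| ≤ 2 := (abs_sub _ _).trans (by linarith [hb x, hb (x - z)])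
          rw [← sq_abs]
          have := rieszKernel_nonneg s z
          have h3 := abs_nonneg (U x - U (x - z))
          calc |U x - U (x - z)| ^ 2 * rieszKernel s z
              ≤ (|U x - U (x - z)| * 2) * rieszKernel s z := by
                refine mul_le_mul_of_nonneg_right ?_ this
                nlinarith
            _ = _ := by ring
      _ = (∫⁻ x, ENNReal.ofReal |U x - U (x - z)|) * ENNReal.ofReal (2 * rieszKernel s z) :=
          lintegral_mul_const _ (by fun_prop)
      _ ≤ ENNReal.ofReal B * ENNReal.ofReal (2 * rieszKernel s z) := by gcongr
      _ = _ := by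
          rw [ENNReal.ofReal_mul zero_le_two, ENNReal.ofReal_mul zero_le_two]
          ring
  rw [lintegral_prod_eq_shear hm.aemeasurable]
  simp only [sub_sub_cancel]
  rw [← lintegral_add_compl _ (measurableSet_ball (x := (0 : 𝔼)) (ε := R)), mul_add,
    ENNReal.ofReal_add (by positivity) (by positivity)]
  refine add_le_add ?_ ?_
  · calc _ ≤ ∫⁻ z in Metric.ball (0 : 𝔼) R, ENNReal.ofReal (2 * ∫ x, ‖fderiv ℝ U x‖) *
          ENNReal.ofReal (‖z‖ * rieszKernel s z) := by
          refine lintegral_mono fun z => (key z _ (lintegral_abs_sub_translate_le hU hc z)).trans ?_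
          rw [← ENNReal.ofReal_mul (by positivity), ← ENNReal.ofReal_mul (by positivity)]
          exact ENNReal.ofReal_le_ofReal (le_of_eq (by ring))
      _ = _ := by
          rw [lintegral_const_mul _ (by fun_prop), lintegral_norm_mul_rieszKernel_ball hn hs1 hR,
            ← ENNReal.ofReal_mul (by positivity)]
          congr 1
          ring
  · calc _ ≤ ∫⁻ z in (Metric.ball (0 : 𝔼) R)ᶜ, ENNReal.ofReal (2 * (2 * ∫ x, |U x|)) *
          ENNReal.ofReal (rieszKernel s z) := lintegral_mono fun z =>
            key z _ (lintegral_abs_sub_translate_le_two (hUc.integrable_of_hasCompactSupport hc) z)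
      _ = _ := by
          rw [lintegral_const_mul _ (by fun_prop), lintegral_rieszKernel_compl_ball hn hs hR,
            ← ENNReal.ofReal_mul (by positivity)]
          congr 1
          ring

end Interpolation

/-! ### Cutoff functions between two balls -/

section Cutoff

variable {n : ℕ}

local notation "𝔼" => EuclideanSpace ℝ (Fin n)

lemma exists_bound_deriv_smoothTransition : ∃ C : ℝ, 0 < C ∧
    ∀ t, |deriv Real.smoothTransition t| ≤ C := by
  have hc : Continuous (deriv Real.smoothTransition) :=
    (Real.smoothTransition.contDiff (n := 1)).continuous_deriv le_rfl
  obtain ⟨C, hC⟩ := (isCompact_Icc (a := (-1 : ℝ)) (b := 2)).exists_bound_of_continuousOn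
    hc.continuousOn
  refine ⟨max C 1, by positivity, fun t => ?_⟩
  -- The interval exceeds `[0, 1]` on both sides, so at points outside it the function is constant
  -- on a whole neighbourhood.
  by_cases ht : t ∈ Icc (-1 : ℝ) 2
  · exact (hC t ht).trans (le_max_left _ _)
  · have h0 : deriv Real.smoothTransition t = 0 := by
      rw [mem_Icc, not_and_or, not_le, not_le] at ht
      rcases ht with ht | ht
      · have : Real.smoothTransition =ᶠ[nhds t] fun _ => 0 := by
          filter_upwards [Iio_mem_nhds ht] with y (hy : y < -1)
          exact Real.smoothTransition.zero_of_nonpos (by linarith)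
        rw [this.deriv_eq, deriv_const]
      · have : Real.smoothTransition =ᶠ[nhds t] fun _ => 1 := by
          filter_upwards [Ioi_mem_nhds ht] with y (hy : 2 < y)
          exact Real.smoothTransition.one_of_one_le (by linarith)
        rw [this.deriv_eq, deriv_const]
    rw [h0, abs_zero]
    positivity

variable (n) in
lemma exists_cutoff : ∃ C : ℝ, 0 < C ∧ ∀ a b : ℝ, 0 < a → a < b →
    ∃ η : 𝔼 → ℝ, ContDiff ℝ 2 η ∧ (∀ x, 0 ≤ η x) ∧ (∀ x, η x ≤ 1) ∧
      (∀ x, ‖x‖ ≤ a → η x = 1) ∧ (∀ x, b ≤ ‖x‖ → η x = 0) ∧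
      (∀ x, ‖fderiv ℝ η x‖ ≤ C / (b - a)) := by
  obtain ⟨C, hC0, hC⟩ := exists_bound_deriv_smoothTransition
  refine ⟨2 * C, by positivity, fun a b ha hab => ?_⟩
  have hb : 0 < b := ha.trans hab
  have hD : 0 < b ^ 2 - a ^ 2 := by nlinarith
  -- Using the squared norm keeps the cutoff smooth at the origin. The gradient of `q` is then at
  -- most `2b/(b² - a²) ≤ 2/(b - a)` on the ball of radius `b`.
  let q : 𝔼 → ℝ := fun x => (b ^ 2 - ‖x‖ ^ 2) * (b ^ 2 - a ^ 2)⁻¹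
  have hq : ContDiff ℝ 2 q := by
    have : ContDiff ℝ 2 fun x : 𝔼 => ‖x‖ ^ 2 := contDiff_norm_sq ℝ
    exact (contDiff_const.sub this).mul contDiff_const
  have hz : ∀ x, b ≤ ‖x‖ → Real.smoothTransition (q x) = 0 := fun x hx =>
    Real.smoothTransition.zero_of_nonpos
      (mul_nonpos_of_nonpos_of_nonneg (by nlinarith) (inv_nonneg.2 hD.le))
  have hT : ContDiff ℝ 2 (fun x => Real.smoothTransition (q x)) :=
    (Real.smoothTransition.contDiff (n := 2)).comp hq
  refine ⟨fun x => Real.smoothTransition (q x), hT, fun x => Real.smoothTransition.nonneg _,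
    fun x => Real.smoothTransition.le_one _, fun x hx => ?_, hz, fun x => ?_⟩
  · refine Real.smoothTransition.one_of_one_le ?_
    change 1 ≤ (b ^ 2 - ‖x‖ ^ 2) * (b ^ 2 - a ^ 2)⁻¹
    rw [← div_eq_mul_inv, le_div_iff₀ hD]
    nlinarith [norm_nonneg x]
  · by_cases hx : ‖x‖ ≤ b
    · have hqd : HasFDerivAt q (-((b ^ 2 - a ^ 2)⁻¹ • (2 : ℝ) • innerSL ℝ x)) x := by
        have h1 := (hasStrictFDerivAt_norm_sq x).hasFDerivAt
        rw [← Nat.cast_smul_eq_nsmul ℝ] at h1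
        have h2 := (h1.const_sub (b ^ 2)).mul_const (b ^ 2 - a ^ 2)⁻¹
        rw [smul_neg] at h2
        exact h2
      have hTd : HasDerivAt Real.smoothTransition (deriv Real.smoothTransition (q x)) (q x) :=
        ((Real.smoothTransition.contDiff (n := 1)).differentiable one_ne_zero _).hasDerivAt
      have h := hTd.comp_hasFDerivAt x hqd
      have h' : fderiv ℝ (fun x => Real.smoothTransition (q x)) x = _ := h.fderiv
      rw [h', norm_smul, norm_neg, norm_smul, norm_smul, innerSL_apply_norm, norm_inv,
        Real.norm_of_nonneg hD.le, Real.norm_eq_abs, Real.norm_two]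
      calc |deriv Real.smoothTransition (q x)| * ((b ^ 2 - a ^ 2)⁻¹ * (2 * ‖x‖))
          ≤ C * ((b ^ 2 - a ^ 2)⁻¹ * (2 * b)) := by gcongr; exact hC _
        _ = 2 * C / (b - a) * (b / (b + a)) := by
            have : b - a ≠ 0 := (sub_pos.2 hab).ne'
            have : b + a ≠ 0 := by positivity
            rw [show b ^ 2 - a ^ 2 = (b - a) * (b + a) by ring]
            field_simp
        _ ≤ 2 * C / (b - a) * 1 := by
            have := sub_pos.2 hab
            gcongr
            rw [div_le_one (by positivity)]
            linarith
        _ = _ := mul_one _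
    · have : (fun x => Real.smoothTransition (q x)) =ᶠ[nhds x] fun _ => 0 := by
        filter_upwards [continuous_norm.continuousAt.eventually (lt_mem_nhds (not_le.1 hx))]
          with y hy using hz y hy.le
      rw [this.fderiv_eq]
      have := sub_pos.2 hab
      simp only [fderiv_fun_const, Pi.zero_apply, norm_zero]
      positivity

end Cutoff

/-! ### Absolute convergence of the bilinear forms -/

section KernelIntegrability

variable {n : ℕ}

local notation "𝔼" => EuclideanSpace ℝ (Fin n)

lemma IsKernelL2.measurable {s lam Lam : ℝ} {K : 𝔼 → ℝ} (hK : IsKernelL2 s lam Lam K) :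
    Measurable K :=
  measurable_of_continuousOn_compl_singleton 0 hK.contDiffOn.continuousOn

lemma div_norm_rpow_eq (c s : ℝ) (z : 𝔼) :
    c / ‖z‖ ^ ((n : ℝ) + s) = c * rieszKernel s z := by
  rw [rieszKernel, Real.rpow_neg (norm_nonneg z), div_eq_mul_inv]

lemma IsKernelL2.nonneg {s lam Lam : ℝ} {K : 𝔼 → ℝ} (hK : IsKernelL2 s lam Lam K)
    (hlam : 0 < lam) (hs1 : s < 1) {z : 𝔼} (hz : z ≠ 0) : 0 ≤ K z := by
  refine le_trans ?_ (hK.lower z hz)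
  have : 0 ≤ 2 - s := by linarith
  positivity

lemma IsKernelL2.abs_le {s lam Lam : ℝ} {K : 𝔼 → ℝ} (hK : IsKernelL2 s lam Lam K)
    (hlam : 0 < lam) (hs1 : s < 1) {z : 𝔼} (hz : z ≠ 0) :
    |K z| ≤ (2 - s) * Lam * rieszKernel s z := by
  rw [abs_of_nonneg (hK.nonneg hlam hs1 hz), ← div_norm_rpow_eq]
  exact hK.upper z hz

/-- Bounded and Lipschitz together give increments of size `min 1 ‖x - y‖`, exactly the factor that
makes the kernel integrable. -/
lemma LipschitzWith.exists_compact_bounds {f : 𝔼 → ℝ} {L : NNReal} (hf : LipschitzWith L f)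
    (hc : HasCompactSupport f) : ∃ C M : ℝ, 0 ≤ C ∧
      (∀ x, |f x| ≤ C * (Metric.ball (0 : 𝔼) M).indicator (fun _ => (1 : ℝ)) x) ∧
      (∀ x, |f x| ≤ C) ∧ ∀ x y, |f x - f y| ≤ C * min 1 ‖x - y‖ := by
  obtain ⟨B, hB⟩ := hc.exists_bound_of_continuous hf.continuous
  obtain ⟨M, hM⟩ := hc.isCompact.isBounded.subset_ball (0 : 𝔼)
  have hB0 : 0 ≤ B := (norm_nonneg _).trans (hB 0)
  have hC : ∀ x, |f x| ≤ max (2 * B) L := fun x =>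
    (hB x).trans (le_max_of_le_left (by linarith))
  refine ⟨max (2 * B) L, M, le_max_of_le_left (by linarith), fun x => ?_, hC, fun x y => ?_⟩
  · by_cases hx : x ∈ Metric.ball (0 : 𝔼) M
    · simpa [hx] using hC x
    · have : f x = 0 := image_eq_zero_of_notMem_tsupport fun h => hx (hM h)
      simp [hx, this]
  · rw [mul_min_of_nonneg _ _ (le_max_of_le_left (by linarith)), mul_one]
    refine le_min ?_ ?_
    · refine le_max_of_le_left ((abs_sub _ _).trans ?_)
      have h1 := hB x
      have h2 := hB y
      rw [Real.norm_eq_abs] at h1 h2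
      linarith
    · have := hf.dist_le_mul x y
      rw [Real.dist_eq, dist_eq_norm] at this
      exact this.trans (mul_le_mul_of_nonneg_right (le_max_right _ _) (norm_nonneg _))

/-- The increment of `f` cancels the singularity and `g` localizes one of the two points, so
`pairWeight` dominates. The kernel is a general `H` with a Riesz bound. -/
lemma integrable_mul_sub_mul_kernel (hn : 0 < n) {s P : ℝ} (hs : 0 < s) (hs1 : s < 1)
    {H : 𝔼 → ℝ} (hH : Measurable H) (hHP : ∀ z, z ≠ 0 → |H z| ≤ P * rieszKernel s z)
    {f g : 𝔼 → ℝ} {L : NNReal} (hf : LipschitzWith L f) (hcf : HasCompactSupport f)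
    (hg : Continuous g) (hcg : HasCompactSupport g) :
    Integrable fun p : 𝔼 × 𝔼 => g p.1 * (f p.1 - f p.2) * H (p.1 - p.2) := by
  obtain ⟨C, M, hC, -, -, hC3⟩ := hf.exists_compact_bounds hcf
  obtain ⟨B, hB⟩ := hcg.exists_bound_of_continuous hg
  obtain ⟨M, hM⟩ := hcg.isCompact.isBounded.subset_ball (0 : 𝔼)
  have hB0 : 0 ≤ B := (norm_nonneg _).trans (hB 0)
  have hfm := hf.continuous.measurable
  have hgm := hg.measurable
  refine integrable_of_abs_le_pairWeight hn hs hs1 (M := M) (C := B * C * P)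
    (Measurable.aestronglyMeasurable (by fun_prop)) fun p hp => ?_
  have hz : p.1 - p.2 ≠ 0 := sub_ne_zero.2 hp
  have h1 : |g p.1| ≤ B * ((Metric.ball (0 : 𝔼) M).indicator (fun _ => (1 : ℝ)) p.1 +
    (Metric.ball (0 : 𝔼) M).indicator (fun _ => (1 : ℝ)) p.2) := by
    have h2 : 0 ≤ (Metric.ball (0 : 𝔼) M).indicator (fun _ => (1 : ℝ)) p.2 :=
      indicator_nonneg (fun _ _ => zero_le_one) _
    by_cases hx : p.1 ∈ Metric.ball (0 : 𝔼) M
    · rw [indicator_of_mem hx]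
      exact (hB p.1).trans (by nlinarith)
    · have : g p.1 = 0 := image_eq_zero_of_notMem_tsupport fun h => hx (hM h)
      rw [this, abs_zero]
      refine mul_nonneg hB0 (add_nonneg (indicator_nonneg (fun _ _ => zero_le_one) _) h2)
  have hmin : 0 ≤ min 1 ‖p.1 - p.2‖ := le_min zero_le_one (norm_nonneg _)
  rw [abs_mul, abs_mul, pairWeight]
  calc |g p.1| * |f p.1 - f p.2| * |H (p.1 - p.2)|
      ≤ (B * ((Metric.ball (0 : 𝔼) M).indicator (fun _ => (1 : ℝ)) p.1 +
        (Metric.ball (0 : 𝔼) M).indicator (fun _ => (1 : ℝ)) p.2)) *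
        (C * min 1 ‖p.1 - p.2‖) * (P * rieszKernel s (p.1 - p.2)) :=
        mul_le_mul (mul_le_mul h1 (hC3 _ _) (abs_nonneg _) ((abs_nonneg _).trans h1))
          (hHP _ hz) (abs_nonneg _) (mul_nonneg ((abs_nonneg _).trans h1) (mul_nonneg hC hmin))
    _ = _ := by ring

lemma integrable_sub_mul_sub_mul_kernel (hn : 0 < n) {s P : ℝ} (hs : 0 < s) (hs1 : s < 1)
    {H : 𝔼 → ℝ} (hH : Measurable H) (hHP : ∀ z, z ≠ 0 → |H z| ≤ P * rieszKernel s z)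
    (hsym : ∀ z, H z = H (-z))
    {f g : 𝔼 → ℝ} {L : NNReal} (hf : LipschitzWith L f) (hcf : HasCompactSupport f)
    (hg : Continuous g) (hcg : HasCompactSupport g) :
    Integrable fun p : 𝔼 × 𝔼 => (g p.1 - g p.2) * (f p.1 - f p.2) * H (p.1 - p.2) := by
  have h := integrable_mul_sub_mul_kernel hn hs hs1 hH hHP hf hcf hg hcg
  refine (h.add h.swap).congr (.of_forall fun p => ?_)
  simp only [Pi.add_apply, Function.comp, Prod.fst_swap, Prod.snd_swap]
  rw [hsym (p.2 - p.1), neg_sub]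
  ring

/-- Exchange `x` and `y` in half of the integrand: evenness of `H` turns the symmetric form of the
energy into the weak form of the operator. -/
lemma integral_mul_sub_mul_kernel_symm (hn : 0 < n) {s P : ℝ} (hs : 0 < s) (hs1 : s < 1)
    {H : 𝔼 → ℝ} (hH : Measurable H) (hHP : ∀ z, z ≠ 0 → |H z| ≤ P * rieszKernel s z)
    (hsym : ∀ z, H z = H (-z))
    {f g : 𝔼 → ℝ} {L : NNReal} (hf : LipschitzWith L f) (hcf : HasCompactSupport f)
    (hg : Continuous g) (hcg : HasCompactSupport g) :
    ∫ p : 𝔼 × 𝔼, (g p.1 - g p.2) * (f p.1 - f p.2) * H (p.1 - p.2) =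
      2 * ∫ p : 𝔼 × 𝔼, g p.1 * (f p.1 - f p.2) * H (p.1 - p.2) := by
  have h := integrable_mul_sub_mul_kernel hn hs hs1 hH hHP hf hcf hg hcg
  have e : (fun p : 𝔼 × 𝔼 => (g p.1 - g p.2) * (f p.1 - f p.2) * H (p.1 - p.2)) =
      fun p => g p.1 * (f p.1 - f p.2) * H (p.1 - p.2) +
        (fun p : 𝔼 × 𝔼 => g p.1 * (f p.1 - f p.2) * H (p.1 - p.2)) p.swap := by
    ext p
    simp only [Prod.fst_swap, Prod.snd_swap]
    rw [hsym (p.2 - p.1), neg_sub]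
    ring
  have hsw : Integrable fun p : 𝔼 × 𝔼 =>
      (fun p : 𝔼 × 𝔼 => g p.1 * (f p.1 - f p.2) * H (p.1 - p.2)) p.swap := h.swap
  rw [e, integral_add h hsw]
  have := integral_prod_swap (μ := (volume : Measure 𝔼)) (ν := (volume : Measure 𝔼))
    (fun p : 𝔼 × 𝔼 => g p.1 * (f p.1 - f p.2) * H (p.1 - p.2))
  rw [← Measure.volume_eq_prod] at this
  rw [this]
  ring

lemma integrable_sq_sub_mul_kernel (hn : 0 < n) {s P : ℝ} (hs : 0 < s) (hs1 : s < 1)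
    {H : 𝔼 → ℝ} (hH : Measurable H) (hHP : ∀ z, z ≠ 0 → |H z| ≤ P * rieszKernel s z)
    {f g : 𝔼 → ℝ} {L : NNReal} (hf : LipschitzWith L f) (hcf : HasCompactSupport f)
    (hg : Continuous g) (hcg : HasCompactSupport g) :
    Integrable fun p : 𝔼 × 𝔼 => (f p.1 - f p.2) ^ 2 * (g p.1 * g p.2) * H (p.1 - p.2) := by
  have h := integrable_mul_sub_mul_kernel hn hs hs1 hH hHP hf hcf hg hcg
  obtain ⟨C, M, hC, -, hC2, hC3⟩ := hf.exists_compact_bounds hcf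
  obtain ⟨B, hB⟩ := hcg.exists_bound_of_continuous hg
  have hfm := hf.continuous.measurable
  have hgm := hg.measurable
  refine (h.bdd_mul (c := 2 * C * B) (f := fun p : 𝔼 × 𝔼 => (f p.1 - f p.2) * g p.2)
    (Measurable.aestronglyMeasurable (by fun_prop)) (.of_forall fun p => ?_)).congr
    (.of_forall fun p => ?_)
  · rw [Real.norm_eq_abs, abs_mul]
    refine mul_le_mul ((abs_sub _ _).trans ?_) (hB p.2) (abs_nonneg _) (by positivity)
    linarith [hC2 p.1, hC2 p.2]
  · simp only
    ring

end KernelIntegrability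

/-! ### The product of derivatives as a mixed second derivative -/

section DoubleIntegrationByParts

variable {n : ℕ}

local notation "𝔼" => EuclideanSpace ℝ (Fin n)

lemma ContDiff.fderiv_apply_const {f : 𝔼 → ℝ} (hf : ContDiff ℝ 2 f) (v : 𝔼) :
    ContDiff ℝ 1 fun x => fderiv ℝ f x v :=
  (hf.fderiv_right (m := 1) (by norm_num)).clm_apply contDiff_const

lemma HasCompactSupport.fderiv_apply_const {f : 𝔼 → ℝ} (hf : HasCompactSupport f) (v : 𝔼) :
    HasCompactSupport fun x => fderiv ℝ f x v :=
  (hf.fderiv ℝ).comp_left (g := fun A : 𝔼 →L[ℝ] ℝ => A v) rfl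

lemma hasDerivAt_comp_add_smul {f : 𝔼 → ℝ} (hf : ContDiff ℝ 1 f) (x v : 𝔼) :
    HasDerivAt (fun t : ℝ => f (x + t • v)) (fderiv ℝ f x v) 0 :=
  (hf.differentiable one_ne_zero x).hasFDerivAt.hasLineDerivAt v

lemma hasDerivAt_comp_add_smul_sub {f : 𝔼 → ℝ} (hf : ContDiff ℝ 1 f) (x y v : 𝔼) :
    HasDerivAt (fun t : ℝ => f (x + t • v - y)) (fderiv ℝ f (x - y) v) 0 := by
  have := hasDerivAt_comp_add_smul hf (x - y) v
  refine this.congr_of_eventuallyEq (.of_forall fun t => ?_)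
  simp only
  congr 1
  abel

lemma hasDerivAt_comp_sub_add_smul {f : 𝔼 → ℝ} (hf : ContDiff ℝ 1 f) (x y v : 𝔼) :
    HasDerivAt (fun t : ℝ => f (x - (y + t • v))) (-fderiv ℝ f (x - y) v) 0 := by
  have := hasDerivAt_comp_add_smul hf (x - y) (-v)
  rw [map_neg] at this
  refine this.congr_of_eventuallyEq (.of_forall fun t => ?_)
  simp only [smul_neg]
  congr 1
  abel

/-- A bound on `x - y` together with a bound on one of the points bounds the pair. This gives
compact support in the product space to expressions built from `k(x - y)` and from `η` at either
point. -/
lemma eq_zero_of_pairs_far {η k : 𝔼 → ℝ} (hη : HasCompactSupport η) (hk : HasCompactSupport k) :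
    ∃ M : ℝ, ∀ p : 𝔼 × 𝔼, p ∉ Metric.closedBall (0 : 𝔼 × 𝔼) M →
      (p.1 - p.2 ∉ tsupport k) ∨ (p.1 ∉ tsupport η ∧ p.2 ∉ tsupport η) := by
  obtain ⟨A, hA⟩ := hη.isCompact.isBounded.subset_closedBall (0 : 𝔼)
  obtain ⟨B, hB⟩ := hk.isCompact.isBounded.subset_closedBall (0 : 𝔼)
  refine ⟨A + B, fun p hp => ?_⟩
  by_contra! h
  obtain ⟨h1, h2⟩ := h
  apply hp
  have h1' : ‖p.1 - p.2‖ ≤ B := by simpa using hB h1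
  have hx : ‖p.1‖ ≤ A + B ∧ ‖p.2‖ ≤ A + B := by
    have e1 := norm_sub_norm_le p.1 p.2
    have e2 := norm_sub_norm_le p.2 p.1
    rw [norm_sub_rev] at e2
    have hB0 := (norm_nonneg _).trans h1'
    by_cases hx : p.1 ∈ tsupport η
    · have : ‖p.1‖ ≤ A := by simpa using hA hx
      constructor <;> linarith
    · have : ‖p.2‖ ≤ A := by simpa using hA (h2 hx)
      constructor <;> linarith
  simpa [Prod.norm_def] using hx

lemma fderiv_apply_eq_zero_of_notMem_tsupport {f : 𝔼 → ℝ} {x : 𝔼} (hx : x ∉ tsupport f) (v : 𝔼) :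
    fderiv ℝ f x v = 0 := by
  have : fderiv ℝ f x = 0 := by
    by_contra h
    exact hx (support_fderiv_subset ℝ h)
  rw [this, zero_apply]

/-- Two integrations by parts turn `ω(x) ω(y)`, with `ω = ∂ᵥU`, into `(U(x) - U(y))²`. -/
lemma integral_sq_sub_mul_fderiv_mul_fderiv {U η k : 𝔼 → ℝ} (hU : ContDiff ℝ 2 U)
    (hη : ContDiff ℝ 2 η) (hcη : HasCompactSupport η) (hk : ContDiff ℝ 2 k)
    (hck : HasCompactSupport k) (v : 𝔼) :
    ∫ p : 𝔼 × 𝔼, (η p.1 - η p.2) ^ 2 * (fderiv ℝ U p.1 v * fderiv ℝ U p.2 v) * k (p.1 - p.2) =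
      ∫ p : 𝔼 × 𝔼, (U p.1 - U p.2) ^ 2 *
        (fderiv ℝ η p.1 v * fderiv ℝ η p.2 v * k (p.1 - p.2) +
          (η p.1 - η p.2) * (fderiv ℝ η p.1 v + fderiv ℝ η p.2 v) * fderiv ℝ k (p.1 - p.2) v +
          (η p.1 - η p.2) ^ 2 / 2 *
            fderiv ℝ (fun z => fderiv ℝ k z v) (p.1 - p.2) v) := by
  have hω := hU.fderiv_apply_const v
  have hη' := hη.fderiv_apply_const v
  have hk' := hk.fderiv_apply_const v
  have h12 : (1 : WithTop ℕ∞) ≤ 2 := by norm_num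
  have cU := hU.continuous
  have cω := hω.continuous
  have cη := hη.continuous
  have cη' := hη'.continuous
  have ck := hk.continuous
  have ck' := hk'.continuous
  have ck'' : Continuous fun z => fderiv ℝ (fun z => fderiv ℝ k z v) z v :=
    (hk'.continuous_fderiv one_ne_zero).clm_apply continuous_const
  set ω : 𝔼 → ℝ := fun x => fderiv ℝ U x v
  set η' : 𝔼 → ℝ := fun x => fderiv ℝ η x v
  set k' : 𝔼 → ℝ := fun x => fderiv ℝ k x v
  set k'' : 𝔼 → ℝ := fun x => fderiv ℝ k' x v
  obtain ⟨M, hM⟩ := eq_zero_of_pairs_far hcη hck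
  have hzero : ∀ p : 𝔼 × 𝔼, p ∉ Metric.closedBall (0 : 𝔼 × 𝔼) M →
      (k (p.1 - p.2) = 0 ∧ k' (p.1 - p.2) = 0 ∧ k'' (p.1 - p.2) = 0) ∨
      (η p.1 = 0 ∧ η p.2 = 0 ∧ η' p.1 = 0 ∧ η' p.2 = 0) := by
    intro p hp
    refine (hM p hp).imp (fun h => ⟨image_eq_zero_of_notMem_tsupport h,
      fderiv_apply_eq_zero_of_notMem_tsupport h v, ?_⟩) (fun h =>
      ⟨image_eq_zero_of_notMem_tsupport h.1, image_eq_zero_of_notMem_tsupport h.2,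
      fderiv_apply_eq_zero_of_notMem_tsupport h.1 v,
      fderiv_apply_eq_zero_of_notMem_tsupport h.2 v⟩)
    refine fderiv_apply_eq_zero_of_notMem_tsupport (fun h' => h ?_) v
    refine (closure_minimal ?_ (isClosed_tsupport k)) h'
    intro y hy
    by_contra hcon
    exact hy (fderiv_apply_eq_zero_of_notMem_tsupport hcon v)
  -- The chain of derivatives: `Ψ` is `Φ` differentiated along `v` in `y`, and `Q` is `Ψ`
  -- differentiated along `v` in `x`. Likewise `G₁` is the `x`-derivative of `G` and `G₂` the
  -- `y`-derivative of `G₁`. Then `∫ ΦG₂ = -∫ ΨG₁ = ∫ QG`, and both ends carry the factor `-2`.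
  let Φ : 𝔼 × 𝔼 → ℝ := fun p => (η p.1 - η p.2) ^ 2 * k (p.1 - p.2)
  let Ψ : 𝔼 × 𝔼 → ℝ := fun p =>
    -2 * (η p.1 - η p.2) * η' p.2 * k (p.1 - p.2) - (η p.1 - η p.2) ^ 2 * k' (p.1 - p.2)
  let Q : 𝔼 × 𝔼 → ℝ := fun p =>
    -2 * (η' p.1 * η' p.2 * k (p.1 - p.2) +
      (η p.1 - η p.2) * (η' p.1 + η' p.2) * k' (p.1 - p.2) +
      (η p.1 - η p.2) ^ 2 / 2 * k'' (p.1 - p.2))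
  let G : 𝔼 × 𝔼 → ℝ := fun p => (U p.1 - U p.2) ^ 2
  let G₁ : 𝔼 × 𝔼 → ℝ := fun p => 2 * (U p.1 - U p.2) * ω p.1
  let G₂ : 𝔼 × 𝔼 → ℝ := fun p => -2 * (ω p.1 * ω p.2)
  have cΦ : Continuous Φ := by fun_prop
  have cΨ : Continuous Ψ := by fun_prop
  have cQ : Continuous Q := by fun_prop
  have cG : Continuous G := by fun_prop
  have cG₁ : Continuous G₁ := by fun_prop
  have cG₂ : Continuous G₂ := by fun_prop
  have hcpt := isCompact_closedBall (0 : 𝔼 × 𝔼) M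
  have sΦ : HasCompactSupport Φ := .intro hcpt fun p hp => by
    rcases hzero p hp with ⟨h1, h2, h3⟩ | ⟨h1, h2, h3, h4⟩
    · simp [Φ, h1]
    · simp [Φ, h1, h2]
  have sΨ : HasCompactSupport Ψ := .intro hcpt fun p hp => by
    rcases hzero p hp with ⟨h1, h2, h3⟩ | ⟨h1, h2, h3, h4⟩
    · simp [Ψ, h1, h2]
    · simp [Ψ, h1, h2]
  have sQ : HasCompactSupport Q := .intro hcpt fun p hp => by
    rcases hzero p hp with ⟨h1, h2, h3⟩ | ⟨h1, h2, h3, h4⟩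
    · simp [Q, h1, h2, h3]
    · simp [Q, h1, h2, h3]
  have dη := hη.of_le h12
  have dU := hU.of_le h12
  have dk := hk.of_le h12
  have Dη : ∀ x, HasDerivAt (fun t : ℝ => η (x + t • v)) (η' x) 0 := fun x =>
    hasDerivAt_comp_add_smul dη x v
  have DU : ∀ x, HasDerivAt (fun t : ℝ => U (x + t • v)) (ω x) 0 := fun x =>
    hasDerivAt_comp_add_smul dU x v
  have Dk : ∀ x y, HasDerivAt (fun t : ℝ => k (x - (y + t • v))) (-k' (x - y)) 0 := fun x y =>
    hasDerivAt_comp_sub_add_smul dk x y v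
  have Dk₁ : ∀ x y, HasDerivAt (fun t : ℝ => k (x + t • v - y)) (k' (x - y)) 0 := fun x y =>
    hasDerivAt_comp_add_smul_sub dk x y v
  have Dk₂ : ∀ x y, HasDerivAt (fun t : ℝ => k' (x + t • v - y)) (k'' (x - y)) 0 := fun x y =>
    hasDerivAt_comp_add_smul_sub hk' x y v
  change ∫ p : 𝔼 × 𝔼, (η p.1 - η p.2) ^ 2 * (ω p.1 * ω p.2) * k (p.1 - p.2) =
    ∫ p : 𝔼 × 𝔼, (U p.1 - U p.2) ^ 2 *
      (η' p.1 * η' p.2 * k (p.1 - p.2) +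
        (η p.1 - η p.2) * (η' p.1 + η' p.2) * k' (p.1 - p.2) +
        (η p.1 - η p.2) ^ 2 / 2 * k'' (p.1 - p.2))
  -- From here on the derivatives are opaque functions, known only through `Dη`, `DU`, `Dk`, `Dk₁`,
  -- `Dk₂`; this keeps `simp` from unfolding them.
  clear_value ω η' k''
  clear_value k'
  have lΦ : ∀ p, HasLineDerivAt ℝ Φ (Ψ p) p ((0 : 𝔼), v) := by
    intro p
    have h1 := Dη p.2
    have h2 := Dk p.1 p.2
    have h := ((h1.const_sub (η p.1)).pow 2).mul h2
    refine HasDerivAt.congr_of_eventuallyEq (h.congr_deriv ?_) (.of_forall fun t => ?_)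
    · simp [Ψ]
      ring
    · simp [Φ]
  have lG₁ : ∀ p, HasLineDerivAt ℝ G₁ (G₂ p) p ((0 : 𝔼), v) := by
    intro p
    have h1 := DU p.2
    have h := ((h1.const_sub (U p.1)).const_mul 2).mul_const (ω p.1)
    refine HasDerivAt.congr_of_eventuallyEq (h.congr_deriv ?_) (.of_forall fun t => ?_)
    · simp [G₂]
      ring
    · simp [G₁]
  have lG : ∀ p, HasLineDerivAt ℝ G (G₁ p) p (v, (0 : 𝔼)) := by
    intro p
    have h1 := DU p.1
    have h := (h1.sub_const (U p.2)).pow 2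
    refine HasDerivAt.congr_of_eventuallyEq (h.congr_deriv ?_) (.of_forall fun t => ?_)
    · simp [G₁]
    · simp [G]
  have lΨ : ∀ p, HasLineDerivAt ℝ Ψ (Q p) p (v, (0 : 𝔼)) := by
    intro p
    have h1 := Dη p.1
    have h2 := Dk₁ p.1 p.2
    have h3 := Dk₂ p.1 p.2
    have h := ((((h1.sub_const (η p.2)).const_mul (-2)).mul_const (η' p.2)).mul h2).sub
      (((h1.sub_const (η p.2)).pow 2).mul h3)
    refine HasDerivAt.congr_of_eventuallyEq (h.congr_deriv ?_) (.of_forall fun t => ?_)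
    · simp [Q]
      ring
    · simp [Ψ]
  have : (volume : Measure (𝔼 × 𝔼)).IsAddHaarMeasure :=
    inferInstanceAs ((volume : Measure 𝔼).prod (volume : Measure 𝔼)).IsAddHaarMeasure
  have I1 := integral_bilinear_hasLineDerivAt_right_eq_neg_left_of_integrable
    (μ := (volume : Measure (𝔼 × 𝔼))) (B := ContinuousLinearMap.mul ℝ ℝ)
    (f := Φ) (f' := Ψ) (g := G₁) (g' := G₂)
    ((cΨ.mul cG₁).integrable_of_hasCompactSupport sΨ.mul_right)
    ((cΦ.mul cG₂).integrable_of_hasCompactSupport sΦ.mul_right)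
    ((cΦ.mul cG₁).integrable_of_hasCompactSupport sΦ.mul_right)
    (fun p _ => lΦ p) (fun p _ => lG₁ p)
  have I2 := integral_bilinear_hasLineDerivAt_right_eq_neg_left_of_integrable
    (μ := (volume : Measure (𝔼 × 𝔼))) (B := ContinuousLinearMap.mul ℝ ℝ)
    (f := Ψ) (f' := Q) (g := G) (g' := G₁)
    ((cQ.mul cG).integrable_of_hasCompactSupport sQ.mul_right)
    ((cΨ.mul cG₁).integrable_of_hasCompactSupport sΨ.mul_right)
    ((cΨ.mul cG).integrable_of_hasCompactSupport sΨ.mul_right)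
    (fun p _ => lΨ p) (fun p _ => lG p)
  simp only [ContinuousLinearMap.mul_apply'] at I1 I2
  rw [I2, neg_neg] at I1
  have e1 : ∫ p, Φ p * G₂ p = -2 * ∫ p : 𝔼 × 𝔼, (η p.1 - η p.2) ^ 2 * (ω p.1 * ω p.2) *
      k (p.1 - p.2) := by
    rw [← integral_const_mul]
    congr 1 with p
    simp only [Φ, G₂]
    ring
  have e2 : ∫ p, Q p * G p = -2 * ∫ p : 𝔼 × 𝔼, (U p.1 - U p.2) ^ 2 *
        (η' p.1 * η' p.2 * k (p.1 - p.2) +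
          (η p.1 - η p.2) * (η' p.1 + η' p.2) * k' (p.1 - p.2) +
          (η p.1 - η p.2) ^ 2 / 2 * k'' (p.1 - p.2)) := by
    rw [← integral_const_mul]
    congr 1 with p
    simp only [Q, G]
    ring
  rw [e1, e2] at I1
  linarith

end DoubleIntegrationByParts

/-! ### Bump functions with dilation-invariant bounds -/

section ScaledBump

variable {E : Type*} [NormedAddCommGroup E] [InnerProductSpace ℝ E]

lemma fderiv_fderiv_apply {f : E → ℝ} (hf : ContDiff ℝ 2 f) (z v w : E) :
    fderiv ℝ (fun y => fderiv ℝ f y v) z w = fderiv ℝ (fderiv ℝ f) z w v := by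
  have h : DifferentiableAt ℝ (fderiv ℝ f) z :=
    (hf.fderiv_right (m := 1) (by norm_num)).differentiable one_ne_zero z
  rw [fderiv_clm_apply h (differentiableAt_const v)]
  simp

variable (E) in
/-- Bounds for the derivatives of a fixed bump function that are invariant under dilations. -/
lemma exists_scaled_bump [FiniteDimensional ℝ E] : ∃ C : ℝ, 0 < C ∧ ∀ a : ℝ, 0 < a →
    ∃ φ : E → ℝ, ContDiff ℝ 2 φ ∧ (∀ z, 0 ≤ φ z) ∧ (∀ z, φ z ≤ 1) ∧
      (∀ z, ‖z‖ ≤ a → φ z = 1) ∧ (∀ z, 2 * a ≤ ‖z‖ → φ z = 0) ∧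
      ∀ z v, ‖v‖ = 1 → ‖z‖ * |fderiv ℝ φ z v| ≤ C ∧
        ‖z‖ ^ 2 * |fderiv ℝ (fun y => fderiv ℝ φ y v) z v| ≤ C := by
  obtain ⟨b, hb, hs, b0, b1, b2, b3⟩ : ∃ b : E → ℝ, ContDiff ℝ 2 b ∧
      HasCompactSupport b ∧ (∀ z, 0 ≤ b z) ∧ (∀ z, b z ≤ 1) ∧ (∀ z, ‖z‖ ≤ 1 → b z = 1) ∧
      ∀ z, 2 ≤ ‖z‖ → b z = 0 := by
    let b : ContDiffBump (0 : E) := ⟨1, 2, one_pos, one_lt_two⟩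
    exact ⟨b, b.contDiff (n := 2), b.hasCompactSupport, fun z => b.nonneg, fun z => b.le_one,
      fun z hz => b.one_of_mem_closedBall (by simpa [b] using hz),
      fun z hz => b.zero_of_le_dist (by simpa [b] using hz)⟩
  have hb1 : ContDiff ℝ 1 (fderiv ℝ b) := hb.fderiv_right (by norm_num)
  have s₀ : HasCompactSupport (fderiv ℝ b) := hs.fderiv ℝ
  have s₁ : HasCompactSupport fun z : E => ‖z‖ * ‖fderiv ℝ b z‖ :=
    (hs.fderiv ℝ).norm.mul_left
  have s₂ : HasCompactSupport fun z : E =>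
      ‖z‖ ^ 2 * ‖fderiv ℝ (fderiv ℝ b) z‖ :=
    .intro s₀.isCompact fun z hz => by
      have h2 : fderiv ℝ (fderiv ℝ b) z = 0 := by
        by_contra h
        exact hz (support_fderiv_subset ℝ h)
      exact mul_eq_zero_of_right _ (h2 ▸ ContinuousLinearMap.opNorm_zero)
  have c₁ : Continuous fun z : E => ‖z‖ * ‖fderiv ℝ b z‖ :=
    continuous_norm.mul hb1.continuous.norm
  have c₂ : Continuous fun z : E => ‖z‖ ^ 2 * ‖fderiv ℝ (fderiv ℝ b) z‖ :=
    (continuous_norm.pow 2).mul (hb1.continuous_fderiv one_ne_zero).norm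
  obtain ⟨C₁, hC₁⟩ := s₁.exists_bound_of_continuous c₁
  obtain ⟨C₂, hC₂⟩ := s₂.exists_bound_of_continuous c₂
  refine ⟨max (max C₁ C₂) 1, by positivity, fun a ha => ?_⟩
  have hφ : ContDiff ℝ 2 fun z => b (a⁻¹ • z) := hb.comp (contDiff_const_smul _)
  have h1 : ∀ z, fderiv ℝ (fun z => b (a⁻¹ • z)) z = a⁻¹ • fderiv ℝ b (a⁻¹ • z) := fun z =>
    fderiv_comp_smul _
  refine ⟨fun z => b (a⁻¹ • z), hφ, fun z => b0 _, fun z => b1 _, fun z hz => b2 _ ?_,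
    fun z hz => b3 _ ?_, fun z v hv => ⟨?_, ?_⟩⟩
  · rw [norm_smul, norm_inv, Real.norm_of_nonneg ha.le, inv_mul_le_iff₀ ha]
    simpa using hz
  · rw [norm_smul, norm_inv, Real.norm_of_nonneg ha.le, le_inv_mul_iff₀ ha]
    simpa [mul_comm] using hz
  · refine le_trans ?_ ((hC₁ (a⁻¹ • z)).trans ((le_max_left _ _).trans (le_max_left _ _)))
    rw [h1, smul_apply, smul_eq_mul, abs_mul, abs_of_pos (inv_pos.2 ha), Real.norm_eq_abs, abs_mul,
      abs_norm, abs_norm, norm_smul, norm_inv, Real.norm_of_nonneg ha.le]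
    have := (fderiv ℝ b (a⁻¹ • z)).le_opNorm v
    rw [hv, mul_one, Real.norm_eq_abs] at this
    calc _ = a⁻¹ * ‖z‖ * |fderiv ℝ b (a⁻¹ • z) v| := by ring
      _ ≤ _ := by gcongr
  · refine le_trans ?_ ((hC₂ (a⁻¹ • z)).trans ((le_max_right _ _).trans (le_max_left _ _)))
    have h2 : (fun y => fderiv ℝ (fun z => b (a⁻¹ • z)) y v) =
        fun y => a⁻¹ * (fun y => fderiv ℝ b y v) (a⁻¹ • y) := by
      ext y
      rw [h1]
      rfl
    have hd : Differentiable ℝ fun y => fderiv ℝ b y v :=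
      ((hb.fderiv_right (m := 1) (by norm_num)).clm_apply contDiff_const).differentiable one_ne_zero
    have hd' : DifferentiableAt ℝ (fun y => (fun y => fderiv ℝ b y v) (a⁻¹ • y)) z :=
      (hd _).comp z (differentiableAt_id.const_smul _)
    rw [h2, fderiv_const_mul hd', fderiv_comp_smul (f := fun y => fderiv ℝ b y v), smul_apply, smul_apply, fderiv_fderiv_apply hb]
    have := ((fderiv ℝ (fderiv ℝ b) (a⁻¹ • z)) v).le_opNorm v
    have h3 := (fderiv ℝ (fderiv ℝ b) (a⁻¹ • z)).le_opNorm v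
    rw [hv, mul_one] at this h3
    have h4 := this.trans h3
    rw [Real.norm_eq_abs] at h4
    rw [smul_eq_mul, smul_eq_mul, abs_mul, abs_mul, abs_of_pos (inv_pos.2 ha), Real.norm_eq_abs,
      abs_mul, abs_pow, abs_norm, abs_of_nonneg (ContinuousLinearMap.opNorm_nonneg _), norm_smul,
      norm_inv, Real.norm_of_nonneg ha.le]
    calc _ = (a⁻¹ * ‖z‖) ^ 2 * |fderiv ℝ (fderiv ℝ b) (a⁻¹ • z) v v| := by ring
      _ ≤ _ := by gcongr

end ScaledBump

/-! ### Cutoffs supported in annuli -/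

section CrossTerm

variable {n : ℕ}

local notation "𝔼" => EuclideanSpace ℝ (Fin n)

/-- Take the bump at scale `M` minus the bump at scale `ε`; the condition `2ε ≤ M` nests them, so
the difference stays in `[0, 1]`. The derivative bounds do not see `ε` or `M`, so multiplying a
kernel by this cutoff preserves its scaling bounds uniformly. -/
lemma exists_annular_cutoff (n : ℕ) : ∃ C : ℝ, 0 < C ∧ ∀ ε M : ℝ, 0 < ε → 2 * ε ≤ M →
    ∃ χ : EuclideanSpace ℝ (Fin n) → ℝ, ContDiff ℝ 2 χ ∧ (∀ z, 0 ≤ χ z) ∧ (∀ z, χ z ≤ 1) ∧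
      (∀ z, ‖z‖ ≤ ε → χ z = 0) ∧ (∀ z, 2 * M ≤ ‖z‖ → χ z = 0) ∧
      (∀ z, 2 * ε ≤ ‖z‖ → ‖z‖ ≤ M → χ z = 1) ∧
      ∀ z v, ‖v‖ = 1 → ‖z‖ * |fderiv ℝ χ z v| ≤ C ∧
        ‖z‖ ^ 2 * |fderiv ℝ (fun y => fderiv ℝ χ y v) z v| ≤ C := by
  obtain ⟨C, hC, h⟩ := exists_scaled_bump (EuclideanSpace ℝ (Fin n))
  refine ⟨2 * C, by positivity, fun ε M hε hM => ?_⟩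
  obtain ⟨φ, hφ, p1, p2, p3, p4, p5⟩ := h M (by linarith)
  obtain ⟨ψ, hψ, q1, q2, q3, q4, q5⟩ := h ε hε
  have d1 := hφ.differentiable two_ne_zero
  have d2 := hψ.differentiable two_ne_zero
  have e : ∀ z v, fderiv ℝ (fun z => φ z - ψ z) z v = fderiv ℝ φ z v - fderiv ℝ ψ z v := by
    intro z v
    rw [fderiv_fun_sub (d1 z) (d2 z)]
    rfl
  refine ⟨fun z => φ z - ψ z, hφ.sub hψ, fun z => ?_, fun z => ?_, fun z hz => ?_, fun z hz => ?_,
    fun z hz hz' => ?_, fun z v hv => ⟨?_, ?_⟩⟩ <;> beta_reduce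
  · rcases le_total ‖z‖ M with hz | hz
    · rw [p3 z hz]
      linarith [q2 z]
    · rw [q4 z (hM.trans hz)]
      linarith [p1 z]
  · linarith [p2 z, q1 z]
  · rw [p3 z (by linarith), q3 z hz, sub_self]
  · rw [p4 z hz, q4 z (by linarith), sub_self]
  · rw [p3 z hz', q4 z hz, sub_zero]
  · rw [e]
    have := abs_sub (fderiv ℝ φ z v) (fderiv ℝ ψ z v)
    have h1 := (p5 z v hv).1
    have h2 := (q5 z v hv).1
    nlinarith [norm_nonneg z]
  · simp only [e]
    have d3 := (hφ.fderiv_apply_const v).differentiable one_ne_zero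
    have d4 := (hψ.fderiv_apply_const v).differentiable one_ne_zero
    rw [fderiv_fun_sub (d3 z) (d4 z), sub_apply]
    have := abs_sub (fderiv ℝ (fun y => fderiv ℝ φ y v) z v) (fderiv ℝ (fun y => fderiv ℝ ψ y v) z v)
    have h1 := (p5 z v hv).2
    have h2 := (q5 z v hv).2
    nlinarith [sq_nonneg ‖z‖]

end CrossTerm

/-! ### The cross term for the singular kernel -/

section TruncatedKernel

variable {n : ℕ}

local notation "𝔼" => EuclideanSpace ℝ (Fin n)

lemma IsKernelL2.contDiffAt {s lam Lam : ℝ} {K : 𝔼 → ℝ} (hK : IsKernelL2 s lam Lam K)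
    {z : 𝔼} (hz : z ≠ 0) : ContDiffAt ℝ 2 K z :=
  hK.contDiffOn.contDiffAt (isOpen_compl_singleton.mem_nhds hz)

lemma IsKernelL2.contDiff_mul {s lam Lam : ℝ} {K : 𝔼 → ℝ} (hK : IsKernelL2 s lam Lam K)
    {χ : 𝔼 → ℝ} (hχ : ContDiff ℝ 2 χ) {ε : ℝ} (hε : 0 < ε) (h0 : ∀ z, ‖z‖ ≤ ε → χ z = 0) :
    ContDiff ℝ 2 fun z => K z * χ z := by
  rw [contDiff_iff_contDiffAt]
  intro z
  by_cases hz : z = 0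
  · have : (fun z => K z * χ z) =ᶠ[nhds z] fun _ => 0 := by
      filter_upwards [Metric.ball_mem_nhds z hε] with y hy
      rw [h0 y, mul_zero]
      rw [hz, mem_ball_zero_iff] at hy
      exact hy.le
    exact contDiffAt_const.congr_of_eventuallyEq this
  · exact (hK.contDiffAt hz).mul hχ.contDiffAt

lemma ContDiffAt.differentiableAt_fderiv_apply {f : 𝔼 → ℝ} {z : 𝔼} (hf : ContDiffAt ℝ 2 f z)
    (v : 𝔼) : DifferentiableAt ℝ (fun y => fderiv ℝ f y v) z :=
  ((hf.fderiv_right (m := 1) (by norm_num)).clm_apply contDiffAt_const).differentiableAt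
    one_ne_zero

/-- Leibniz rule with scale-invariant weights. In the second derivative the three terms contribute
`C`, `2C` and `1`. -/
lemma IsKernelL2.deriv_mul_bounds {s lam Lam : ℝ} {K : 𝔼 → ℝ} (hK : IsKernelL2 s lam Lam K)
    (hlam : 0 < lam) (hs1 : s < 1) {χ : 𝔼 → ℝ} (hχ : ContDiff ℝ 2 χ) (h0 : ∀ z, 0 ≤ χ z)
    (h1 : ∀ z, χ z ≤ 1) {C : ℝ}
    {v : 𝔼} (hv : ‖v‖ = 1) (hC : ∀ z, ‖z‖ * |fderiv ℝ χ z v| ≤ C ∧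
        ‖z‖ ^ 2 * |fderiv ℝ (fun y => fderiv ℝ χ y v) z v| ≤ C) {z : 𝔼} (hz : z ≠ 0) :
    |K z * χ z| ≤ (2 - s) * Lam * rieszKernel s z ∧
    ‖z‖ * |fderiv ℝ (fun z => K z * χ z) z v| ≤ (1 + C) * ((2 - s) * Lam * rieszKernel s z) ∧
    ‖z‖ ^ 2 * |fderiv ℝ (fun y => fderiv ℝ (fun z => K z * χ z) y v) z v| ≤
      (1 + 3 * C) * ((2 - s) * Lam * rieszKernel s z) := by
  have b0 := hK.abs_le hlam hs1 hz
  have bd := hK.deriv_bound z hz v hv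
  rw [div_norm_rpow_eq, max_le_iff] at bd
  obtain ⟨b1, b2⟩ := bd
  obtain ⟨c1, c2⟩ := hC z
  set B := (2 - s) * Lam * rieszKernel s z
  have hχz : |χ z| ≤ 1 := _root_.abs_le.2 ⟨by linarith [h0 z], h1 z⟩
  have hB : 0 ≤ B := (abs_nonneg _).trans b0
  have hC0 : 0 ≤ C := le_trans (by positivity) c1
  have hd : ∀ y : 𝔼, y ≠ 0 → fderiv ℝ (fun z => K z * χ z) y v =
      K y * fderiv ℝ χ y v + fderiv ℝ K y v * χ y := by
    intro y hy
    rw [fderiv_fun_mul ((hK.contDiffAt hy).differentiableAt two_ne_zero)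
      (hχ.differentiable two_ne_zero y)]
    simp [mul_comm]
  have hd2 : fderiv ℝ (fun y => fderiv ℝ (fun z => K z * χ z) y v) z v =
      K z * fderiv ℝ (fun y => fderiv ℝ χ y v) z v + 2 * (fderiv ℝ K z v * fderiv ℝ χ z v) +
        fderiv ℝ (fun y => fderiv ℝ K y v) z v * χ z := by
    have e : (fun y => fderiv ℝ (fun z => K z * χ z) y v) =ᶠ[nhds z]
        fun y => K y * fderiv ℝ χ y v + fderiv ℝ K y v * χ y := by
      filter_upwards [isOpen_compl_singleton.mem_nhds hz] with y hy using hd y hy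
    have d1 := (hK.contDiffAt hz).differentiableAt two_ne_zero
    have d2 := (hK.contDiffAt hz).differentiableAt_fderiv_apply v
    have d3 := hχ.differentiable two_ne_zero z
    have d4 := (hχ.contDiffAt (x := z)).differentiableAt_fderiv_apply v
    rw [e.fderiv_eq, fderiv_fun_add (d1.fun_mul d4) (d2.fun_mul d3), fderiv_fun_mul d1 d4,
      fderiv_fun_mul d2 d3]
    simp
    ring
  have hz0 := norm_nonneg z
  refine ⟨?_, ?_, ?_⟩
  · rw [abs_mul]
    calc |K z| * |χ z| ≤ B * 1 := mul_le_mul b0 hχz (abs_nonneg _) hB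
      _ = B := mul_one B
  · rw [hd z hz]
    calc ‖z‖ * |K z * fderiv ℝ χ z v + fderiv ℝ K z v * χ z|
        ≤ ‖z‖ * (|K z| * |fderiv ℝ χ z v| + |fderiv ℝ K z v| * |χ z|) := by
          rw [← abs_mul, ← abs_mul]
          exact mul_le_mul_of_nonneg_left (abs_add_le _ _) hz0
      _ = |K z| * (‖z‖ * |fderiv ℝ χ z v|) + (‖z‖ * |fderiv ℝ K z v|) * |χ z| := by ring
      _ ≤ B * C + B * 1 := by gcongr
      _ = _ := by ring
  · rw [hd2]
    set a := fderiv ℝ (fun y => fderiv ℝ χ y v) z v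
    set b := fderiv ℝ (fun y => fderiv ℝ K y v) z v
    calc ‖z‖ ^ 2 * |K z * a + 2 * (fderiv ℝ K z v * fderiv ℝ χ z v) + b * χ z|
        ≤ ‖z‖ ^ 2 * (|K z| * |a| + 2 * (|fderiv ℝ K z v| * |fderiv ℝ χ z v|) + |b| * |χ z|) := by
          refine mul_le_mul_of_nonneg_left ((abs_add_le _ _).trans ?_) (by positivity)
          rw [abs_mul b]
          refine add_le_add ((abs_add_le _ _).trans ?_) le_rfl
          rw [abs_mul, abs_mul, abs_mul, abs_two]
      _ = |K z| * (‖z‖ ^ 2 * |a|) + 2 * ((‖z‖ * |fderiv ℝ K z v|) * (‖z‖ * |fderiv ℝ χ z v|)) +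
          (‖z‖ ^ 2 * |b|) * |χ z| := by ring
      _ ≤ B * C + 2 * (B * C) + B * 1 := by gcongr
      _ = _ := by ring

lemma ContDiff.lipschitz_fderiv_apply {f : 𝔼 → ℝ} (hf : ContDiff ℝ 2 f)
    (hc : HasCompactSupport f) (v : 𝔼) : ∃ L, LipschitzWith L fun x => fderiv ℝ f x v :=
  ContDiff.lipschitzWith_of_hasCompactSupport (hc.fderiv_apply_const v) (hf.fderiv_apply_const v)
    one_ne_zero

lemma abs_sub_le_of_norm_fderiv_le {η : 𝔼 → ℝ} (hη : Differentiable ℝ η) {L : ℝ}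
    (hL : ∀ x, ‖fderiv ℝ η x‖ ≤ L) (x y : 𝔼) : |η x - η y| ≤ L * ‖x - y‖ := by
  have := Convex.norm_image_sub_le_of_norm_fderiv_le (f := η) (s := univ) (x := y) (y := x)
    (fun z _ => hη z) (fun z _ => hL z) convex_univ (mem_univ _) (mem_univ _)
  simpa using this

lemma integrable_sq_sub_mul_riesz (hn : 0 < n) {s : ℝ} (hs : 0 < s) (hs1 : s < 1) {U : 𝔼 → ℝ}
    (hU : ContDiff ℝ 1 U) (hcU : HasCompactSupport U) :
    Integrable fun p : 𝔼 × 𝔼 => (U p.1 - U p.2) ^ 2 * rieszKernel s (p.1 - p.2) := by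
  obtain ⟨L, hL⟩ := ContDiff.lipschitzWith_of_hasCompactSupport hcU hU one_ne_zero
  have := integrable_sub_mul_sub_mul_kernel hn hs hs1 (P := 1) (measurable_rieszKernel (n := n) s)
    (fun z _ => by rw [one_mul, abs_of_nonneg (rieszKernel_nonneg s z)])
    (fun z => (rieszKernel_neg s z).symm) hL hcU hU.continuous hcU
  refine this.congr (.of_forall fun p => ?_)
  simp only
  ring

variable (n) in
-- In the double integration by parts each derivative on the kernel costs a factor `‖z‖⁻¹`, which
-- the accompanying increment of `η`, at most `L‖z‖`, pays back. So every term is at most `L²` times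
-- the Riesz kernel. The singular kernel is reached by truncating to annuli and passing to the
-- limit.
lemma exists_cross_bound (hn : 0 < n) : ∃ C : ℝ, 0 < C ∧ ∀ (s lam Lam : ℝ) (K : 𝔼 → ℝ),
    0 < lam → 0 < s → s < 1 → IsKernelL2 s lam Lam K →
    ∀ (U η : 𝔼 → ℝ) (L : ℝ), ContDiff ℝ 2 U → HasCompactSupport U → ContDiff ℝ 2 η →
    HasCompactSupport η → (∀ x, ‖fderiv ℝ η x‖ ≤ L) → ∀ v : 𝔼, ‖v‖ = 1 →
    |∫ p : 𝔼 × 𝔼, (η p.1 - η p.2) ^ 2 * (fderiv ℝ U p.1 v * fderiv ℝ U p.2 v) * K (p.1 - p.2)| ≤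
      C * L ^ 2 * ((2 - s) * Lam) *
        ∫ p : 𝔼 × 𝔼, (U p.1 - U p.2) ^ 2 * rieszKernel s (p.1 - p.2) := by
  obtain ⟨C, hC0, hC⟩ := exists_annular_cutoff n
  -- The three terms of the integrand contribute `1`, `2(1 + C)` and `(1 + 3C)/2`.
  refine ⟨4 + 4 * C, by positivity, ?_⟩
  intro s lam Lam K hlam hs hs1 hK U η L hU hcU hη hcη hL v hv
  have hL0 : 0 ≤ L := (norm_nonneg _).trans (hL 0)
  have hη' : ∀ x, |fderiv ℝ η x v| ≤ L := fun x => by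
    have := (fderiv ℝ η x).le_opNorm v
    rw [hv, mul_one] at this
    exact this.trans (hL x)
  have hD := abs_sub_le_of_norm_fderiv_le (hη.differentiable two_ne_zero) hL
  have hUint := integrable_sq_sub_mul_riesz hn hs hs1 (hU.of_le (by norm_num)) hcU
  obtain ⟨Lη, hLη⟩ := ContDiff.lipschitzWith_of_hasCompactSupport hcη hη two_ne_zero
  have hcω := hcU.fderiv_apply_const v
  have hω := (hU.fderiv_apply_const v).continuous
  have hint := integrable_sq_sub_mul_kernel hn hs hs1 hK.measurable
    (fun z hz => hK.abs_le hlam hs1 hz) hLη hcη hω hcω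
  obtain ⟨A, hA0, hA⟩ := hcω.isCompact.isBounded.subset_closedBall_lt 0 (0 : 𝔼)
  -- The support of `ω` lies in the ball of radius `A`, so only `‖x - y‖ ≤ 2A` matters and the outer
  -- scale can be fixed at `2A`; only the inner scale shrinks.
  let ε : ℕ → ℝ := fun m => A / (m + 1)
  have hε : ∀ m, 0 < ε m := fun m => by positivity
  have hεA : ∀ m, 2 * ε m ≤ 2 * A := fun m => by
    have : ε m ≤ A := div_le_self hA0.le (by linarith [(Nat.cast_nonneg m : (0 : ℝ) ≤ m)])
    linarith
  choose χ hχ p0 p1 pε pM pone pd using fun m => hC (ε m) (2 * A) (hε m) (hεA m)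
  have key : ∀ m, |∫ p : 𝔼 × 𝔼, (η p.1 - η p.2) ^ 2 * (fderiv ℝ U p.1 v * fderiv ℝ U p.2 v) *
      (K (p.1 - p.2) * χ m (p.1 - p.2))| ≤ (4 + 4 * C) * L ^ 2 * ((2 - s) * Lam) *
        ∫ p : 𝔼 × 𝔼, (U p.1 - U p.2) ^ 2 * rieszKernel s (p.1 - p.2) := by
    intro m
    have hk := hK.contDiff_mul (hχ m) (hε m) (pε m)
    have hck : HasCompactSupport fun z => K z * χ m z :=
      .intro (isCompact_closedBall (0 : 𝔼) (2 * (2 * A))) fun z hz => by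
        rw [pM m z, mul_zero]
        rw [mem_closedBall_zero_iff, not_le] at hz
        exact hz.le
    rw [integral_sq_sub_mul_fderiv_mul_fderiv hU hη hcη hk hck v, ← integral_const_mul,
      ← Real.norm_eq_abs]
    refine norm_integral_le_of_norm_le (hUint.const_mul _) ?_
    filter_upwards [ae_fst_ne_snd hn] with p hp
    have hz : p.1 - p.2 ≠ 0 := sub_ne_zero.2 hp
    obtain ⟨b0, b1, b2⟩ := hK.deriv_mul_bounds hlam hs1 (hχ m) (p0 m) (p1 m) hv
      (fun z => pd m z v hv) hz
    have hDp := hD p.1 p.2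
    have e1 := hη' p.1
    have e2 := hη' p.2
    set z := p.1 - p.2
    set B := (2 - s) * Lam * rieszKernel s z with hBdef
    set k₀ := K z * χ m z
    set k₁ := fderiv ℝ (fun z => K z * χ m z) z v
    set k₂ := fderiv ℝ (fun y => fderiv ℝ (fun z => K z * χ m z) y v) z v
    set D := η p.1 - η p.2
    set x' := fderiv ℝ η p.1 v
    set y' := fderiv ℝ η p.2 v
    have hz0 := norm_nonneg z
    have hB0 : 0 ≤ B := (abs_nonneg _).trans b0
    have hQ : |x' * y' * k₀ + D * (x' + y') * k₁ + D ^ 2 / 2 * k₂| ≤ (4 + 4 * C) * L ^ 2 * B := by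
      calc |x' * y' * k₀ + D * (x' + y') * k₁ + D ^ 2 / 2 * k₂|
          ≤ |x'| * |y'| * |k₀| + |D| * (|x'| + |y'|) * |k₁| + |D| ^ 2 / 2 * |k₂| := by
            refine (abs_add_le _ _).trans (add_le_add ((abs_add_le _ _).trans
              (add_le_add ?_ ?_)) ?_)
            · rw [abs_mul, abs_mul]
            · rw [abs_mul, abs_mul]
              gcongr
              exact abs_add_le _ _
            · rw [abs_mul, abs_div, abs_pow, abs_two]
        _ ≤ L * L * B + (L * ‖z‖) * (L + L) * |k₁| + (L * ‖z‖) ^ 2 / 2 * |k₂| := by gcongr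
        _ = L ^ 2 * (B + 2 * (‖z‖ * |k₁|) + (‖z‖ ^ 2 * |k₂|) / 2) := by ring
        _ ≤ L ^ 2 * (B + 2 * ((1 + C) * B) + ((1 + 3 * C) * B) / 2) := by gcongr
        _ ≤ L ^ 2 * ((4 + 4 * C) * B) := by
            gcongr
            nlinarith [mul_nonneg hC0.le hB0]
        _ = _ := by ring
    rw [Real.norm_eq_abs, abs_mul, abs_of_nonneg (sq_nonneg (U p.1 - U p.2))]
    calc _ ≤ (U p.1 - U p.2) ^ 2 * ((4 + 4 * C) * L ^ 2 * B) :=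
          mul_le_mul_of_nonneg_left hQ (sq_nonneg _)
      _ = _ := by
          rw [hBdef]
          ring
  -- Off the diagonal the truncated integrand is eventually equal to the full one, and the latter
  -- dominates because the cutoffs lie in `[0, 1]`.
  have hlim : Filter.Tendsto (fun m => ∫ p : 𝔼 × 𝔼, (η p.1 - η p.2) ^ 2 *
      (fderiv ℝ U p.1 v * fderiv ℝ U p.2 v) * (K (p.1 - p.2) * χ m (p.1 - p.2))) Filter.atTop
      (nhds (∫ p : 𝔼 × 𝔼, (η p.1 - η p.2) ^ 2 * (fderiv ℝ U p.1 v * fderiv ℝ U p.2 v) *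
        K (p.1 - p.2))) := by
    refine tendsto_integral_of_dominated_convergence _ (fun m => ?_) hint.norm (fun m => ?_) ?_
    · have h1 : Continuous fun p : 𝔼 × 𝔼 => χ m (p.1 - p.2) :=
        (hχ m).continuous.comp (by fun_prop)
      refine (hint.aestronglyMeasurable.mul h1.aestronglyMeasurable).congr
        (.of_forall fun p => ?_)
      simp only [Pi.mul_apply]
      ring
    · refine .of_forall fun p => ?_
      rw [← mul_assoc, norm_mul]
      refine mul_le_of_le_one_right (norm_nonneg _) ?_
      rw [Real.norm_of_nonneg (p0 m _)]
      exact p1 m _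
    · filter_upwards [ae_fst_ne_snd hn] with p hp
      refine tendsto_const_nhds.congr' ?_
      have hεlim : Filter.Tendsto (fun m => 2 * ε m) Filter.atTop (nhds 0) := by
        have := (tendsto_one_div_add_atTop_nhds_zero_nat (𝕜 := ℝ)).const_mul (2 * A)
        simpa [ε, div_eq_mul_inv, mul_assoc] using this
      filter_upwards [hεlim.eventually (gt_mem_nhds (norm_pos_iff.2 (sub_ne_zero.2 hp)))] with m hm
      by_cases h : p.1 ∈ tsupport (fun x => fderiv ℝ U x v) ∧ p.2 ∈ tsupport (fun x => fderiv ℝ U x v)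
      · rw [pone m _ hm.le, mul_one]
        have h1 : ‖p.1‖ ≤ A := by simpa using hA h.1
        have h2 : ‖p.2‖ ≤ A := by simpa using hA h.2
        exact (norm_sub_le _ _).trans (by linarith)
      · have : fderiv ℝ U p.1 v * fderiv ℝ U p.2 v = 0 := by
          rw [mul_eq_zero]
          rw [not_and_or] at h
          exact h.imp (fun h => image_eq_zero_of_notMem_tsupport (f := fun x => fderiv ℝ U x v) h)
            (fun h => image_eq_zero_of_notMem_tsupport (f := fun x => fderiv ℝ U x v) h)
        rw [this]
        ring
  exact le_of_tendsto hlim.abs (.of_forall key)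

end TruncatedKernel

/-! ### The linearized equation in weak form -/

section WeakLinearizedEquation

variable {n : ℕ}

local notation "𝔼" => EuclideanSpace ℝ (Fin n)

/-- The Riesz kernel cut off in the ball of radius `δ`. -/
noncomputable def rieszTail (s δ : ℝ) (z : 𝔼) : ℝ :=
  (Metric.ball (0 : 𝔼) δ)ᶜ.indicator (rieszKernel s) z

lemma rieszTail_nonneg (s δ : ℝ) (z : 𝔼) : 0 ≤ rieszTail s δ z :=
  indicator_nonneg (fun z _ => rieszKernel_nonneg s z) z

lemma rieszTail_of_le {s δ : ℝ} {z : 𝔼} (hz : δ ≤ ‖z‖) : rieszTail s δ z = rieszKernel s z :=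
  indicator_of_mem (by simpa using hz) _

lemma integral_rieszTail (hn : 0 < n) {s δ : ℝ} (hs : 0 < s) (hδ : 0 < δ) :
    Integrable (rieszTail (n := n) s δ) ∧
      ∫ z : 𝔼, rieszTail s δ z = sphereArea n * (δ ^ (-s) / s) := by
  have h := integral_norm_rpow_compl_ball (n := n) hn hs hδ
  have e : (fun z : 𝔼 => ‖z‖ ^ (-s - (n : ℝ))) = rieszKernel s := by
    ext z
    rw [rieszKernel, show -((n : ℝ) + s) = -s - n by ring]
  rw [e] at h
  exact ⟨h.1.integrable_indicator measurableSet_ball.compl,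
    (integral_indicator measurableSet_ball.compl).trans h.2⟩

lemma integral_mul_comp_sub {g G : 𝔼 → ℝ} (hg : Integrable g) (hG : Integrable G) :
    Integrable (fun p : 𝔼 × 𝔼 => g p.1 * G (p.1 - p.2)) ∧
      ∫ p : 𝔼 × 𝔼, g p.1 * G (p.1 - p.2) = (∫ x, g x) * ∫ z, G z := by
  have h := (measurePreserving_sub_prod (volume : Measure 𝔼) (volume : Measure 𝔼)).comp
    Measure.measurePreserving_swap
  have hi := (hG.comp_neg.mul_prod hg)
  have h1 := h.integrable_comp_of_integrable hi
  have h2 : Integrable (fun p : 𝔼 × 𝔼 => g p.1 * G (p.1 - p.2)) := by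
    refine h1.congr (.of_forall fun p => ?_)
    simp [mul_comm]
  refine ⟨h2, ?_⟩
  rw [integral_prod_eq_shear h2]
  simp only [sub_sub_cancel]
  simp_rw [integral_mul_const]
  rw [integral_const_mul]

/-- Chain rule and integration by parts. It serves with `f = W'` to produce the potential term, and
with the identity elsewhere. -/
lemma integral_mul_comp_fderiv_eq {f : ℝ → ℝ} (hf : ContDiff ℝ 1 f) {U g : 𝔼 → ℝ}
    (hU : ContDiff ℝ 1 U) (hg : ContDiff ℝ 1 g) (hcg : HasCompactSupport g) (v : 𝔼) :
    ∫ x, g x * (deriv f (U x) * fderiv ℝ U x v) = -∫ x, f (U x) * fderiv ℝ g x v := by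
  have hfU := hf.comp hU
  have hd : ∀ x, fderiv ℝ (f ∘ U) x v = deriv f (U x) * fderiv ℝ U x v := by
    intro x
    have := (hf.differentiable one_ne_zero (U x)).hasDerivAt.comp_hasFDerivAt x
      (hU.differentiable one_ne_zero x).hasFDerivAt
    rw [this.fderiv]
    rfl
  have c1 : Continuous fun x => fderiv ℝ (f ∘ U) x v :=
    (hfU.continuous_fderiv one_ne_zero).clm_apply continuous_const
  have c2 : Continuous fun x => fderiv ℝ g x v :=
    (hg.continuous_fderiv one_ne_zero).clm_apply continuous_const
  have h := integral_mul_fderiv_eq_neg_fderiv_mul_of_integrable (μ := (volume : Measure 𝔼))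
    (f := f ∘ U) (g := g) (v := v)
    ((c1.mul hg.continuous).integrable_of_hasCompactSupport hcg.mul_left)
    ((hfU.continuous.mul c2).integrable_of_hasCompactSupport (hcg.fderiv_apply_const v).mul_left)
    ((hfU.continuous.mul hg.continuous).integrable_of_hasCompactSupport hcg.mul_left)
    (fun x _ => hfU.differentiable one_ne_zero x) (fun x _ => hg.differentiable one_ne_zero x)
  simp only [Function.comp] at h hd
  rw [h, neg_neg]
  refine integral_congr_ae (.of_forall fun x => ?_)
  simp only
  rw [hd, mul_comm]

/-- For fixed increment `z`, integrate by parts in `x` alone: `H z` is a constant there, so `H`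
needs no regularity. -/
lemma integral_fderiv_mul_sub_mul_kernel (hn : 0 < n) {s P : ℝ} (hs : 0 < s) (hs1 : s < 1)
    {H : 𝔼 → ℝ} (hH : Measurable H) (hHP : ∀ z, z ≠ 0 → |H z| ≤ P * rieszKernel s z)
    {U g : 𝔼 → ℝ} (hU : ContDiff ℝ 2 U) (hcU : HasCompactSupport U) (hg : ContDiff ℝ 1 g)
    (hcg : HasCompactSupport g) (v : 𝔼) :
    ∫ p : 𝔼 × 𝔼, fderiv ℝ g p.1 v * (U p.1 - U p.2) * H (p.1 - p.2) =
      -∫ p : 𝔼 × 𝔼, g p.1 * (fderiv ℝ U p.1 v - fderiv ℝ U p.2 v) * H (p.1 - p.2) := by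
  obtain ⟨L, hL⟩ := ContDiff.lipschitzWith_of_hasCompactSupport hcU hU two_ne_zero
  obtain ⟨L', hL'⟩ := hU.lipschitz_fderiv_apply hcU v
  have ch : Continuous fun x => fderiv ℝ g x v :=
    (hg.continuous_fderiv one_ne_zero).clm_apply continuous_const
  have hch := hcg.fderiv_apply_const v
  rw [integral_prod_eq_shear (integrable_mul_sub_mul_kernel hn hs hs1 hH hHP hL hcU ch hch),
    integral_prod_eq_shear (integrable_mul_sub_mul_kernel hn hs hs1 hH hHP hL'
      (hcU.fderiv_apply_const v) hg.continuous hcg), ← integral_neg]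
  refine integral_congr_ae (.of_forall fun z => ?_)
  simp only [sub_sub_cancel]
  rw [integral_mul_const, integral_mul_const, ← neg_mul]
  congr 1
  have hUz : ContDiff ℝ 1 fun x => U x - U (x - z) :=
    (hU.of_le (by norm_num)).sub ((hU.of_le (by norm_num)).comp (contDiff_id.sub contDiff_const))
  have h := integral_mul_comp_fderiv_eq contDiff_id hUz hg hcg v
  simp only [deriv_id, one_mul, id] at h
  have hd := hU.differentiable two_ne_zero
  have e : ∀ x, fderiv ℝ (fun x => U x - U (x - z)) x v =
      fderiv ℝ U x v - fderiv ℝ U (x - z) v := by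
    intro x
    have hd' : DifferentiableAt ℝ (fun x => U (x - z)) x :=
      (hd _).comp x (differentiableAt_id.sub_const z)
    rw [fderiv_fun_sub (hd x) hd', sub_apply,
      fderiv_comp_sub]
  simp_rw [e] at h
  rw [h, neg_neg]
  refine integral_congr_ae (.of_forall fun x => ?_)
  simp only
  ring

lemma integrable_comp_sub_mul (hn : 0 < n) {s A δ : ℝ} (hs : 0 < s) (hδ : 0 < δ)
    {H g : 𝔼 → ℝ} {y : 𝔼} (hH : Measurable H) (hg : Continuous g) (hcg : HasCompactSupport g)
    (hb : ∀ x, g x ≠ 0 → |H (x - y)| ≤ A * rieszTail s δ (x - y)) :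
    Integrable fun x => H (x - y) * g x := by
  obtain ⟨B, hB⟩ := hcg.exists_bound_of_continuous hg
  have hgm := hg.measurable
  have hB0 : 0 ≤ B := (norm_nonneg _).trans (hB 0)
  refine ((((integral_rieszTail (n := n) hn hs hδ).1.comp_sub_right y).const_mul |A|).mul_const
    B).mono' (Measurable.aestronglyMeasurable (by fun_prop)) (.of_forall fun x => ?_)
  rw [norm_mul, Real.norm_eq_abs]
  have hT := rieszTail_nonneg s δ (x - y)
  by_cases h : g x = 0
  · rw [h, norm_zero, mul_zero]
    positivity
  · refine mul_le_mul ((hb x h).trans ?_) (hB x) (norm_nonneg _) (by positivity)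
    exact mul_le_mul_of_nonneg_right (le_abs_self A) hT

/-- The contribution to the linearized equation of the part `e` of `u` supported away from `g`. -/
lemma IsKernelL2.abs_integral_far_le (hn : 0 < n) {s lam Lam : ℝ} {K : 𝔼 → ℝ}
    (hK : IsKernelL2 s lam Lam K) (hlam : 0 < lam) (hLam : 0 < Lam) (hs : 0 < s) (hs1 : s < 1)
    {δ : ℝ} (hδ : 0 < δ) {g e : 𝔼 → ℝ} (hg : ContDiff ℝ 1 g)
    (hcg : HasCompactSupport g) (hem : AEMeasurable e) (he1 : ∀ y, |e y| ≤ 1)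
    (hsep : ∀ x ∈ tsupport g, ∀ y, e y ≠ 0 → δ ≤ ‖x - y‖) {v : 𝔼} (hv : ‖v‖ = 1) :
    Integrable (fun p : 𝔼 × 𝔼 => fderiv ℝ g p.1 v * e p.2 * K (p.1 - p.2)) ∧
    |∫ p : 𝔼 × 𝔼, fderiv ℝ g p.1 v * e p.2 * K (p.1 - p.2)| ≤
      (2 - s) * Lam * (sphereArea n * (δ ^ (-s) / s)) / δ * ∫ x, |g x| := by
  obtain ⟨hTi, hTe⟩ := integral_rieszTail (n := n) hn hs hδ
  set P := (2 - s) * Lam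
  have hP : 0 ≤ P := mul_nonneg (by linarith) hLam.le
  have hKm := hK.measurable
  have hK'm : Measurable fun z => fderiv ℝ K z v := measurable_fderiv_apply_const ℝ K v
  have ch : Continuous fun x => fderiv ℝ g x v :=
    (hg.continuous_fderiv one_ne_zero).clm_apply continuous_const
  have hch := hcg.fderiv_apply_const v
  have hsub : ∀ x, fderiv ℝ g x v ≠ 0 → x ∈ tsupport g := fun x hx => by
    by_contra h
    exact hx (fderiv_apply_eq_zero_of_notMem_tsupport h v)
  have hsub' : ∀ x, g x ≠ 0 → x ∈ tsupport g := fun x hx => subset_tsupport _ hx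
  have hKb : ∀ z : 𝔼, δ ≤ ‖z‖ → |K z| ≤ P * rieszTail s δ z := fun z hz => by
    rw [rieszTail_of_le hz]
    exact hK.abs_le hlam hs1 (norm_pos_iff.1 (hδ.trans_le hz))
  have hK'b : ∀ z : 𝔼, δ ≤ ‖z‖ → |fderiv ℝ K z v| ≤ P / δ * rieszTail s δ z := fun z hz => by
    have hz0 : z ≠ 0 := norm_pos_iff.1 (hδ.trans_le hz)
    have := (le_max_left _ _).trans (hK.deriv_bound z hz0 v hv)
    rw [div_norm_rpow_eq] at this
    rw [rieszTail_of_le hz, div_mul_eq_mul_div, le_div_iff₀ hδ]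
    nlinarith [abs_nonneg (fderiv ℝ K z v)]
  have hdom : ∀ (f H : 𝔼 → ℝ) (A : ℝ), 0 ≤ A → (∀ x, f x ≠ 0 → x ∈ tsupport g) →
      (∀ z : 𝔼, δ ≤ ‖z‖ → |H z| ≤ A * rieszTail s δ z) → ∀ p : 𝔼 × 𝔼,
      ‖f p.1 * e p.2 * H (p.1 - p.2)‖ ≤ |f p.1| * (A * rieszTail s δ (p.1 - p.2)) := by
    intro f H A hA hf hH p
    have hT := rieszTail_nonneg s δ (p.1 - p.2)
    by_cases h : f p.1 = 0 ∨ e p.2 = 0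
    · rw [mul_eq_zero.2 h, zero_mul, norm_zero]
      positivity
    · rw [not_or] at h
      rw [norm_mul, norm_mul, Real.norm_eq_abs, Real.norm_eq_abs, Real.norm_eq_abs]
      calc |f p.1| * |e p.2| * |H (p.1 - p.2)|
          ≤ |f p.1| * 1 * (A * rieszTail s δ (p.1 - p.2)) := by
            gcongr
            · exact he1 _
            · exact hH _ (hsep _ (hf _ h.1) _ h.2)
        _ = _ := by ring
  have hm : ∀ f H : 𝔼 → ℝ, Continuous f → Measurable H →
      AEStronglyMeasurable fun p : 𝔼 × 𝔼 => f p.1 * e p.2 * H (p.1 - p.2) := by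
    intro f H hf hH
    have h1 : AEMeasurable fun p : 𝔼 × 𝔼 => e p.2 :=
      hem.comp_quasiMeasurePreserving Measure.quasiMeasurePreserving_snd
    have h2 : Measurable fun p : 𝔼 × 𝔼 => f p.1 := by
      have := hf.measurable
      fun_prop
    have h3 : Measurable fun p : 𝔼 × 𝔼 => H (p.1 - p.2) := by fun_prop
    exact ((h2.aemeasurable.mul h1).mul h3.aemeasurable).aestronglyMeasurable
  have hint1 : Integrable (fun p : 𝔼 × 𝔼 => fderiv ℝ g p.1 v * e p.2 * K (p.1 - p.2)) :=
    (integral_mul_comp_sub (ch.integrable_of_hasCompactSupport hch).abs (hTi.const_mul P)).1.mono'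
      (hm _ K ch hKm) (.of_forall (hdom (fun x => fderiv ℝ g x v) K P hP hsub hKb))
  have hdom2 := integral_mul_comp_sub (hg.continuous.integrable_of_hasCompactSupport hcg).abs
    (hTi.const_mul (P / δ))
  have hint2 : Integrable (fun p : 𝔼 × 𝔼 => g p.1 * e p.2 * fderiv ℝ K (p.1 - p.2) v) :=
    hdom2.1.mono' (hm _ _ hg.continuous hK'm)
      (.of_forall (hdom g (fun z => fderiv ℝ K z v) (P / δ) (by positivity) hsub' hK'b))
  refine ⟨hint1, ?_⟩
  -- For fixed `y` with `e y ≠ 0`, the function `x ↦ K(x - y)` is differentiable on the support of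
  -- `g`, by separation. The derivative must land on `K`, as `e` is only measurable.
  have heq : ∫ p : 𝔼 × 𝔼, fderiv ℝ g p.1 v * e p.2 * K (p.1 - p.2) =
      -∫ p : 𝔼 × 𝔼, g p.1 * e p.2 * fderiv ℝ K (p.1 - p.2) v := by
    rw [Measure.volume_eq_prod, integral_prod_symm _ hint1, integral_prod_symm _ hint2,
      ← integral_neg]
    refine integral_congr_ae (.of_forall fun y => ?_)
    simp only
    by_cases hy : e y = 0
    · simp [hy]
    have hdK : ∀ x, δ ≤ ‖x - y‖ → DifferentiableAt ℝ K (x - y) := fun x hx =>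
      (hK.contDiffAt (norm_pos_iff.1 (hδ.trans_le hx))).differentiableAt two_ne_zero
    have h := integral_mul_fderiv_eq_neg_fderiv_mul_of_integrable (μ := (volume : Measure 𝔼))
      (f := fun x => K (x - y)) (g := g) (v := v)
      (by
        simp_rw [fderiv_comp_sub]
        exact integrable_comp_sub_mul hn hs hδ (H := fun z => fderiv ℝ K z v) hK'm hg.continuous hcg
          fun x hx => hK'b _ (hsep x (hsub' x hx) y hy))
      (integrable_comp_sub_mul hn hs hδ (H := K) hKm ch hch
          fun x hx => hKb _ (hsep x (hsub x hx) y hy))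
      (integrable_comp_sub_mul hn hs hδ (H := K) hKm hg.continuous hcg
          fun x hx => hKb _ (hsep x (hsub' x hx) y hy))
      (fun x hx => (hdK x (hsep x hx y hy)).comp x (differentiableAt_id.sub_const y))
      (fun x _ => hg.differentiable one_ne_zero x)
    simp_rw [fderiv_comp_sub] at h
    calc ∫ x, fderiv ℝ g x v * e y * K (x - y)
        = e y * ∫ x, K (x - y) * fderiv ℝ g x v := by
          rw [← integral_const_mul]
          congr 1 with x
          ring
      _ = -(e y * ∫ x, fderiv ℝ K (x - y) v * g x) := by rw [h, mul_neg]
      _ = _ := by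
          rw [← integral_const_mul]
          congr 2 with x
          ring
  rw [heq, abs_neg]
  calc |∫ p : 𝔼 × 𝔼, g p.1 * e p.2 * fderiv ℝ K (p.1 - p.2) v|
      ≤ ∫ p : 𝔼 × 𝔼, |g p.1| * (P / δ * rieszTail s δ (p.1 - p.2)) :=
        norm_integral_le_of_norm_le hdom2.1
          (.of_forall (hdom g (fun z => fderiv ℝ K z v) (P / δ) (by positivity) hsub' hK'b))
    _ = _ := by
        rw [hdom2.2, integral_const_mul, hTe]
        ring

/-- The linearized equation tested against `g`. -/
lemma IsNonlocalSolution.abs_linearized_le (hn : 0 < n) {s lam Lam : ℝ} {K : 𝔼 → ℝ}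
    (hK : IsKernelL2 s lam Lam K) (hlam : 0 < lam) (hLam : 0 < Lam) (hs : 0 < s) (hs1 : s < 1)
    {W : ℝ → ℝ} (hW : ContDiff ℝ 3 W) {Ω : Set 𝔼} {u : 𝔼 → ℝ} (hu : IsNonlocalSolution K W Ω u)
    {δ : ℝ} (hδ : 0 < δ) {U g : 𝔼 → ℝ} (hU : ContDiff ℝ 2 U) (hcU : HasCompactSupport U)
    (hUu : ∀ x, |u x - U x| ≤ 1) (hg : ContDiff ℝ 1 g) (hcg : HasCompactSupport g)
    (hgΩ : tsupport g ⊆ Ω) (hgU : ∀ x ∈ tsupport g, U x = u x)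
    (hsep : ∀ x ∈ tsupport g, ∀ y, u y ≠ U y → δ ≤ ‖x - y‖) {v : 𝔼} (hv : ‖v‖ = 1) :
    |(∫ x, g x * (deriv (deriv W) (U x) * fderiv ℝ U x v)) +
      ∫ p : 𝔼 × 𝔼, g p.1 * (fderiv ℝ U p.1 v - fderiv ℝ U p.2 v) * K (p.1 - p.2)| ≤
      (2 - s) * Lam * (sphereArea n * (δ ^ (-s) / s)) / δ * ∫ x, |g x| := by
  have hW' : ContDiff ℝ 1 (deriv W) := by
    have : ContDiff ℝ (2 + 1) W := by simpa [show (2 : WithTop ℕ∞) + 1 = 3 by norm_num] using hW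
    exact (this.deriv').of_le (by norm_num)
  obtain ⟨L, hL⟩ := ContDiff.lipschitzWith_of_hasCompactSupport hcU hU two_ne_zero
  have ch : Continuous fun x => fderiv ℝ g x v :=
    (hg.continuous_fderiv one_ne_zero).clm_apply continuous_const
  have hch := hcg.fderiv_apply_const v
  have hKP := fun z (hz : z ≠ 0) => hK.abs_le hlam hs1 hz
  have i1 := integrable_mul_sub_mul_kernel hn hs hs1 hK.measurable hKP hL hcU ch hch
  obtain ⟨i2, hfar⟩ := hK.abs_integral_far_le hn hlam hLam hs hs1 hδ (e := fun y => u y - U y) hg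
    hcg (hu.aemeasurable.sub hU.continuous.aemeasurable) hUu
    (fun x hx y hy => hsep x hx y (sub_ne_zero.1 hy)) hv
  have e1 := integral_mul_comp_fderiv_eq hW' (hU.of_le (by norm_num)) hg hcg v
  have e2 := integral_fderiv_mul_sub_mul_kernel hn hs hs1 hK.measurable hKP hU hcU hg hcg v
  -- This is the equation multiplied by `∂ᵥg` and integrated, with `U(x) - u(y)` split as `(U(x) -
  -- U(y)) - (u(y) - U(y))`.
  have e3 : -∫ x, deriv W (U x) * fderiv ℝ g x v =
      ∫ p : 𝔼 × 𝔼, (fderiv ℝ g p.1 v * (U p.1 - U p.2) * K (p.1 - p.2) -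
        fderiv ℝ g p.1 v * (u p.2 - U p.2) * K (p.1 - p.2)) := by
    have i3 : Integrable fun p : 𝔼 × 𝔼 => fderiv ℝ g p.1 v * (U p.1 - U p.2) * K (p.1 - p.2) -
        fderiv ℝ g p.1 v * (u p.2 - U p.2) * K (p.1 - p.2) := i1.sub i2
    rw [Measure.volume_eq_prod, integral_prod _ i3, ← integral_neg]
    refine integral_congr_ae (.of_forall fun x => ?_)
    simp only
    by_cases hx : x ∈ tsupport g
    · have heq := hu.equation x (hgΩ hx)
      rw [nonlocalOp, ← hgU x hx] at heq
      calc -(deriv W (U x) * fderiv ℝ g x v)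
          = fderiv ℝ g x v * ∫ y, (U x - u y) * K (x - y) := by
            rw [eq_neg_of_add_eq_zero_left heq]
            ring
        _ = _ := by
            rw [← integral_const_mul]
            congr 1 with y
            ring
    · simp [fderiv_apply_eq_zero_of_notMem_tsupport hx v]
  rw [e1, e3, integral_sub i1 i2, e2]
  rw [show ∀ a b : ℝ, -a - b + a = -b by intros; ring, abs_neg]
  exact hfar

end WeakLinearizedEquation

/-! ### Stability against the linearized equation -/

section StabilityInequality

variable {n : ℕ}

local notation "𝔼" => EuclideanSpace ℝ (Fin n)

/-- The linearized equation is tested with `η²ω`, stability with `|ηω|`. Both contain the same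
integral of `W''(u)η²ω²`, which disappears on combining them. What is left on the left-hand side is
nonzero only where `ω` takes opposite signs at the two points. -/
lemma IsStableNonlocalSolution.integral_cross_le (hn : 0 < n) {s lam Lam : ℝ} {K : 𝔼 → ℝ}
    (hK : IsKernelL2 s lam Lam K) (hlam : 0 < lam) (hLam : 0 < Lam) (hs : 0 < s) (hs1 : s < 1)
    {W : ℝ → ℝ} (hW : ContDiff ℝ 3 W) {Ω : Set 𝔼} {u : 𝔼 → ℝ}
    (hu : IsStableNonlocalSolution K W Ω u)
    {δ : ℝ} (hδ : 0 < δ) {U η : 𝔼 → ℝ} (hU : ContDiff ℝ 2 U) (hcU : HasCompactSupport U)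
    (hUu : ∀ x, |u x - U x| ≤ 1) (hη : ContDiff ℝ 2 η) (hcη : HasCompactSupport η)
    (hη0 : ∀ x, 0 ≤ η x) (hηΩ : tsupport η ⊆ Ω) (hηU : ∀ x ∈ tsupport η, U x = u x)
    (hsep : ∀ x ∈ tsupport η, ∀ y, u y ≠ U y → δ ≤ ‖x - y‖) {v : 𝔼} (hv : ‖v‖ = 1) :
    Integrable (fun p : 𝔼 × 𝔼 => η p.1 * η p.2 *
      (|fderiv ℝ U p.1 v * fderiv ℝ U p.2 v| - fderiv ℝ U p.1 v * fderiv ℝ U p.2 v) *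
        K (p.1 - p.2)) ∧
    ∫ p : 𝔼 × 𝔼, η p.1 * η p.2 *
      (|fderiv ℝ U p.1 v * fderiv ℝ U p.2 v| - fderiv ℝ U p.1 v * fderiv ℝ U p.2 v) *
        K (p.1 - p.2) ≤
      1 / 2 * (∫ p : 𝔼 × 𝔼, (η p.1 - η p.2) ^ 2 * (fderiv ℝ U p.1 v * fderiv ℝ U p.2 v) *
        K (p.1 - p.2)) +
      (2 - s) * Lam * (sphereArea n * (δ ^ (-s) / s)) / δ *
        ∫ x, |η x ^ 2 * fderiv ℝ U x v| := by
  have hω := hU.fderiv_apply_const v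
  have hcω := hcU.fderiv_apply_const v
  obtain ⟨Lω, hLω⟩ := hU.lipschitz_fderiv_apply hcU v
  obtain ⟨Lη, hLη⟩ := ContDiff.lipschitzWith_of_hasCompactSupport hcη hη two_ne_zero
  have hη1 : ContDiff ℝ 1 η := hη.of_le (by norm_num)
  have hfar : ∀ g : 𝔼 → ℝ, ContDiff ℝ 1 g → tsupport g ⊆ tsupport η →
      |(∫ x, g x * (deriv (deriv W) (U x) * fderiv ℝ U x v)) +
        ∫ p : 𝔼 × 𝔼, g p.1 * (fderiv ℝ U p.1 v - fderiv ℝ U p.2 v) * K (p.1 - p.2)| ≤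
      (2 - s) * Lam * (sphereArea n * (δ ^ (-s) / s)) / δ * ∫ x, |g x| := fun g hg hgη =>
    hu.toIsNonlocalSolution.abs_linearized_le hn hK hlam hLam hs hs1 hW hδ hU hcU hUu hg
      (hcη.mono' (subset_closure.trans hgη)) (hgη.trans hηΩ) (fun x hx => hηU x (hgη hx))
      (fun x hx => hsep x (hgη hx)) hv
  set ω : 𝔼 → ℝ := fun x => fderiv ℝ U x v
  have hg : ContDiff ℝ 1 fun x => η x ^ 2 * ω x := (hη1.pow 2).mul hω
  have hgη : tsupport (fun x => η x ^ 2 * ω x) ⊆ tsupport η := by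
    refine closure_mono fun x hx hx' => hx ?_
    simp [hx']
  have hcg : HasCompactSupport fun x => η x ^ 2 * ω x := hcη.mono' (subset_closure.trans hgη)
  have hfar := hfar _ hg hgη
  have hξ0 : ContDiff ℝ 1 fun x => η x * ω x := hη1.mul hω
  have hcξ0 : HasCompactSupport fun x => η x * ω x := hcη.mul_right
  obtain ⟨Lξ, hLξ⟩ := ContDiff.lipschitzWith_of_hasCompactSupport hcξ0 hξ0 one_ne_zero
  -- The modulus destroys differentiability, which is why test functions in the stability condition
  -- must be allowed to be merely Lipschitz.
  have hξ : LipschitzWith Lξ fun x => |η x * ω x| := by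
    have := (lipschitzWith_one_norm (E := ℝ)).comp hLξ
    rw [one_mul] at this
    exact this
  have hcξ : HasCompactSupport fun x => |η x * ω x| := hcξ0.norm
  have hstab := hu.stable _ ⟨_, hξ⟩ hcξ (fun x hx => by
    have : η x = 0 := image_eq_zero_of_notMem_tsupport fun h => hx (hηΩ h)
    simp [this])
  have hKP := fun z (hz : z ≠ 0) => hK.abs_le hlam hs1 hz
  have hKm := hK.measurable
  have i1 := integrable_sub_mul_sub_mul_kernel hn hs hs1 hKm hKP hK.symm hLω hcω hg.continuous hcg
  have i2 := integrable_sub_mul_sub_mul_kernel hn hs hs1 hKm hKP hK.symm hξ hcξ hξ.continuous hcξ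
  have i3 := integrable_sq_sub_mul_kernel hn hs hs1 hKm hKP hLη hcη hω.continuous hcω
  have esymm := integral_mul_sub_mul_kernel_symm hn hs hs1 hKm hKP hK.symm hLω hcω hg.continuous hcg
  have eW : ∫ x, deriv (deriv W) (u x) * |η x * ω x| ^ 2 =
      ∫ x, η x ^ 2 * ω x * (deriv (deriv W) (U x) * ω x) := by
    refine integral_congr_ae (.of_forall fun x => ?_)
    simp only
    rw [sq_abs]
    by_cases hx : x ∈ tsupport η
    · rw [hηU x hx]
      ring
    · rw [image_eq_zero_of_notMem_tsupport hx]
      ring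
  have eξ : ∫ p : 𝔼 × 𝔼, |(|η p.1 * ω p.1|) - (|η p.2 * ω p.2|)| ^ 2 * K (p.1 - p.2) =
      ∫ p : 𝔼 × 𝔼, (|η p.1 * ω p.1| - |η p.2 * ω p.2|) * (|η p.1 * ω p.1| - |η p.2 * ω p.2|) *
        K (p.1 - p.2) := by
    refine integral_congr_ae (.of_forall fun p => ?_)
    simp only
    rw [sq_abs, sq]
  rw [eW, eξ] at hstab
  -- The three terms on the right are, in order, those handled by the linearized equation, by
  -- stability, and by the double integration by parts.
  have hpt : ∀ a b x y : ℝ, 0 ≤ a → 0 ≤ b → a * b * (|x * y| - x * y) =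
      1 / 2 * ((a ^ 2 * x - b ^ 2 * y) * (x - y) -
        (|a * x| - |b * y|) * (|a * x| - |b * y|) + (a - b) ^ 2 * (x * y)) := by
    intro a b x y ha hb
    have h1 : |a * x| * |a * x| = (a * x) ^ 2 := by rw [← sq, sq_abs]
    have h2 : |b * y| * |b * y| = (b * y) ^ 2 := by rw [← sq, sq_abs]
    have h3 : |a * x| * |b * y| = a * b * |x * y| := by
      rw [abs_mul, abs_mul, abs_mul, abs_of_nonneg ha, abs_of_nonneg hb]
      ring
    linear_combination 1 / 2 * h1 + 1 / 2 * h2 - h3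
  have e : (fun p : 𝔼 × 𝔼 => η p.1 * η p.2 * (|ω p.1 * ω p.2| - ω p.1 * ω p.2) *
      K (p.1 - p.2)) = fun p => 1 / 2 *
      ((η p.1 ^ 2 * ω p.1 - η p.2 ^ 2 * ω p.2) * (ω p.1 - ω p.2) * K (p.1 - p.2) -
        (|η p.1 * ω p.1| - |η p.2 * ω p.2|) * (|η p.1 * ω p.1| - |η p.2 * ω p.2|) *
          K (p.1 - p.2) + (η p.1 - η p.2) ^ 2 * (ω p.1 * ω p.2) * K (p.1 - p.2)) := by
    ext p
    rw [hpt _ _ _ _ (hη0 p.1) (hη0 p.2)]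
    ring
  have i12 : Integrable fun p : 𝔼 × 𝔼 =>
      (η p.1 ^ 2 * ω p.1 - η p.2 ^ 2 * ω p.2) * (ω p.1 - ω p.2) * K (p.1 - p.2) -
        (|η p.1 * ω p.1| - |η p.2 * ω p.2|) * (|η p.1 * ω p.1| - |η p.2 * ω p.2|) *
          K (p.1 - p.2) := i1.sub i2
  change Integrable (fun p : 𝔼 × 𝔼 => η p.1 * η p.2 * (|ω p.1 * ω p.2| - ω p.1 * ω p.2) *
    K (p.1 - p.2)) ∧ ∫ p : 𝔼 × 𝔼, η p.1 * η p.2 * (|ω p.1 * ω p.2| - ω p.1 * ω p.2) *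
      K (p.1 - p.2) ≤ _
  rw [e]
  refine ⟨(i12.add i3).const_mul _, ?_⟩
  rw [integral_const_mul, integral_add i12 i3, integral_sub i1 i2, esymm]
  have := (_root_.abs_le.1 hfar).2
  linarith

end StabilityInequality

/-! ### From the sign defect to the total variation -/

section TotalVariation

variable {n : ℕ}

local notation "𝔼" => EuclideanSpace ℝ (Fin n)

lemma IsKernelL2.lower_of_norm_le {s lam Lam R : ℝ} {K : 𝔼 → ℝ} (hK : IsKernelL2 s lam Lam K)
    (hlam : 0 < lam) (hs : 0 < s) (hs1 : s < 1) {z : 𝔼} (hz : z ≠ 0)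
    (hzR : ‖z‖ ≤ R) : lam / R ^ ((n : ℝ) + s) ≤ K z := by
  refine le_trans ?_ (hK.lower z hz)
  have hz0 : 0 < ‖z‖ := norm_pos_iff.2 hz
  have : 0 < ‖z‖ ^ ((n : ℝ) + s) := Real.rpow_pos_of_pos hz0 _
  refine div_le_div₀ (by nlinarith) (by nlinarith) this ?_
  exact Real.rpow_le_rpow hz0.le hzR (by positivity)

/-- By Fubini the difference of the two squares is the double integral of `ηη(|ωω| - ωω)`. This
integrand is nonnegative, and on its support points are at distance at most `2R`, so the lower bound
for `K` can be inserted. -/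
lemma integral_abs_sq_le_of_kernel {s lam Lam R Z : ℝ} {K : 𝔼 → ℝ} (hn : 0 < n)
    (hK : IsKernelL2 s lam Lam K)
    (hlam : 0 < lam) (hs : 0 < s) (hs1 : s < 1) (hR : 0 < R) {η ω : 𝔼 → ℝ} (hη : Continuous η)
    (hη0 : ∀ x, 0 ≤ η x) (hηR : ∀ x, η x ≠ 0 → ‖x‖ ≤ R) (hω : Continuous ω)
    (hcω : HasCompactSupport ω)
    (hi : Integrable (fun p : 𝔼 × 𝔼 => η p.1 * η p.2 * (|ω p.1 * ω p.2| - ω p.1 * ω p.2) *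
      K (p.1 - p.2)))
    (hZ : ∫ p : 𝔼 × 𝔼, η p.1 * η p.2 * (|ω p.1 * ω p.2| - ω p.1 * ω p.2) * K (p.1 - p.2) ≤ Z) :
    (∫ x, η x * |ω x|) ^ 2 ≤ (∫ x, η x * ω x) ^ 2 + (2 * R) ^ ((n : ℝ) + s) / lam * Z := by
  have i1 : Integrable fun x => η x * |ω x| :=
    (hη.mul hω.abs).integrable_of_hasCompactSupport (f := fun x => η x * |ω x|)
      (hcω.norm.mul_left)
  have i2 : Integrable fun x => η x * ω x :=
    (hη.mul hω).integrable_of_hasCompactSupport (f := fun x => η x * ω x) hcω.mul_left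
  have j1 := i1.mul_prod i1
  have j2 := i2.mul_prod i2
  have hρ : 0 < (2 * R) ^ ((n : ℝ) + s) := Real.rpow_pos_of_pos (by linarith) _
  have h : lam / (2 * R) ^ ((n : ℝ) + s) * ((∫ x, η x * |ω x|) ^ 2 - (∫ x, η x * ω x) ^ 2) ≤ Z := by
    rw [sq, sq, ← integral_prod_mul, ← integral_prod_mul, ← integral_sub j1 j2,
      ← integral_const_mul]
    refine le_trans (integral_mono_ae ((j1.sub j2).const_mul _) hi ?_) hZ
    filter_upwards [ae_fst_ne_snd hn] with p hp
    have hz : p.1 - p.2 ≠ 0 := sub_ne_zero.2 hp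
    rw [show η p.1 * |ω p.1| * (η p.2 * |ω p.2|) - η p.1 * ω p.1 * (η p.2 * ω p.2) =
      η p.1 * η p.2 * (|ω p.1 * ω p.2| - ω p.1 * ω p.2) by rw [abs_mul]; ring]
    by_cases h0 : η p.1 * η p.2 = 0
    · simp [h0]
    · rw [← ne_eq, mul_ne_zero_iff] at h0
      have hz2 : ‖p.1 - p.2‖ ≤ 2 * R := (norm_sub_le _ _).trans (by
        linarith [hηR _ h0.1, hηR _ h0.2])
      rw [mul_comm]
      refine mul_le_mul_of_nonneg_left (hK.lower_of_norm_le hlam hs hs1 hz hz2) ?_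
      exact mul_nonneg (mul_nonneg (hη0 _) (hη0 _)) (sub_nonneg.2 (le_abs_self _))
  rw [div_mul_eq_mul_div, div_le_iff₀ hρ] at h
  rw [← sub_le_iff_le_add', div_mul_eq_mul_div, le_div_iff₀ hlam]
  linarith

lemma measureReal_closedBall_zero {R : ℝ} (hR : 0 ≤ R) :
    (volume : Measure 𝔼).real (Metric.closedBall 0 R) =
      R ^ n * (volume : Measure 𝔼).real (Metric.ball 0 1) := by
  rw [measureReal_def, Measure.addHaar_closedBall _ _ hR, ENNReal.toReal_mul,
    ENNReal.toReal_ofReal (by positivity)]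
  simp [measureReal_def]

lemma abs_integral_mul_fderiv_le {U η : 𝔼 → ℝ} {L R : ℝ} (hR : 0 ≤ R) (hU : ContDiff ℝ 1 U)
    (hη : ContDiff ℝ 1 η)
    (hcη : HasCompactSupport η) (hU1 : ∀ x, |U x| ≤ 1) (hL : ∀ x, ‖fderiv ℝ η x‖ ≤ L)
    (hηR : tsupport η ⊆ Metric.closedBall 0 R) {v : 𝔼} (hv : ‖v‖ = 1) :
    |∫ x, η x * fderiv ℝ U x v| ≤
      L * (R ^ n * (volume : Measure 𝔼).real (Metric.ball 0 1)) := by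
  have h := integral_mul_comp_fderiv_eq contDiff_id hU hη hcη v
  simp only [deriv_id, one_mul, id] at h
  rw [h, abs_neg]
  have e : ∫ x, U x * fderiv ℝ η x v = ∫ x in Metric.closedBall (0 : 𝔼) R, U x * fderiv ℝ η x v := by
    rw [setIntegral_eq_integral_of_forall_compl_eq_zero]
    intro x hx
    rw [fderiv_apply_eq_zero_of_notMem_tsupport (fun h => hx (hηR h)) v, mul_zero]
  rw [e, ← Real.norm_eq_abs]
  rw [← measureReal_closedBall_zero hR]
  refine norm_setIntegral_le_of_norm_le_const measure_closedBall_lt_top fun x _ => ?_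
  rw [norm_mul, Real.norm_eq_abs]
  have h1 := (fderiv ℝ η x).le_opNorm v
  rw [hv, mul_one] at h1
  calc |U x| * ‖fderiv ℝ η x v‖ ≤ 1 * L := by
        gcongr
        · exact hU1 x
        · exact h1.trans (hL x)
    _ = L := one_mul L

end TotalVariation

/-! ### Replacing the solution by a compactly supported function -/

section Localization

variable {n : ℕ}

local notation "𝔼" => EuclideanSpace ℝ (Fin n)

/-- The total variation of `u` in the closed ball of radius `r`. -/
noncomputable def ballVariation (u : 𝔼 → ℝ) (r : ℝ) : ℝ :=
  ∫ x in Metric.closedBall (0 : 𝔼) r, ‖fderiv ℝ u x‖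

lemma ballVariation_nonneg (u : 𝔼 → ℝ) (r : ℝ) : 0 ≤ ballVariation u r :=
  integral_nonneg fun _ => norm_nonneg _

lemma continuousOn_fderiv_ball {u : 𝔼 → ℝ} {T : ℝ} (hu : ContDiffOn ℝ 2 u (Metric.ball 0 T)) :
    ContinuousOn (fderiv ℝ u) (Metric.ball 0 T) :=
  hu.continuousOn_fderiv_of_isOpen Metric.isOpen_ball (by norm_num)

lemma integrableOn_norm_fderiv {u : 𝔼 → ℝ} {T b : ℝ} (hu : ContDiffOn ℝ 2 u (Metric.ball 0 T))
    (hbT : b < T) : IntegrableOn (fun x => ‖fderiv ℝ u x‖) (Metric.closedBall 0 b) :=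
  ((continuousOn_fderiv_ball hu).norm.mono
    (Metric.closedBall_subset_ball hbT)).integrableOn_compact (isCompact_closedBall _ _)

lemma ballVariation_mono {u : 𝔼 → ℝ} {T a b : ℝ} (hu : ContDiffOn ℝ 2 u (Metric.ball 0 T))
    (hab : a ≤ b) (hbT : b < T) : ballVariation u a ≤ ballVariation u b :=
  setIntegral_mono_set (integrableOn_norm_fderiv hu hbT) (.of_forall fun _ => norm_nonneg _)
    (Metric.closedBall_subset_closedBall hab).eventuallyLE

variable (n) in
-- Multiply `u` by a cutoff between radii `a` and `b`. Only the cutoff's gradient adds to the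
-- variation, and it costs the volume of the ball over `b - a` because `|u| ≤ 1`.
lemma exists_localization : ∃ C : ℝ, 0 < C ∧ ∀ (u : 𝔼 → ℝ) (T a b : ℝ), 0 < a → a < b → b < T →
    (∀ x, |u x| ≤ 1) → ContDiffOn ℝ 2 u (Metric.ball 0 T) → ∃ U : 𝔼 → ℝ, ContDiff ℝ 2 U ∧
      HasCompactSupport U ∧ (∀ x, |U x| ≤ 1) ∧ (∀ x, |u x - U x| ≤ 1) ∧
      (∀ x, ‖x‖ ≤ a → U x = u x) ∧ (∀ x, b ≤ ‖x‖ → U x = 0) ∧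
      ∫ x, ‖fderiv ℝ U x‖ ≤ ballVariation u b + C * (b ^ n / (b - a)) := by
  obtain ⟨C, hC, h⟩ := exists_cutoff n
  have hβ : 0 < (volume : Measure 𝔼).real (Metric.ball 0 1) :=
    ENNReal.toReal_pos (Metric.measure_ball_pos _ _ one_pos).ne' measure_ball_lt_top.ne
  refine ⟨C * (volume : Measure 𝔼).real (Metric.ball 0 1), by positivity, ?_⟩
  intro u T a b ha hab hbT hu1 hu
  obtain ⟨ψ, hψ, p0, p1, pa, pb, pd⟩ := h a b ha hab
  have hb0 : 0 < b := ha.trans hab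
  have hzero : ∀ x : 𝔼, b < ‖x‖ → (fun x => ψ x * u x) =ᶠ[nhds x] fun _ => 0 := by
    intro x hx
    filter_upwards [continuous_norm.continuousAt.eventually (lt_mem_nhds hx)] with y hy
    rw [pb y hy.le, zero_mul]
  have hU : ContDiff ℝ 2 fun x => ψ x * u x := by
    rw [contDiff_iff_contDiffAt]
    intro x
    rcases lt_or_ge ‖x‖ T with hx | hx
    · exact hψ.contDiffAt.mul (hu.contDiffAt (Metric.isOpen_ball.mem_nhds (by simpa using hx)))
    · exact contDiffAt_const.congr_of_eventuallyEq (hzero x (hbT.trans_le hx))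
  refine ⟨fun x => ψ x * u x, hU, .intro (isCompact_closedBall (0 : 𝔼) b) fun x hx => ?_,
    fun x => ?_, fun x => ?_, fun x hx => ?_, fun x hx => ?_, ?_⟩
  · rw [mem_closedBall_zero_iff, not_le] at hx
    rw [pb x hx.le, zero_mul]
  · rw [abs_mul, abs_of_nonneg (p0 x)]
    exact mul_le_one₀ (p1 x) (abs_nonneg _) (hu1 x)
  · rw [show u x - ψ x * u x = (1 - ψ x) * u x by ring, abs_mul,
      abs_of_nonneg (sub_nonneg.2 (p1 x))]
    exact mul_le_one₀ (by linarith [p0 x]) (abs_nonneg _) (hu1 x)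
  · beta_reduce
    rw [pa x hx, one_mul]
  · beta_reduce
    rw [pb x hx, zero_mul]
  · have e : ∫ x, ‖fderiv ℝ (fun x => ψ x * u x) x‖ =
        ∫ x in Metric.closedBall (0 : 𝔼) b, ‖fderiv ℝ (fun x => ψ x * u x) x‖ := by
      rw [setIntegral_eq_integral_of_forall_compl_eq_zero]
      intro x hx
      rw [mem_closedBall_zero_iff, not_le] at hx
      rw [(hzero x hx).fderiv_eq]
      simp
    have hbd : ∀ x ∈ Metric.closedBall (0 : 𝔼) b, ‖fderiv ℝ (fun x => ψ x * u x) x‖ ≤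
        ‖fderiv ℝ u x‖ + C / (b - a) := by
      intro x hx
      have hxT : x ∈ Metric.ball (0 : 𝔼) T := Metric.closedBall_subset_ball hbT hx
      have hd := (hu.contDiffAt (Metric.isOpen_ball.mem_nhds hxT)).differentiableAt two_ne_zero
      rw [fderiv_fun_mul (hψ.differentiable two_ne_zero x) hd]
      refine (norm_add_le _ _).trans ?_
      rw [norm_smul, norm_smul, Real.norm_of_nonneg (p0 x), Real.norm_eq_abs]
      refine add_le_add (mul_le_of_le_one_left (norm_nonneg _) (p1 x)) ?_
      exact (mul_le_of_le_one_left (norm_nonneg _) (hu1 x)).trans (pd x)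
    have hi := integrableOn_norm_fderiv hu hbT
    have hc : IntegrableOn (fun _ : 𝔼 => C / (b - a)) (Metric.closedBall 0 b) :=
      integrableOn_const measure_closedBall_lt_top.ne
    rw [e]
    calc _ ≤ ∫ x in Metric.closedBall (0 : 𝔼) b, (‖fderiv ℝ u x‖ + C / (b - a)) := by
          refine setIntegral_mono_on ?_ (hi.add hc) measurableSet_closedBall hbd
          exact (((hU.continuous_fderiv two_ne_zero).norm).continuousOn).integrableOn_compact
            (isCompact_closedBall _ _)
      _ = _ := by
          rw [integral_add hi hc, setIntegral_const, measureReal_closedBall_zero hb0.le,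
            smul_eq_mul, ballVariation]
          ring

lemma norm_clm_le_sum (A : 𝔼 →L[ℝ] ℝ) :
    ‖A‖ ≤ ∑ i : Fin n, |A (EuclideanSpace.single i 1)| := by
  refine A.opNorm_le_bound (Finset.sum_nonneg fun _ _ => abs_nonneg _) fun y => ?_
  have hy : y = ∑ i : Fin n, y i • EuclideanSpace.single i (1 : ℝ) := by
    have := (EuclideanSpace.basisFun (Fin n) ℝ).sum_repr y
    simpa using this.symm
  calc ‖A y‖ = ‖∑ i : Fin n, y i * A (EuclideanSpace.single i 1)‖ := by
        conv_lhs => rw [hy]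
        simp [map_sum]
    _ ≤ ∑ i : Fin n, ‖y i * A (EuclideanSpace.single i 1)‖ := norm_sum_le _ _
    _ ≤ ∑ i : Fin n, |A (EuclideanSpace.single i 1)| * ‖y‖ := by
        refine Finset.sum_le_sum fun i _ => ?_
        rw [norm_mul, mul_comm]
        exact mul_le_mul_of_nonneg_left (PiLp.norm_apply_le y i) (norm_nonneg _)
    _ = _ := by rw [Finset.sum_mul]

/-- The norm of the gradient is at most the sum of the absolute partial derivatives, which reduces
the variation to `n` fixed directions. The strict inequality `r < a` makes `U` and `u` agree near
each point of the ball, hence to first order. -/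
lemma ballVariation_le_sum {u U η : 𝔼 → ℝ} {r a T : ℝ} (hu : ContDiffOn ℝ 2 u (Metric.ball 0 T))
    (hra : r < a) (haT : a < T) (hU : ContDiff ℝ 2 U) (hcU : HasCompactSupport U)
    (hUu : ∀ x, ‖x‖ ≤ a → U x = u x) (hη : Continuous η) (hη0 : ∀ x, 0 ≤ η x)
    (hη1 : ∀ x, ‖x‖ ≤ r → η x = 1) :
    ballVariation u r ≤
      ∑ i : Fin n, ∫ x, η x * |fderiv ℝ U x (EuclideanSpace.single i 1)| := by
  have hi : ∀ i : Fin n, Integrable fun x => η x * |fderiv ℝ U x (EuclideanSpace.single i 1)| :=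
    fun i => (hη.mul (hU.fderiv_apply_const _).continuous.abs).integrable_of_hasCompactSupport
      (f := fun x => η x * |fderiv ℝ U x (EuclideanSpace.single i 1)|)
      ((hcU.fderiv_apply_const _).norm.mul_left)
  rw [← integral_finsetSum _ fun i _ => hi i]
  have hs := integrable_finsetSum Finset.univ fun i _ => hi i
  refine le_trans (setIntegral_mono_on (integrableOn_norm_fderiv hu (hra.trans haT)) hs.integrableOn
    measurableSet_closedBall fun x hx => ?_)
    (setIntegral_le_integral hs (.of_forall fun x => Finset.sum_nonneg fun i _ =>
      mul_nonneg (hη0 x) (abs_nonneg _)))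
  rw [mem_closedBall_zero_iff] at hx
  have e : U =ᶠ[nhds x] u := by
    filter_upwards [continuous_norm.continuousAt.eventually (gt_mem_nhds (hx.trans_lt hra))]
      with y hy using hUu y hy.le
  rw [← e.fderiv_eq, hη1 x hx]
  simpa using norm_clm_le_sum (fderiv ℝ U x)

lemma integral_abs_sq_mul_fderiv_le {u U η : 𝔼 → ℝ} {a b T : ℝ}
    (hu : ContDiffOn ℝ 2 u (Metric.ball 0 T)) (hba : b < a) (haT : a < T)
    (hUu : ∀ x, ‖x‖ ≤ a → U x = u x) (hη0 : ∀ x, 0 ≤ η x) (hη1 : ∀ x, η x ≤ 1)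
    (hηb : ∀ x, b < ‖x‖ → η x = 0) (hU : ContDiff ℝ 2 U) (hη : Continuous η) {v : 𝔼}
    (hv : ‖v‖ = 1) :
    ∫ x, |η x ^ 2 * fderiv ℝ U x v| ≤ ballVariation u b := by
  have e : ∫ x, |η x ^ 2 * fderiv ℝ U x v| =
      ∫ x in Metric.closedBall (0 : 𝔼) b, |η x ^ 2 * fderiv ℝ U x v| := by
    rw [setIntegral_eq_integral_of_forall_compl_eq_zero]
    intro x hx
    rw [mem_closedBall_zero_iff, not_le] at hx
    simp [hηb x hx]
  rw [e]
  have hc : Continuous fun x => |η x ^ 2 * fderiv ℝ U x v| :=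
    ((hη.pow 2).mul (hU.fderiv_apply_const v).continuous).abs
  refine setIntegral_mono_on (hc.continuousOn.integrableOn_compact (isCompact_closedBall _ _))
    (integrableOn_norm_fderiv hu (hba.trans haT)) measurableSet_closedBall fun x hx => ?_
  rw [mem_closedBall_zero_iff] at hx
  have e : U =ᶠ[nhds x] u := by
    filter_upwards [continuous_norm.continuousAt.eventually (gt_mem_nhds (hx.trans_lt hba))]
      with y hy using hUu y hy.le
  rw [← e.fderiv_eq, abs_mul, abs_of_nonneg (sq_nonneg (η x))]
  have h1 := (fderiv ℝ U x).le_opNorm v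
  rw [hv, mul_one, Real.norm_eq_abs] at h1
  refine (mul_le_of_le_one_left (abs_nonneg _) ?_).trans h1
  exact pow_le_one₀ (hη0 x) (hη1 x)

end Localization

/-! ### The variation in a ball against that in a larger ball -/

section VariationStep

variable {n : ℕ}

local notation "𝔼" => EuclideanSpace ℝ (Fin n)

/-- Interpolation bound for the Gagliardo energy of a bounded compactly supported function. -/
lemma integral_sq_sub_mul_riesz_le (hn : 0 < n) {s R : ℝ} (hs : 0 < s) (hs1 : s < 1)
    (hR : 0 < R) {U : 𝔼 → ℝ} (hU : ContDiff ℝ 1 U) (hc : HasCompactSupport U)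
    (hb : ∀ x, |U x| ≤ 1) :
    ∫ p : 𝔼 × 𝔼, (U p.1 - U p.2) ^ 2 * rieszKernel s (p.1 - p.2) ≤
      2 * sphereArea n * (R ^ (1 - s) / (1 - s) * (∫ x, ‖fderiv ℝ U x‖) +
        R ^ (-s) / s * (2 * ∫ x, |U x|)) := by
  have hA := (sphereArea_pos hn).le
  have hI1 : 0 ≤ ∫ x, ‖fderiv ℝ U x‖ := integral_nonneg fun x => norm_nonneg _
  have hI2 : 0 ≤ ∫ x, |U x| := integral_nonneg fun x => abs_nonneg _
  have h1s : 0 < 1 - s := sub_pos.2 hs1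
  have h := lintegral_sq_sub_mul_rieszKernel_le hn hs hs1 hR hU hc hb
  rw [← ofReal_integral_eq_lintegral_ofReal (integrable_sq_sub_mul_riesz hn hs hs1 hU hc)
    (.of_forall fun p => mul_nonneg (sq_nonneg _) (rieszKernel_nonneg s _))] at h
  exact (ENNReal.ofReal_le_ofReal_iff (by positivity)).1 h

lemma integral_abs_le_of_support {U : 𝔼 → ℝ} {b : ℝ} (hb : 0 ≤ b) (hU1 : ∀ x, |U x| ≤ 1)
    (hU0 : ∀ x, b ≤ ‖x‖ → U x = 0) :
    ∫ x, |U x| ≤ b ^ n * (volume : Measure 𝔼).real (Metric.ball 0 1) := by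
  have e : ∫ x, |U x| = ∫ x in Metric.closedBall (0 : 𝔼) b, |U x| := by
    rw [setIntegral_eq_integral_of_forall_compl_eq_zero]
    intro x hx
    rw [mem_closedBall_zero_iff, not_le] at hx
    simp [hU0 x hx.le]
  rw [e, ← measureReal_closedBall_zero hb]
  have h := norm_setIntegral_le_of_norm_le_const (f := fun x => |U x|) (C := 1)
    (measure_closedBall_lt_top (μ := (volume : Measure 𝔼)) (x := 0) (r := b)) fun x _ => by
      rw [Real.norm_eq_abs, abs_abs]
      exact hU1 x
  rw [one_mul] at h
  exact (le_abs_self _).trans h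

/-- The estimate of the total variation in a ball by that in a larger ball, before
simplification. -/
lemma exists_ballVariation_sq_le (hn : 0 < n) : ∃ C₁ C₂ C₃ : ℝ, 0 < C₁ ∧ 0 < C₂ ∧ 0 < C₃ ∧
    ∀ (s lam Lam : ℝ) (K : 𝔼 → ℝ), 0 < lam → 0 < Lam → 0 < s → s < 1 → IsKernelL2 s lam Lam K →
    ∀ W : ℝ → ℝ, ContDiff ℝ 3 W → ∀ R : ℝ, 0 < R → ∀ u : 𝔼 → ℝ, (∀ x, |u x| ≤ 1) →
    IsStableNonlocalSolution K W (Metric.ball 0 (2 * R)) u →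
    ∀ r ρ : ℝ, 0 < r → r < ρ → ρ < 2 * R →
    ballVariation u r ^ 2 ≤ n ^ 2 *
      ((3 * C₂ / (ρ - r) * ((2 * R) ^ n * (volume : Measure 𝔼).real (Metric.ball 0 1))) ^ 2 +
      (2 * (2 * R)) ^ ((n : ℝ) + s) / lam *
        (1 / 2 * (C₁ * (3 * C₂ / (ρ - r)) ^ 2 * ((2 - s) * Lam) *
          (2 * sphereArea n * (R ^ (1 - s) / (1 - s) *
            (ballVariation u ρ + 3 * C₃ * (2 * R) ^ n / (ρ - r)) +
            R ^ (-s) / s * (2 * ((2 * R) ^ n *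
              (volume : Measure 𝔼).real (Metric.ball 0 1)))))) +
          (2 - s) * Lam * (sphereArea n * (((ρ - r) / 3) ^ (-s) / s)) / ((ρ - r) / 3) *
            ballVariation u ρ)) := by
  obtain ⟨C₁, hC₁, h₁⟩ := exists_cross_bound n hn
  obtain ⟨C₂, hC₂, h₂⟩ := exists_cutoff n
  obtain ⟨C₃, hC₃, h₃⟩ := exists_localization n
  refine ⟨C₁, C₂, C₃, hC₁, hC₂, hC₃, ?_⟩
  intro s lam Lam K hlam hLam hs hs1 hK W hW R hR u hu1 hu r ρ hr hrρ hρR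
  have huC := hu.contDiffOn
  set d := ρ - r with hd
  have hd0 : 0 < d := sub_pos.2 hrρ
  have hρ0 : 0 ≤ ρ := by linarith
  have hA := (sphereArea_pos hn).le
  have h1s : 0 < 1 - s := sub_pos.2 hs1
  have h2s : 0 ≤ (2 - s) * Lam := mul_nonneg (by linarith) hLam.le
  -- The gap `d` is cut into thirds: `η` descends on the first, the second separates its support
  -- from the error `u - U` (so `δ = d/3`), and `U` is cut off on the third.
  obtain ⟨η, hη, e0, e1, er, eb, ed⟩ := h₂ r (r + d / 3) hr (by linarith)
  obtain ⟨U, hU, hcU, hU1, hUu1, hUa, hUb, hUV⟩ := h₃ u (2 * R) (r + 2 * d / 3) ρ (by linarith)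
    (by linarith) hρR hu1 huC
  rw [show r + d / 3 - r = d / 3 by ring, show C₂ / (d / 3) = 3 * C₂ / d by field_simp] at ed
  have hcη : HasCompactSupport η := .intro (isCompact_closedBall (0 : 𝔼) (r + d / 3)) fun x hx => by
    rw [mem_closedBall_zero_iff, not_le] at hx
    exact eb x hx.le
  have hsη : tsupport η ⊆ Metric.closedBall 0 (r + d / 3) := by
    refine closure_minimal (fun x hx => ?_) Metric.isClosed_closedBall
    by_contra h
    rw [mem_closedBall_zero_iff, not_le] at h
    exact hx (eb x h.le)
  have hsη' : ∀ x ∈ tsupport η, ‖x‖ ≤ r + d / 3 := fun x hx => by simpa using hsη hx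
  set β := (volume : Measure 𝔼).real (Metric.ball 0 1)
  have hβ : 0 ≤ β := measureReal_nonneg
  set V := ballVariation u ρ
  have hE : ∫ p : 𝔼 × 𝔼, (U p.1 - U p.2) ^ 2 * rieszKernel s (p.1 - p.2) ≤
      2 * sphereArea n * (R ^ (1 - s) / (1 - s) * (V + 3 * C₃ * (2 * R) ^ n / d) +
        R ^ (-s) / s * (2 * ((2 * R) ^ n * β))) := by
    refine (integral_sq_sub_mul_riesz_le hn hs hs1 hR (hU.of_le (by norm_num)) hcU hU1).trans ?_
    have a1 : ∫ x, ‖fderiv ℝ U x‖ ≤ V + 3 * C₃ * (2 * R) ^ n / d := by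
      refine hUV.trans (add_le_add le_rfl ?_)
      rw [show ρ - (r + 2 * d / 3) = d / 3 by rw [hd]; ring]
      calc C₃ * (ρ ^ n / (d / 3)) = 3 * C₃ * ρ ^ n / d := by field_simp
        _ ≤ 3 * C₃ * (2 * R) ^ n / d := by gcongr
    have a2 : ∫ x, |U x| ≤ (2 * R) ^ n * β := by
      refine (integral_abs_le_of_support (by linarith) hU1 hUb).trans ?_
      gcongr
    gcongr
  have hdir : ∀ v : 𝔼, ‖v‖ = 1 → (∫ x, η x * |fderiv ℝ U x v|) ^ 2 ≤
      (3 * C₂ / d * ((2 * R) ^ n * β)) ^ 2 +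
      (2 * (2 * R)) ^ ((n : ℝ) + s) / lam *
        (1 / 2 * (C₁ * (3 * C₂ / d) ^ 2 * ((2 - s) * Lam) *
          (2 * sphereArea n * (R ^ (1 - s) / (1 - s) * (V + 3 * C₃ * (2 * R) ^ n / d) +
            R ^ (-s) / s * (2 * ((2 * R) ^ n * β))))) +
          (2 - s) * Lam * (sphereArea n * ((d / 3) ^ (-s) / s)) / (d / 3) * V) := by
    intro v hv
    obtain ⟨hi, hle⟩ := hu.integral_cross_le hn hK hlam hLam hs hs1 hW (δ := d / 3) (by linarith)
      hU hcU hUu1 hη hcη e0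
      (fun x hx => by
        have := hsη' x hx
        rw [mem_ball_zero_iff]
        linarith)
      (fun x hx => hUa x ((hsη' x hx).trans (by linarith)))
      (fun x hx y hy => by
        have h1 := hsη' x hx
        have h2 : r + 2 * d / 3 < ‖y‖ := by
          by_contra h
          exact hy (hUa y (not_lt.1 h)).symm
        have h3 := norm_sub_norm_le y x
        rw [norm_sub_rev] at h3
        linarith) hv
    have hcross := (le_abs_self _).trans
      (h₁ s lam Lam K hlam hs hs1 hK U η (3 * C₂ / d) hU hcU hη hcη ed v hv)
    have hV1 : ∫ x, |η x ^ 2 * fderiv ℝ U x v| ≤ V :=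
      (integral_abs_sq_mul_fderiv_le huC (b := r + d / 3) (a := r + 2 * d / 3) (by linarith)
        (by linarith) hUa e0 e1 (fun x hx => eb x hx.le) hU hη.continuous hv).trans
        (ballVariation_mono huC (by linarith) hρR)
    refine (integral_abs_sq_le_of_kernel hn hK hlam hs hs1 (R := 2 * R) (by linarith)
      hη.continuous e0 (fun x hx => (hsη' x (subset_tsupport _ hx)).trans (by linarith))
      (hU.fderiv_apply_const v).continuous (hcU.fderiv_apply_const v) hi le_rfl).trans ?_
    have hB := abs_integral_mul_fderiv_le (R := 2 * R) (by linarith) (hU.of_le (by norm_num))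
      (hη.of_le (by norm_num)) hcη hU1 ed
      (hsη.trans (Metric.closedBall_subset_closedBall (by linarith))) hv
    refine add_le_add (sq_le_sq' (neg_le_of_abs_le hB) (le_of_abs_le hB)) ?_
    refine mul_le_mul_of_nonneg_left (hle.trans ?_) (by positivity)
    have hδs : 0 ≤ (d / 3) ^ (-s) / s := by positivity
    refine add_le_add (mul_le_mul_of_nonneg_left (hcross.trans ?_) (by norm_num)) ?_
    · exact mul_le_mul_of_nonneg_left hE (by positivity)
    · exact mul_le_mul_of_nonneg_left hV1 (by positivity)
  set Z := (3 * C₂ / d * ((2 * R) ^ n * β)) ^ 2 +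
      (2 * (2 * R)) ^ ((n : ℝ) + s) / lam *
        (1 / 2 * (C₁ * (3 * C₂ / d) ^ 2 * ((2 - s) * Lam) *
          (2 * sphereArea n * (R ^ (1 - s) / (1 - s) * (V + 3 * C₃ * (2 * R) ^ n / d) +
            R ^ (-s) / s * (2 * ((2 * R) ^ n * β))))) +
          (2 - s) * Lam * (sphereArea n * ((d / 3) ^ (-s) / s)) / (d / 3) * V)
  have hsum : ballVariation u r ≤ n * √Z := by
    refine (ballVariation_le_sum huC (a := r + 2 * d / 3) (by linarith) (by linarith) hU hcU hUa
      hη.continuous e0 er).trans ?_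
    calc _ ≤ ∑ _i : Fin n, √Z := Finset.sum_le_sum fun i _ =>
          Real.le_sqrt_of_sq_le (hdir _ (by simp))
      _ = _ := by simp
  -- `Z` dominates a square in any direction; a coordinate direction exists because `n > 0`.
  have hZ0 : 0 ≤ Z := le_trans (sq_nonneg _) (hdir (EuclideanSpace.single ⟨0, hn⟩ 1) (by simp))
  calc ballVariation u r ^ 2 ≤ (n * √Z) ^ 2 := by
        gcongr
        exact ballVariation_nonneg u r
    _ = n ^ 2 * Z := by rw [mul_pow, Real.sq_sqrt hZ0]

end VariationStep

/-! ### Absorption and iteration over radii -/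

section Iteration

variable {n : ℕ}

local notation "𝔼" => EuclideanSpace ℝ (Fin n)

lemma rpow_mul_energy_eq {R s X Y : ℝ} (hR : 0 < R) :
    R ^ s * (R ^ (1 - s) / (1 - s) * X + R ^ (-s) / s * Y) = R / (1 - s) * X + Y / s := by
  have h1 : R ^ s * R ^ (1 - s) = R := by
    rw [← Real.rpow_add hR, add_sub_cancel, Real.rpow_one]
  have h2 : R ^ s * R ^ (-s) = 1 := by
    rw [← Real.rpow_add hR, add_neg_cancel, Real.rpow_zero]
  calc _ = (R ^ s * R ^ (1 - s)) / (1 - s) * X + (R ^ s * R ^ (-s)) / s * Y := by ring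
    _ = _ := by rw [h1, h2]; ring

/-- The left side is `(3R/d)^s` with base at least `1`, so the exponent can be raised to `1`. The
bound is then free of `s`. -/
lemma rpow_mul_rpow_neg_le {R d s : ℝ} (hd : 0 < d) (hdR : d ≤ R) (hs1 : s < 1) :
    R ^ s * (d / 3) ^ (-s) ≤ 3 * (R / d) := by
  have hR : 0 < R := hd.trans_le hdR
  rw [Real.rpow_neg (by positivity), ← div_eq_mul_inv, ← Real.div_rpow hR.le (by positivity)]
  have h1 : R / (d / 3) = 3 * (R / d) := by field_simp
  rw [h1]
  have h2 : 1 ≤ 3 * (R / d) := by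
    have := (one_le_div hd).2 hdR
    linarith
  calc (3 * (R / d)) ^ s ≤ (3 * (R / d)) ^ (1 : ℝ) := Real.rpow_le_rpow_of_exponent_le h2 hs1.le
    _ = _ := Real.rpow_one _

lemma rpow_dim_add_le {R s : ℝ} (hn : 0 < n) (hR : 0 < R) (hs1 : s < 1) :
    (2 * (2 * R)) ^ ((n : ℝ) + s) ≤ 4 ^ (n + 1) * (R ^ (n - 1) * R * R ^ s) := by
  rw [show 2 * (2 * R) = 4 * R by ring, Real.mul_rpow (by norm_num) hR.le, Real.rpow_add hR,
    Real.rpow_natCast, pow_sub_one_mul hn.ne']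
  gcongr
  calc (4 : ℝ) ^ ((n : ℝ) + s) ≤ 4 ^ (((n + 1 : ℕ) : ℝ)) :=
        Real.rpow_le_rpow_of_exponent_le (by norm_num) (by push_cast; linarith)
    _ = 4 ^ (n + 1) := Real.rpow_natCast _ _

/-- The right-hand side of the variation estimate, simplified. -/
lemma exists_variation_constant (hn : 0 < n) {s₀ lam Lam C₁ C₂ C₃ σ β : ℝ} (hs₀ : 0 < s₀)
    (hlam : 0 < lam) (hLam : 0 < Lam) (hC₁ : 0 < C₁) (hC₂ : 0 < C₂) (hC₃ : 0 < C₃) (hσ : 0 < σ)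
    (hβ : 0 < β) : ∃ C : ℝ, 0 < C ∧ ∀ s R d V : ℝ, s₀ < s → s < 1 → 0 < d → d ≤ R → 0 ≤ V →
    n ^ 2 * ((3 * C₂ / d * ((2 * R) ^ n * β)) ^ 2 +
      (2 * (2 * R)) ^ ((n : ℝ) + s) / lam *
        (1 / 2 * (C₁ * (3 * C₂ / d) ^ 2 * ((2 - s) * Lam) *
          (2 * σ * (R ^ (1 - s) / (1 - s) * (V + 3 * C₃ * (2 * R) ^ n / d) +
            R ^ (-s) / s * (2 * ((2 * R) ^ n * β))))) +
          (2 - s) * Lam * (σ * ((d / 3) ^ (-s) / s)) / (d / 3) * V)) ≤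
      C / (1 - s) * (R / d) ^ 3 * (R ^ (n - 1) * (R ^ (n - 1) + V)) := by
  -- The three constants belong to the square of `∫ ηω`, to the cross term, and to the far term.
  -- Dependence on `s₀` enters only by replacing `1/s` with `1/s₀`.
  set c₁ := (3 * C₂ * 2 ^ n * β) ^ 2
  set c₂ := 4 ^ (n + 1) / lam * (C₁ * (3 * C₂) ^ 2 * (2 * Lam) * σ)
  set c₃ := 4 ^ (n + 1) / lam * (2 * Lam * σ * 9 / s₀)
  refine ⟨n ^ 2 * (c₁ + c₂ * (1 + 3 * C₃ * 2 ^ n + 2 * 2 ^ n * β / s₀) + c₃) , by positivity, ?_⟩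
  intro s R d V hs hs1 hd hdR hV
  have hs0 : 0 < s := hs₀.trans hs
  have hR : 0 < R := hd.trans_le hdR
  have h1s : 0 < 1 - s := sub_pos.2 hs1
  have h2s : 0 < 2 - s := by linarith
  set M := R ^ (n - 1) with hM
  have hM0 : 0 < M := by positivity
  have hRn : R ^ n = M * R := (pow_sub_one_mul hn.ne' R).symm
  set q := R / d with hq
  have hq1 : 1 ≤ q := (one_le_div hd).2 hdR
  have hRq : R = q * d := by rw [hq]; field_simp
  set S := R ^ s with hS
  have hS0 : 0 < S := Real.rpow_pos_of_pos hR s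
  set X := V + 3 * C₃ * (2 * R) ^ n / d with hX
  set Y := 2 * ((2 * R) ^ n * β) with hY
  set A := R ^ (1 - s) / (1 - s) * X + R ^ (-s) / s * Y with hA
  have hSA : S * A = R / (1 - s) * X + Y / s := rpow_mul_energy_eq hR
  set D := (d / 3) ^ (-s) with hD
  have hSD : S * D ≤ 3 * q := rpow_mul_rpow_neg_le hd hdR hs1
  have hD0 : 0 < D := Real.rpow_pos_of_pos (by positivity) _
  have hX0 : 0 ≤ X := by positivity
  have hA0 : 0 ≤ A := by positivity
  -- `G` is the common majorant. The cube of `q = R/d` arises from two powers in the squared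
  -- gradient of `η` and a third from cutting off `U`.
  set G := q ^ 3 * (M * (M + V)) / (1 - s) with hG
  have hinv : 1 ≤ 1 / (1 - s) := (one_le_div h1s).2 (by linarith)
  have hq23 : q ^ 2 ≤ q ^ 3 := pow_le_pow_right₀ hq1 (by norm_num)
  have g0 : q ^ 3 * (M * (M + V)) ≤ G := by
    rw [hG, div_eq_mul_one_div]
    exact le_mul_of_one_le_right (by positivity) hinv
  have f1 : q ^ 2 * (M * M) ≤ G := le_trans (by gcongr; linarith) g0
  have f2 : q ^ 2 * (M * V) ≤ G := le_trans (by gcongr; linarith) g0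
  have f3 : q ^ 2 * (M * V) / (1 - s) ≤ G := by rw [hG]; gcongr; linarith
  have f4 : q ^ 3 * (M * M) / (1 - s) ≤ G := by rw [hG]; gcongr; linarith
  have t1 : (3 * C₂ / d * ((2 * R) ^ n * β)) ^ 2 ≤ c₁ * G := by
    have : (3 * C₂ / d * ((2 * R) ^ n * β)) ^ 2 = c₁ * (q ^ 2 * (M * M)) := by
      rw [mul_pow 2 R, hRn, hq]
      ring
    rw [this]
    gcongr
  have t2 : 4 ^ (n + 1) * (M * R * S) / lam * (1 / 2 * (C₁ * (3 * C₂ / d) ^ 2 * ((2 - s) * Lam) *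
      (2 * σ * A))) ≤ c₂ * (1 + 3 * C₃ * 2 ^ n + 2 * 2 ^ n * β / s₀) * G := by
    have e1 : 4 ^ (n + 1) * (M * R * S) / lam * (1 / 2 * (C₁ * (3 * C₂ / d) ^ 2 * ((2 - s) * Lam) *
        (2 * σ * A))) ≤ c₂ * (M * R / d ^ 2 * (S * A)) := by
      calc _ = 4 ^ (n + 1) / lam * (C₁ * (3 * C₂) ^ 2 * ((2 - s) * Lam) * σ) *
            (M * R / d ^ 2 * (S * A)) := by field_simp
        _ ≤ 4 ^ (n + 1) / lam * (C₁ * (3 * C₂) ^ 2 * (2 * Lam) * σ) *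
            (M * R / d ^ 2 * (S * A)) := by
            gcongr
            linarith
    have e2 : M * R / d ^ 2 * (S * A) = q ^ 2 * (M * V) / (1 - s) +
        3 * C₃ * 2 ^ n * (q ^ 3 * (M * M) / (1 - s)) + 2 * 2 ^ n * β / s * (q ^ 2 * (M * M)) := by
      rw [hSA, hX, hY, mul_pow 2 R, hRn, hq]
      field_simp
    have e3 : 2 * 2 ^ n * β / s * (q ^ 2 * (M * M)) ≤ 2 * 2 ^ n * β / s₀ * G := by gcongr
    calc _ ≤ _ := e1
      _ ≤ c₂ * (G + 3 * C₃ * 2 ^ n * G + 2 * 2 ^ n * β / s₀ * G) := by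
          rw [e2]
          gcongr
      _ = _ := by ring
  have t3 : 4 ^ (n + 1) * (M * R * S) / lam * ((2 - s) * Lam * (σ * (D / s)) / (d / 3) * V) ≤
      c₃ * G := by
    calc _ = 4 ^ (n + 1) / lam * ((2 - s) * Lam * σ * 3 / s) * (q * (S * D) * (M * V)) := by
          rw [hq]
          field_simp
      _ ≤ 4 ^ (n + 1) / lam * (2 * Lam * σ * 3 / s₀) * (q * (3 * q) * (M * V)) := by
          gcongr
          linarith
      _ = c₃ * (q ^ 2 * (M * V)) := by ring
      _ ≤ c₃ * G := by gcongr
  have hT := rpow_dim_add_le (n := n) hn hR hs1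
  calc _ ≤ n ^ 2 * ((3 * C₂ / d * ((2 * R) ^ n * β)) ^ 2 + 4 ^ (n + 1) * (M * R * S) / lam *
        (1 / 2 * (C₁ * (3 * C₂ / d) ^ 2 * ((2 - s) * Lam) * (2 * σ * A)) +
          (2 - s) * Lam * (σ * (D / s)) / (d / 3) * V)) := by gcongr
    _ ≤ n ^ 2 * (c₁ * G + (c₂ * (1 + 3 * C₃ * 2 ^ n + 2 * 2 ^ n * β / s₀) * G + c₃ * G)) := by
        rw [mul_add (4 ^ (n + 1) * (M * R * S) / lam)]
        gcongr
    _ = _ := by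
        rw [hG]
        ring

/-- Unrolling the recursion gives the geometric series `Σ (8/16)^k = 2`, and boundedness of `a`
kills the remainder `a k / 16^k`. -/
lemma le_of_iterated_bound {a : ℕ → ℝ} {B D : ℝ} (hB : ∀ k, a k ≤ B)
    (h : ∀ k, a k ≤ a (k + 1) / 16 + D * 8 ^ k) : a 0 ≤ 2 * D := by
  have key : ∀ k, a 0 ≤ a k / 16 ^ k + D * (2 - 2 / 2 ^ k) := by
    intro k
    induction k with
    | zero => simp
    | succ k ih =>
      have h1 := div_le_div_of_nonneg_right (h k) (by positivity : (0 : ℝ) ≤ 16 ^ k)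
      have e : (a (k + 1) / 16 + D * 8 ^ k) / 16 ^ k + D * (2 - 2 / 2 ^ k) =
          a (k + 1) / 16 ^ (k + 1) + D * (2 - 2 / 2 ^ (k + 1)) := by
        rw [show (16 : ℝ) ^ k = 8 ^ k * 2 ^ k by rw [← mul_pow]; norm_num,
          show (16 : ℝ) ^ (k + 1) = 8 ^ k * 2 ^ k * 16 by rw [pow_succ, ← mul_pow]; norm_num,
          pow_succ]
        field_simp
        ring
      linarith
  have l16 : Filter.Tendsto (fun k : ℕ => B / 16 ^ k) Filter.atTop (nhds 0) :=
    tendsto_const_nhds.div_atTop (tendsto_pow_atTop_atTop_of_one_lt (by norm_num))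
  have l2 : Filter.Tendsto (fun k : ℕ => (2 : ℝ) / 2 ^ k) Filter.atTop (nhds 0) :=
    tendsto_const_nhds.div_atTop (tendsto_pow_atTop_atTop_of_one_lt (by norm_num))
  have hl : Filter.Tendsto (fun k : ℕ => B / 16 ^ k + D * (2 - 2 / 2 ^ k)) Filter.atTop
      (nhds (0 + D * (2 - 0))) := l16.add ((tendsto_const_nhds.sub l2).const_mul D)
  refine ge_of_tendsto (by simpa [mul_comm] using hl) (.of_forall fun k => (key k).trans ?_)
  gcongr
  exact hB k

/-- The interior bound for the total variation of a stable solution. -/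
lemma exists_ballVariation_bound (hn : 0 < n) {s₀ lam Lam : ℝ} (hs₀ : 0 < s₀) (hlam : 0 < lam)
    (hLam : 0 < Lam) : ∃ C : ℝ, 0 < C ∧ ∀ s : ℝ, s₀ < s → s < 1 → ∀ W : ℝ → ℝ, ContDiff ℝ 3 W →
    ∀ K : 𝔼 → ℝ, IsKernelL2 s lam Lam K → ∀ R : ℝ, 0 < R → ∀ u : 𝔼 → ℝ, (∀ x, |u x| ≤ 1) →
    IsStableNonlocalSolution K W (Metric.ball 0 (2 * R)) u →
    ballVariation u (7 / 4 * R) ≤ C / (1 - s) * R ^ (n - 1) := by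
  obtain ⟨C₁, C₂, C₃, hC₁, hC₂, hC₃, h⟩ := exists_ballVariation_sq_le (n := n) hn
  have hβ : 0 < (volume : Measure 𝔼).real (Metric.ball 0 1) :=
    ENNReal.toReal_pos (Metric.measure_ball_pos _ _ one_pos).ne' measure_ball_lt_top.ne
  obtain ⟨C, hC, hC'⟩ := exists_variation_constant hn hs₀ hlam hLam hC₁ hC₂ hC₃ (sphereArea_pos hn) hβ
  refine ⟨2 * (1 + 16384 * C), by positivity, ?_⟩
  intro s hs hs1 W hW K hK R hR u hu1 hu
  have h1s : 0 < 1 - s := sub_pos.2 hs1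
  have hs0 : 0 < s := hs₀.trans hs
  set M := R ^ (n - 1)
  have hM : 0 < M := by positivity
  -- The radii increase from `7R/4` towards `15R/8`, which stays strictly inside `B_{2R}`, so the
  -- variations are uniformly bounded. The gaps are `R 2^(-k)/16`, hence `(R/d)³ = 4096 * 8^k`.
  let ρ : ℕ → ℝ := fun k => R * (15 / 8 - (1 / 2) ^ k / 8)
  have hpow : ∀ k : ℕ, 0 < (1 / 2 : ℝ) ^ k ∧ (1 / 2 : ℝ) ^ k ≤ 1 := fun k =>
    ⟨by positivity, pow_le_one₀ (by norm_num) (by norm_num)⟩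
  have hρ2 : ∀ k, ρ k ≤ 15 / 8 * R := fun k => by
    simp only [ρ]
    nlinarith [(hpow k).1]
  have hstep : ∀ k, ballVariation u (ρ k) ≤
      ballVariation u (ρ (k + 1)) / 16 + (1 / 16 + 16384 * C / (1 - s)) * M * 8 ^ k := by
    intro k
    have hd : ρ (k + 1) - ρ k = R * (1 / 2) ^ k / 16 := by
      simp only [ρ, pow_succ]
      ring
    have hV := ballVariation_nonneg u (ρ (k + 1))
    have hd0 : 0 < ρ (k + 1) - ρ k := by
      rw [hd]
      positivity
    have hdR : ρ (k + 1) - ρ k ≤ R := by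
      rw [hd]
      nlinarith [(hpow k).2]
    have h1 := (h s lam Lam K hlam hLam hs0 hs1 hK W hW R hR u hu1 hu (ρ k) (ρ (k + 1))
      (by simp only [ρ]; nlinarith [(hpow k).2]) (sub_pos.1 hd0)
      (by linarith [hρ2 (k + 1)])).trans (hC' s R _ _ hs hs1 hd0 hdR hV)
    have hq : R / (ρ (k + 1) - ρ k) = 16 * 2 ^ k := by
      rw [hd, one_div, inv_pow]
      field_simp
    have hq3 : (16 * 2 ^ k : ℝ) ^ 3 = 4096 * 8 ^ k := by
      rw [mul_pow, ← pow_mul, mul_comm k 3, pow_mul]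
      norm_num
    rw [hq, hq3] at h1
    set B := C / (1 - s) * (4096 * 8 ^ k) with hB
    have hB0 : 0 < B := by positivity
    set Y := M + ballVariation u (ρ (k + 1)) with hY
    -- Arithmetic-geometric inequality: `√(BMY) ≤ Y/16 + 4BM`. The weight `1/16` is chosen to beat
    -- the growth `8^k`.
    have h2 : ballVariation u (ρ k) ≤ Y / 16 + 4 * (B * M) := by
      refine abs_le_of_sq_le_sq' (a := ballVariation u (ρ k)) ?_ (by positivity) |>.2
      nlinarith [sq_nonneg (Y / 16 - 4 * (B * M)), mul_pos hB0 hM]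
    have h8 : (1 : ℝ) ≤ 8 ^ k := one_le_pow₀ (by norm_num)
    have h3 : M / 16 ≤ M / 16 * 8 ^ k := le_mul_of_one_le_right (by positivity) h8
    calc ballVariation u (ρ k) ≤ Y / 16 + 4 * (B * M) := h2
      _ = ballVariation u (ρ (k + 1)) / 16 + (M / 16 + 4 * (B * M)) := by rw [hY]; ring
      _ ≤ ballVariation u (ρ (k + 1)) / 16 + (M / 16 * 8 ^ k + 4 * (B * M)) := by gcongr
      _ = _ := by
          rw [hB]
          ring
  have hfin := le_of_iterated_bound (a := fun k => ballVariation u (ρ k))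
    (fun k => ballVariation_mono hu.contDiffOn (hρ2 k) (by linarith)) hstep
  have hρ0 : ρ 0 = 7 / 4 * R := by
    simp only [ρ]
    norm_num
    ring
  simp only [hρ0] at hfin
  refine hfin.trans ?_
  rw [← mul_assoc]
  gcongr
  have : 1 / 16 ≤ 1 / (1 - s) := by
    rw [div_le_div_iff₀ (by norm_num) h1s]
    linarith
  calc 2 * (1 / 16 + 16384 * C / (1 - s)) ≤ 2 * (1 / (1 - s) + 16384 * C / (1 - s)) := by gcongr
    _ = _ := by ring

end Iteration

/-! ### The Sobolev energy of the solution itself -/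

section SobolevEnergy

variable {n : ℕ}

local notation "𝔼" => EuclideanSpace ℝ (Fin n)

lemma rieszTail_neg (s δ : ℝ) (z : 𝔼) : rieszTail s δ (-z) = rieszTail s δ z := by
  by_cases h : δ ≤ ‖z‖
  · rw [rieszTail_of_le h, rieszTail_of_le (by simpa using h), rieszKernel_neg]
  · simp [rieszTail, not_le.1 h]

lemma measurableSet_interaction {Ω : Set 𝔼} (hΩ : MeasurableSet Ω) :
    MeasurableSet ((univ ×ˢ univ : Set (𝔼 × 𝔼)) \ (Ωᶜ ×ˢ Ωᶜ)) :=
  (MeasurableSet.univ.prod MeasurableSet.univ).diff (hΩ.compl.prod hΩ.compl)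

/-- The Sobolev energy of `u` is controlled by that of a localization `U` of `u` and a tail. -/
lemma sobolevEnergy_le (hn : 0 < n) {s lam Lam : ℝ} {K : 𝔼 → ℝ} (hK : IsKernelL2 s lam Lam K)
    (hlam : 0 < lam) (hLam : 0 < Lam) (hs : 0 < s) (hs1 : s < 1) {R δ : ℝ} (hR : 0 < R)
    (hδ : 0 < δ) {u U : 𝔼 → ℝ} (hu1 : ∀ x, |u x| ≤ 1) (hU : ContDiff ℝ 2 U)
    (hcU : HasCompactSupport U) (hUu : ∀ x, ‖x‖ ≤ R + δ → U x = u x) :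
    sobolevEnergy K (Metric.ball 0 R) u ≤ ENNReal.ofReal ((2 - s) * Lam *
      ((∫ p : 𝔼 × 𝔼, (U p.1 - U p.2) ^ 2 * rieszKernel s (p.1 - p.2)) +
        8 * (R ^ n * (volume : Measure 𝔼).real (Metric.ball 0 1) *
          (sphereArea n * (δ ^ (-s) / s))))) := by
  set P := (2 - s) * Lam
  have hP : 0 ≤ P := mul_nonneg (by linarith) hLam.le
  obtain ⟨hTi, hTe⟩ := integral_rieszTail (n := n) hn hs hδ
  let χ : 𝔼 → ℝ := (Metric.closedBall (0 : 𝔼) R).indicator fun _ => 1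
  have hχ0 : ∀ x, 0 ≤ χ x := fun x => indicator_nonneg (fun _ _ => zero_le_one) x
  have hχi : Integrable χ :=
    (integrableOn_const measure_closedBall_lt_top.ne).integrable_indicator measurableSet_closedBall
  have hχe : ∫ x, χ x = R ^ n * (volume : Measure 𝔼).real (Metric.ball 0 1) := by
    rw [integral_indicator measurableSet_closedBall, setIntegral_const, smul_eq_mul, mul_one,
      measureReal_closedBall_zero hR.le]
  obtain ⟨i1, e1⟩ := integral_mul_comp_sub hχi hTi
  have i0 := integrable_sq_sub_mul_riesz hn hs hs1 (hU.of_le (by norm_num)) hcU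
  have esw : (fun p : 𝔼 × 𝔼 => χ p.2 * rieszTail s δ (p.1 - p.2)) =
      fun p => (fun p : 𝔼 × 𝔼 => χ p.1 * rieszTail s δ (p.1 - p.2)) p.swap := by
    ext p
    simp only [Prod.fst_swap, Prod.snd_swap]
    rw [← rieszTail_neg, neg_sub]
  have i2 : Integrable fun p : 𝔼 × 𝔼 => χ p.2 * rieszTail s δ (p.1 - p.2) := by
    rw [esw]
    exact i1.swap
  have e2 : ∫ p : 𝔼 × 𝔼, χ p.2 * rieszTail s δ (p.1 - p.2) = (∫ x, χ x) * ∫ z : 𝔼, rieszTail s δ z := by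
    rw [esw, ← e1]
    exact integral_prod_swap (μ := (volume : Measure 𝔼)) (ν := (volume : Measure 𝔼))
      (fun p : 𝔼 × 𝔼 => χ p.1 * rieszTail s δ (p.1 - p.2))
  let F : 𝔼 × 𝔼 → ℝ := fun p => P * ((U p.1 - U p.2) ^ 2 * rieszKernel s (p.1 - p.2) +
    4 * (χ p.1 * rieszTail s δ (p.1 - p.2) + χ p.2 * rieszTail s δ (p.1 - p.2)))
  have i12 : Integrable fun p : 𝔼 × 𝔼 => 4 * (χ p.1 * rieszTail s δ (p.1 - p.2) +
    χ p.2 * rieszTail s δ (p.1 - p.2)) := (i1.add i2).const_mul 4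
  have hFi : Integrable F := (i0.add i12).const_mul P
  have hFe : ∫ p, F p = P * ((∫ p : 𝔼 × 𝔼, (U p.1 - U p.2) ^ 2 * rieszKernel s (p.1 - p.2)) +
      8 * (R ^ n * (volume : Measure 𝔼).real (Metric.ball 0 1) *
          (sphereArea n * (δ ^ (-s) / s)))) := by
    simp only [F]
    rw [integral_const_mul, integral_add i0 i12, integral_const_mul, integral_add i1 i2, e1, e2,
      hχe, hTe]
    ring
  have hF0 : ∀ p, 0 ≤ F p := fun p => by
    have := rieszKernel_nonneg s (p.1 - p.2)
    have := rieszTail_nonneg s δ (p.1 - p.2)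
    have := hχ0 p.1
    have := hχ0 p.2
    positivity
  have hbound : ∀ p ∈ (univ ×ˢ univ : Set (𝔼 × 𝔼)) \
      ((Metric.ball 0 R)ᶜ ×ˢ (Metric.ball 0 R)ᶜ), p.1 ≠ p.2 →
      |u p.1 - u p.2| ^ 2 * K (p.1 - p.2) ≤ F p := by
    intro p hp hne
    have hz : p.1 - p.2 ≠ 0 := sub_ne_zero.2 hne
    have hKz := (le_abs_self _).trans (hK.abs_le hlam hs1 hz)
    have hJ := rieszKernel_nonneg s (p.1 - p.2)
    have hT := rieszTail_nonneg s δ (p.1 - p.2)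
    have hmem : ‖p.1‖ < R ∨ ‖p.2‖ < R := by
      have := hp.2
      simp only [mem_prod, mem_compl_iff, mem_ball_zero_iff, not_and_or, not_not] at this
      exact this
    have h1 : |u p.1 - u p.2| ^ 2 * K (p.1 - p.2) ≤
        P * (|u p.1 - u p.2| ^ 2 * rieszKernel s (p.1 - p.2)) := by
      calc _ ≤ |u p.1 - u p.2| ^ 2 * (P * rieszKernel s (p.1 - p.2)) := by gcongr
        _ = _ := by ring
    refine h1.trans (mul_le_mul_of_nonneg_left ?_ hP)
    have hχ1 := hχ0 p.1
    have hχ2 := hχ0 p.2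
    -- Distant pairs have squared increment at most `4` and one point in `B_R`, so the tail term
    -- covers them. Close pairs both lie in the ball of radius `R + δ`, where `U = u`.
    rcases le_or_gt δ ‖p.1 - p.2‖ with hδz | hδz
    · have hχ12 : 1 ≤ χ p.1 + χ p.2 := by
        rcases hmem with h | h
        · have : χ p.1 = 1 := indicator_of_mem (by simpa using h.le) _
          linarith
        · have : χ p.2 = 1 := indicator_of_mem (by simpa using h.le) _
          linarith
      have h4 : |u p.1 - u p.2| ^ 2 ≤ 4 := by
        have : |u p.1 - u p.2| ≤ 2 := (abs_sub _ _).trans (by linarith [hu1 p.1, hu1 p.2])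
        nlinarith [abs_nonneg (u p.1 - u p.2)]
      rw [rieszTail_of_le hδz]
      have h5 : 0 ≤ (U p.1 - U p.2) ^ 2 * rieszKernel s (p.1 - p.2) :=
        mul_nonneg (sq_nonneg _) hJ
      have h6 : |u p.1 - u p.2| ^ 2 * rieszKernel s (p.1 - p.2) ≤ 4 * rieszKernel s (p.1 - p.2) :=
        mul_le_mul_of_nonneg_right h4 hJ
      nlinarith [mul_le_mul_of_nonneg_right hχ12 hJ]
    · have hR1 : ‖p.1‖ ≤ R + δ ∧ ‖p.2‖ ≤ R + δ := by
        have a1 := norm_sub_norm_le p.1 p.2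
        have a2 := norm_sub_norm_le p.2 p.1
        rw [norm_sub_rev] at a2
        rcases hmem with h | h <;> constructor <;> linarith
      rw [hUu _ hR1.1, hUu _ hR1.2, sq_abs]
      have : 0 ≤ 4 * (χ p.1 * rieszTail s δ (p.1 - p.2) + χ p.2 * rieszTail s δ (p.1 - p.2)) := by
        positivity
      linarith
  rw [← hFe, sobolevEnergy, ofReal_integral_eq_lintegral_ofReal hFi (.of_forall hF0)]
  calc _ ≤ 1 * ∫⁻ p in (univ ×ˢ univ : Set (𝔼 × 𝔼)) \
        ((Metric.ball 0 R)ᶜ ×ˢ (Metric.ball 0 R)ᶜ), ENNReal.ofReal (F p) := by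
        -- The factor `1/4` of the energy is simply bounded by `1`.
        refine mul_le_mul' ?_ (lintegral_mono_ae ?_)
        · rw [one_div]
          exact ENNReal.inv_le_one.2 (by norm_num)
        · filter_upwards [ae_restrict_of_ae (ae_fst_ne_snd hn),
            ae_restrict_mem (measurableSet_interaction measurableSet_ball)] with p hp hmem
          exact ENNReal.ofReal_le_ofReal (hbound p hmem hp)
    _ ≤ _ := by
        rw [one_mul]
        exact setLIntegral_le_lintegral _ _

end SobolevEnergy

theorem mainTheorem5 (n : ℕ) (hn : 2 ≤ n) (s₀ : ℝ) (hs₀ : 0 < s₀)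
    (lam Lam : ℝ) (hlam : 0 < lam) (hLam : 0 < Lam) :
    ∃ C : ℝ, 0 < C ∧
      ∀ s : ℝ, s₀ < s → s < 1 →
      ∀ W : ℝ → ℝ, ContDiff ℝ 3 W →
      ∀ K : EuclideanSpace ℝ (Fin n) → ℝ, IsKernelL2 s lam Lam K →
      ∀ R : ℝ, 0 < R →
      ∀ u : EuclideanSpace ℝ (Fin n) → ℝ, (∀ x, u x ∈ Set.Ioo (-1 : ℝ) 1) →
        IsStableNonlocalSolution K W (Metric.ball 0 (2 * R)) u →
        sobolevEnergy K (Metric.ball 0 R) u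
          ≤ ENNReal.ofReal (C / (1 - s) ^ 2 * R ^ ((n : ℝ) - s)) := by
  have hn0 : 0 < n := by linarith
  obtain ⟨C, hC, hV⟩ := exists_ballVariation_bound hn0 hs₀ hlam hLam
  obtain ⟨C₃, hC₃, hloc⟩ := exists_localization n
  set β := (volume : Measure (EuclideanSpace ℝ (Fin n))).real (Metric.ball 0 1)
  have hβ : 0 < β :=
    ENNReal.toReal_pos (Metric.measure_ball_pos _ _ one_pos).ne' measure_ball_lt_top.ne
  have hσ := sphereArea_pos hn0
  set σ := sphereArea n
  refine ⟨2 * Lam * (2 * σ * (C + 4 * C₃ * 2 ^ n + 2 * 2 ^ n * β / s₀) + 16 * β * σ / s₀),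
    by positivity, ?_⟩
  intro s hs hs1 W hW K hK R hR u hu hst
  have hu1 : ∀ x, |u x| ≤ 1 := fun x => abs_le.2 ⟨(hu x).1.le, (hu x).2.le⟩
  have hs0 : 0 < s := hs₀.trans hs
  have h1s : 0 < 1 - s := sub_pos.2 hs1
  have h2s : 0 < 2 - s := by linarith
  have hV := hV s hs hs1 W hW K hK R hR u hu1 hst
  -- `U` equals `u` up to radius `3R/2`, leaving `δ = R/2` for the tail, and vanishes from radius
  -- `7R/4`, where the variation bound is available; the cutoff gap is `R/4`.
  obtain ⟨U, hU, hcU, hU1, -, hUa, hUb, hUV⟩ := hloc u (2 * R) (R + R / 2) (7 / 4 * R)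
    (by linarith) (by linarith) (by linarith) hu1 hst.contDiffOn
  refine (sobolevEnergy_le hn0 hK hlam hLam hs0 hs1 hR (half_pos hR) hu1 hU hcU hUa).trans
    (ENNReal.ofReal_le_ofReal ?_)
  have hE := integral_sq_sub_mul_riesz_le hn0 hs0 hs1 hR (hU.of_le (by norm_num)) hcU hU1
  have hUint := integral_abs_le_of_support (by positivity) hU1 hUb
  set M := R ^ (n - 1)
  have hM0 : 0 < M := by positivity
  have hRn : R ^ n = M * R := (pow_sub_one_mul hn0.ne' R).symm
  have h2 : (2 * R) ^ n = 2 ^ n * (M * R) := by rw [mul_pow, hRn]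
  have hinv : 1 ≤ 1 / (1 - s) := (one_le_div h1s).2 (by linarith)
  -- Only the gradient part of the interpolation carries the full `1/(1-s)²`; the `L¹` part and the
  -- tail carry no such factor and are raised to it.
  have hinv2 : 1 / (1 - s) ≤ 1 / (1 - s) ^ 2 := by
    rw [one_div, one_div, ← inv_pow]
    exact le_self_pow₀ (by simpa using hinv) two_ne_zero
  have a1 : ∫ x, ‖fderiv ℝ U x‖ ≤ (C + 4 * C₃ * 2 ^ n) * M / (1 - s) := by
    calc _ ≤ C / (1 - s) * M + C₃ * ((2 * R) ^ n / (R / 4)) := by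
          refine hUV.trans (add_le_add hV ?_)
          rw [show 7 / 4 * R - (R + R / 2) = R / 4 by ring]
          gcongr
          norm_num
      _ = C * M / (1 - s) + 4 * C₃ * 2 ^ n * M * 1 := by
          rw [h2]
          field_simp
      _ ≤ C * M / (1 - s) + 4 * C₃ * 2 ^ n * M * (1 / (1 - s)) := by gcongr
      _ = _ := by ring
  have a2 : ∫ x, |U x| ≤ 2 ^ n * (M * R) * β := by
    refine hUint.trans ?_
    rw [← h2]
    gcongr
    norm_num
  set Q := R ^ ((n : ℝ) - s) with hQ
  have hQ0 : 0 < Q := Real.rpow_pos_of_pos hR _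
  have hQs : R ^ (-s) * (M * R) = Q := by
    rw [← hRn, ← Real.rpow_natCast, ← Real.rpow_add hR, hQ]
    congr 1
    ring
  have hQ1 : R ^ (1 - s) * M = Q := by
    rw [← hQs, sub_eq_add_neg, Real.rpow_add hR, Real.rpow_one]
    ring
  have hhalf : (R / 2) ^ (-s) ≤ 2 * R ^ (-s) := by
    rw [Real.div_rpow hR.le zero_le_two, Real.rpow_neg zero_le_two, div_inv_eq_mul, mul_comm]
    gcongr
    calc (2 : ℝ) ^ s ≤ 2 ^ (1 : ℝ) := Real.rpow_le_rpow_of_exponent_le one_le_two hs1.le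
      _ = 2 := Real.rpow_one 2
  have hRs : 0 < R ^ (-s) := Real.rpow_pos_of_pos hR _
  have hR1s : 0 < R ^ (1 - s) := Real.rpow_pos_of_pos hR _
  have hE2 : ∫ p : EuclideanSpace ℝ (Fin n) × EuclideanSpace ℝ (Fin n),
      (U p.1 - U p.2) ^ 2 * rieszKernel s (p.1 - p.2) ≤
      2 * σ * (C + 4 * C₃ * 2 ^ n + 2 * 2 ^ n * β / s₀) * (1 / (1 - s) ^ 2 * Q) := by
    refine hE.trans ?_
    calc _ ≤ 2 * σ * (R ^ (1 - s) / (1 - s) * ((C + 4 * C₃ * 2 ^ n) * M / (1 - s)) +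
          R ^ (-s) / s₀ * (2 * (2 ^ n * (M * R) * β))) := by gcongr
      _ = 2 * σ * ((C + 4 * C₃ * 2 ^ n) * (1 / (1 - s) ^ 2 * (R ^ (1 - s) * M)) +
          2 * 2 ^ n * β / s₀ * (1 * (R ^ (-s) * (M * R)))) := by field_simp
      _ ≤ 2 * σ * ((C + 4 * C₃ * 2 ^ n) * (1 / (1 - s) ^ 2 * Q) +
          2 * 2 ^ n * β / s₀ * (1 / (1 - s) ^ 2 * Q)) := by
          rw [hQ1, hQs]
          gcongr
          exact hinv.trans hinv2
      _ = _ := by ring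
  have hT : 8 * (R ^ n * β * (σ * ((R / 2) ^ (-s) / s))) ≤
      16 * β * σ / s₀ * (1 / (1 - s) ^ 2 * Q) := by
    calc _ ≤ 8 * (R ^ n * β * (σ * (2 * R ^ (-s) / s₀))) := by gcongr
      _ = 16 * β * σ / s₀ * (1 * (R ^ (-s) * (M * R))) := by
          rw [hRn]
          ring
      _ ≤ _ := by
          rw [hQs]
          gcongr
          exact hinv.trans hinv2
  calc _ ≤ 2 * Lam * (2 * σ * (C + 4 * C₃ * 2 ^ n + 2 * 2 ^ n * β / s₀) * (1 / (1 - s) ^ 2 * Q) +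
        16 * β * σ / s₀ * (1 / (1 - s) ^ 2 * Q)) := by
        have : 0 ≤ ∫ p : EuclideanSpace ℝ (Fin n) × EuclideanSpace ℝ (Fin n),
            (U p.1 - U p.2) ^ 2 * rieszKernel s (p.1 - p.2) :=
          integral_nonneg fun p => mul_nonneg (sq_nonneg _) (rieszKernel_nonneg s _)
        gcongr
        linarith
    _ = _ := by ring
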